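/- **Setting.** Let $\gamma,\kappa\in\mathbb R$, $q_0>0$, $q_\pm\in\mathbb C$ with $|q_\pm|=q_0$, and put $\omega=q_0^2+6\gamma q_0^4-\kappa$. Let $q(x,t)$ be a classical solution on $\mathbb R^2$ of the focusing nonlinear Schrödinger equation with quartic terms $$iq_t+\tfrac12q_{xx}+|q|^2q-\kappa q+\gamma\big(q_{xxxx}+6|q|^4q+4q\bar q_xq_x+2q^2\bar q_{xx}+6\bar qq_x^2+8|q|^2q_{xx}\big)=0$$ (for $\kappa=0$ this is the bare equation; for $\kappa=q_0^2+6\gamma q_0^4$, i.e. $\omega=0$, the boundary values below do not depend on $t$). It is assumed that $q$ is differentiable in $t$ and $C^4$ in $x$; that $\partial_x^nq$ is continuous on $\mathbb R^2$ for $0\le n\le4$; that for every $t$, $q(x,t)\to q_\pm(t):=q_\pm e^{i\omega t}$ and $\partial_x^nq(x,t)\to0$ $(n=1,2,3)$ as $x\to\pm\infty$; that $\partial_x^nq$ $(0\le n\le 3)$ is bounded on $\mathbb R\times[-T,T]$ for every $T$; and that for every $t$, $q(\cdot,t)-q_\pm(t)$ is integrable on the half-line $\{\pm x\ge0\}$ and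 $q_x(\cdot,t)$ is integrable on $\mathbb R$. Write $$Q=\begin{pmatrix}0&\bar q\\ q&0\end{pmatrix},\quad \sigma_3=\begin{pmatrix}1&0\\0&-1\end{pmatrix},\quad Q_\pm(t)=\begin{pmatrix}0&\overline{q_\pm(t)}\\ q_\pm(t)&0\end{pmatrix},\quad \Omega_\pm(t,z)=I-\tfrac1z\sigma_3Q_\pm(t),$$ $$k=\tfrac12\Big(z+\frac{q_0^2}z\Big),\quad \lambda=\tfrac12\Big(z-\frac{q_0^2}z\Big),\quad \theta(x,t,z)=kx+\big[k(\lambda-8\gamma\lambda^3+4\gamma\lambda q_0^2)-\tfrac{\omega}{2}\big]t .$$ The Lax pair is $\psi_x=(i\lambda\sigma_3+iQ)\psi$, $\psi_t=(-8i\gamma\sigma_3\lambda^4-8i\gamma Q\lambda^3+A_2\lambda^2+A_1\lambda+A_0)\psi$ with $$A_2=i(1+4\gamma Q^2)\sigma_3-4\gamma\sigma_3Q_x,\qquad A_1=2\gamma[Q_x,Q]+i(Q+4\gamma Q^3+2\gamma Q_{xx}),$$ $$A_0=-3i\gamma\sigma_3Q^4+i\gamma\sigma_3Q_x^2-i\gamma\sigma_3(QQ_{xx}+Q_{xx}Q)-\tfrac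 i2\sigma_3Q^2+\tfrac12\sigma_3Q_x+6\gamma\sigma_3Q^2Q_x+\gamma\sigma_3Q_{xxx}+\tfrac{i\kappa}2\sigma_3 .$$ Let $D_\pm=\{z\in\mathbb C:\pm(|z|^2-q_0^2)\,\mathrm{Im}\,z>0\}$, $\mathcal C_0=\{|z|=q_0\}$, $\Sigma=\mathbb R\cup\mathcal C_0$ and $\Sigma^*=\Sigma\setminus\{0,iq_0,-iq_0\}$. The $j$-th Jost column $\Psi_{\pm,j}(x,t,z)$ is the solution of both equations of the Lax pair for which $\mu_{\pm,1}=\Psi_{\pm,1}e^{-i\theta}$, respectively $\mu_{\pm,2}=\Psi_{\pm,2}e^{i\theta}$, tends for every $t$ to the $j$-th column of $\Omega_\pm(t,z)$ as $x\to\pm\infty$. Let $\Psi_\pm=(\Psi_{\pm,1},\Psi_{\pm,2})$, $\mu_\pm=(\mu_{\pm,1},\mu_{\pm,2})$, and, on $\Sigma^*$, let $S(z)=(s_{ij}(z))=\Psi_-(0,0,z)^{-1}\Psi_+(0,0,z)$, $b=s_{21}$, $\rho=s_{21}/s_{11}$, $\tilde\rho=s_{12}/s_{22}$. On $D_+\cup\Sigma^*$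 let $a(z)=\det(\Psi_{+,1},\Psi_{-,2})(0,0,z)\,/\,(1+q_0^2/z^2)$. Put $$M^+=\Big(\frac{\mu_{+,1}}{a(z)},\ \mu_{-,2}\Big)\ \text{ on } D_+\cup\Sigma^*,\qquad M^-=\Big(\mu_{-,1},\ \frac{\mu_{+,2}}{\overline{a(\bar z)}}\Big)\ \text{ on } D_-\cup\Sigma^*,$$ and $M=M^\pm$ on $D_\pm$. **Proposition 3.1.** The Jost columns $\Psi_{+,1},\Psi_{-,2}$ for $z\in D_+\cup\Sigma^*$ and $\Psi_{-,1},\Psi_{+,2}$ for $z\in D_-\cup\Sigma^*$ exist and are unique. On $\Sigma^*$, $\mu_+=\mu_-e^{i\theta\sigma_3}S(z)e^{-i\theta\sigma_3}$ for all $x,t\in\mathbb R$, and $S(z)=\begin{pmatrix}a(z)&-\overline{b(\bar z)}\\ b(z)&\overline{a(\bar z)}\end{pmatrix}$; the function $a$ is analytic in $D_+$ and continuous on $D_+\cup\Sigma^*$. For all $x,t\in\mathbb R$ the matrix $M(x,t,z)$ solves the following Riemann–Hilbert problem. * Analyticity: $M(x,t,\cdot)$ is meromorphic in $D_+\cup D_-$.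 * Jump condition: at every $z\in\Sigma^*$ with $s_{11}(z)\neq0$ and $s_{22}(z)\ne0$ (that is, where $\rho$ and $\tilde\rho$ are defined), $M$ has the limits $M^\pm(x,t,z)$ from $D_\pm$, and $$M^+(x,t,z)=M^-(x,t,z)\begin{pmatrix}1-\rho\tilde\rho&-e^{2i\theta}\tilde\rho\\ e^{-2i\theta}\rho&1\end{pmatrix}.$$ * Asymptotic behaviour: for fixed $x,t$ and $z\in D_+\cup D_-$, $M(x,t,z)=I+O(1/z)$ as $z\to\infty$, and $M(x,t,z)=-\frac1z\sigma_3Q_-(t)+O(1)$ as $z\to0$. -/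

import Mathlib

open Set Filter Topology Matrix Asymptotics
open scoped ComplexConjugate

noncomputable section

namespace QNLS

/-- The data of the problem: the real parameters `γ`, `κ`, the background amplitude `q₀`, the
boundary values `qPlus`, `qMinus` at time `0`, and the field `q x t`.

The equation is `i q_t + q_xx / 2 + |q|² q - κ q + γ (...) = 0`.  The term `κ q` only rotates the
phase of `q`: `κ = 0` is the bare equation, and for `κ = q₀² + 6 γ q₀⁴` constant backgrounds of
amplitude `q₀` do not depend on time. -/
structure Data where
  γ : ℝ
  κ : ℝ
  q₀ : ℝ
  qPlus : ℂ
  qMinus : ℂ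
  q : ℝ → ℝ → ℂ

/-- The two ends of the `x`-axis. -/
inductive Side
  | minus
  | plus

/-- `x → -∞` or `x → +∞`. -/
def Side.filter : Side → Filter ℝ
  | .minus => atBot
  | .plus => atTop

/-- The half-line towards the given end. -/
def Side.halfLine : Side → Set ℝ
  | .minus => Iic 0
  | .plus => Ici 0

namespace Data

variable (E : Data)

/-- Frequency of the background: a spatially constant solution of modulus `q₀` is a multiple of
`exp (i ω t)`. -/
def ω : ℝ := E.q₀ ^ 2 + 6 * E.γ * E.q₀ ^ 4 - E.κ

/-- The boundary value `q_±(t)`. -/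
def qLim (s : Side) (t : ℝ) : ℂ :=
  (match s with
    | .minus => E.qMinus
    | .plus => E.qPlus) * Complex.exp (Complex.I * E.ω * t)

/-- The partial derivative `∂ₓⁿ q` at `(x, t)`. -/
def dx (n : ℕ) (x t : ℝ) : ℂ := iteratedDeriv n (fun y => E.q y t) x

/-- The partial derivative `∂ₜ q` at `(x, t)`. -/
def dt (x t : ℝ) : ℂ := deriv (fun s => E.q x s) t

/-- The nonlinear Schrödinger equation with quartic terms at the point `(x, t)`. -/
def Equation (x t : ℝ) : Prop :=
  let q := E.q x t
  let q₁ := E.dx 1 x t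
  let q₂ := E.dx 2 x t
  let q₄ := E.dx 4 x t
  Complex.I * E.dt x t + (1 / 2) * q₂ + (‖q‖ : ℂ) ^ 2 * q - E.κ * q
    + E.γ * (q₄ + 6 * (‖q‖ : ℂ) ^ 4 * q + 4 * q * conj q₁ * q₁ + 2 * q ^ 2 * conj q₂
      + 6 * conj q * q₁ ^ 2 + 8 * (‖q‖ : ℂ) ^ 2 * q₂) = 0

/-- `q` is a classical solution with non-vanishing boundary values `q_±`, `|q_±| = q₀ > 0`, which
approaches these values integrably and has an integrable `x`-derivative. -/
structure IsSolution : Prop where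
  q₀_pos : 0 < E.q₀
  norm_qPlus : ‖E.qPlus‖ = E.q₀
  norm_qMinus : ‖E.qMinus‖ = E.q₀
  contDiff_x : ∀ t, ContDiff ℝ 4 (fun x => E.q x t)
  differentiable_t : ∀ x, Differentiable ℝ (fun t => E.q x t)
  continuous_dx : ∀ n ≤ 4, Continuous (fun p : ℝ × ℝ => E.dx n p.1 p.2)
  equation : ∀ x t, E.Equation x t
  tendsto_q : ∀ (s : Side) (t : ℝ), Tendsto (fun x => E.q x t) s.filter (𝓝 (E.qLim s t))
  tendsto_dx : ∀ n ∈ Finset.Icc 1 3, ∀ (s : Side) (t : ℝ),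
    Tendsto (fun x => E.dx n x t) s.filter (𝓝 0)
  bounded_dx : ∀ n ≤ 3, ∀ T : ℝ, ∃ C : ℝ, ∀ x t : ℝ, |t| ≤ T → ‖E.dx n x t‖ ≤ C
  integrable_q : ∀ (s : Side) (t : ℝ),
    MeasureTheory.IntegrableOn (fun x => E.q x t - E.qLim s t) s.halfLine
  integrable_dx : ∀ t : ℝ, MeasureTheory.Integrable (fun x => E.dx 1 x t)

/-! ### The Lax pair -/

/-- The Pauli matrix `σ₃`. -/
def σ₃ : Matrix (Fin 2) (Fin 2) ℂ := !![1, 0; 0, -1]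

/-- The Hermitian off-diagonal matrix with lower left entry `u` and upper right entry `conj u`. -/
def potential (u : ℂ) : Matrix (Fin 2) (Fin 2) ℂ := !![0, conj u; u, 0]

/-- `∂ₓⁿ Q`; for `n = 0` this is `Q` itself. -/
def Q (n : ℕ) (x t : ℝ) : Matrix (Fin 2) (Fin 2) ℂ := potential (E.dx n x t)

/-- `Q_±(t)`. -/
def QLim (s : Side) (t : ℝ) : Matrix (Fin 2) (Fin 2) ℂ := potential (E.qLim s t)

/-- The uniformizing variable: `k = (z + q₀² / z) / 2`. -/
def k (z : ℂ) : ℂ := (z + (E.q₀ : ℂ) ^ 2 / z) / 2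

/-- The spectral parameter `λ = (z - q₀² / z) / 2`. -/
def lam (z : ℂ) : ℂ := (z - (E.q₀ : ℂ) ^ 2 / z) / 2

/-- The matrix of the `x`-part of the Lax pair, `i λ σ₃ + i Q`. -/
def laxX (x t : ℝ) (z : ℂ) : Matrix (Fin 2) (Fin 2) ℂ :=
  (Complex.I * E.lam z) • σ₃ + Complex.I • E.Q 0 x t

/-- The coefficient `A₂` of `λ²` in the `t`-part of the Lax pair. -/
def A₂ (x t : ℝ) : Matrix (Fin 2) (Fin 2) ℂ :=
  Complex.I • ((1 + (4 * E.γ : ℂ) • E.Q 0 x t ^ 2) * σ₃) - (4 * E.γ : ℂ) • (σ₃ * E.Q 1 x t)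

/-- The coefficient `A₁` of `λ` in the `t`-part of the Lax pair. -/
def A₁ (x t : ℝ) : Matrix (Fin 2) (Fin 2) ℂ :=
  (2 * E.γ : ℂ) • (E.Q 1 x t * E.Q 0 x t - E.Q 0 x t * E.Q 1 x t)
    + Complex.I • (E.Q 0 x t + (4 * E.γ : ℂ) • E.Q 0 x t ^ 3 + (2 * E.γ : ℂ) • E.Q 2 x t)

/-- The coefficient `A₀` in the `t`-part of the Lax pair; the last summand accounts for the term
`κ q` of the equation. -/
def A₀ (x t : ℝ) : Matrix (Fin 2) (Fin 2) ℂ :=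
  -(3 * Complex.I * E.γ) • (σ₃ * E.Q 0 x t ^ 4) + (Complex.I * E.γ) • (σ₃ * E.Q 1 x t ^ 2)
    - (Complex.I * E.γ) • (σ₃ * (E.Q 0 x t * E.Q 2 x t + E.Q 2 x t * E.Q 0 x t))
    - (Complex.I / 2) • (σ₃ * E.Q 0 x t ^ 2) + (1 / 2 : ℂ) • (σ₃ * E.Q 1 x t)
    + (6 * E.γ : ℂ) • (σ₃ * E.Q 0 x t ^ 2 * E.Q 1 x t) + (E.γ : ℂ) • (σ₃ * E.Q 3 x t)
    + (Complex.I * E.κ / 2) • σ₃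

/-- The matrix of the `t`-part of the Lax pair. -/
def laxT (x t : ℝ) (z : ℂ) : Matrix (Fin 2) (Fin 2) ℂ :=
  -(8 * Complex.I * E.γ * E.lam z ^ 4) • σ₃ - (8 * Complex.I * E.γ * E.lam z ^ 3) • E.Q 0 x t
    + E.lam z ^ 2 • E.A₂ x t + E.lam z • E.A₁ x t + E.A₀ x t

/-- The phase `θ(x, t, z)`. -/
def θ (x t : ℝ) (z : ℂ) : ℂ :=
  E.k z * x
    + (E.k z * (E.lam z - 8 * E.γ * E.lam z ^ 3 + 4 * E.γ * E.lam z * (E.q₀ : ℂ) ^ 2)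
      - E.ω / 2) * t

/-- `Ω_±(z) = I - σ₃ Q_± / z`. -/
def Ω (s : Side) (t : ℝ) (z : ℂ) : Matrix (Fin 2) (Fin 2) ℂ := 1 - z⁻¹ • (σ₃ * E.QLim s t)

/-- `exp (i w σ₃)`. -/
def expσ₃ (w : ℂ) : Matrix (Fin 2) (Fin 2) ℂ :=
  !![Complex.exp (Complex.I * w), 0; 0, Complex.exp (-(Complex.I * w))]

/-! ### The regions of the `z`-plane -/

/-- The open region `D₊`. -/
def Dp : Set ℂ := {z | 0 < (‖z‖ ^ 2 - E.q₀ ^ 2) * z.im}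

/-- The open region `D₋`. -/
def Dm : Set ℂ := {z | (‖z‖ ^ 2 - E.q₀ ^ 2) * z.im < 0}

/-- The contour `Σ = ℝ ∪ C₀` without the origin, where `k` and `λ` have a pole, and without the
branch points `± i q₀`. -/
def contour : Set ℂ :=
  {z | (z.im = 0 ∨ ‖z‖ = E.q₀) ∧ z ≠ 0 ∧ z ≠ Complex.I * E.q₀ ∧ z ≠ -(Complex.I * E.q₀)}

/-- The set of `z` for which the `j`-th column of the Jost solution at the given end is considered:
the columns `Ψ_{+,1}`, `Ψ_{-,2}` live on `D₊ ∪ Σ`, the columns `Ψ_{-,1}`, `Ψ_{+,2}` on `D₋ ∪ Σ`. -/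
def jostDomain : Side → Fin 2 → Set ℂ
  | .plus, 0 => E.Dp ∪ E.contour
  | .minus, 1 => E.Dp ∪ E.contour
  | .minus, 0 => E.Dm ∪ E.contour
  | .plus, 1 => E.Dm ∪ E.contour

/-! ### Jost solutions and scattering data -/

/-- `modified j z Ψ` is `Ψ exp (-i θ)` for a first column (`j = 0`) and `Ψ exp (i θ)` for a second
column (`j = 1`). -/
def modified (j : Fin 2) (z : ℂ) (Ψ : ℝ → ℝ → Fin 2 → ℂ) (x t : ℝ) : Fin 2 → ℂ :=
  (expσ₃ (-(E.θ x t z))) j j • Ψ x t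

/-- `Ψ` is the `j`-th column of the Jost solution at the end `s`: it solves both equations of the
Lax pair, and `Ψ exp (∓ i θ)` tends to the `j`-th column of `Ω_±` as `x → ±∞`. -/
structure IsJostColumn (s : Side) (j : Fin 2) (z : ℂ) (Ψ : ℝ → ℝ → Fin 2 → ℂ) : Prop where
  eq_x : ∀ x t, HasDerivAt (fun y => Ψ y t) (E.laxX x t z *ᵥ Ψ x t) x
  eq_t : ∀ x t, HasDerivAt (fun r => Ψ x r) (E.laxT x t z *ᵥ Ψ x t) t
  tendsto : ∀ t, Tendsto (fun x => E.modified j z Ψ x t) s.filter (𝓝 fun i => E.Ω s t z i j)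

/-- The `j`-th column of the Jost solution `Ψ_±(x, t, z)`. -/
def Ψ (s : Side) (j : Fin 2) (z : ℂ) : ℝ → ℝ → Fin 2 → ℂ :=
  Classical.epsilon (E.IsJostColumn s j z)

/-- The `j`-th column `μ_{±,j}(x, t, z)` of the modified Jost solution. -/
def μ (s : Side) (j : Fin 2) (x t : ℝ) (z : ℂ) : Fin 2 → ℂ := E.modified j z (E.Ψ s j z) x t

/-- The matrix with columns `u` and `v`. -/
def ofCols (u v : Fin 2 → ℂ) : Matrix (Fin 2) (Fin 2) ℂ := !![u 0, v 0; u 1, v 1]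

/-- The Jost solution `Ψ_±` as a matrix. -/
def ΨMat (s : Side) (x t : ℝ) (z : ℂ) : Matrix (Fin 2) (Fin 2) ℂ :=
  ofCols (E.Ψ s 0 z x t) (E.Ψ s 1 z x t)

/-- The modified Jost solution `μ_±` as a matrix. -/
def μMat (s : Side) (x t : ℝ) (z : ℂ) : Matrix (Fin 2) (Fin 2) ℂ :=
  ofCols (E.μ s 0 x t z) (E.μ s 1 x t z)

/-- The scattering matrix, `Ψ_+ = Ψ_- S`, read off at `(x, t) = (0, 0)`. -/
def S (z : ℂ) : Matrix (Fin 2) (Fin 2) ℂ := (E.ΨMat .minus 0 0 z)⁻¹ * E.ΨMat .plus 0 0 z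

/-- The scattering coefficient `a(z)` on `D₊ ∪ Σ`: the Wronskian of `Ψ_{+,1}` and `Ψ_{-,2}` over
`det Ψ_- = 1 + q₀² / z²`. On the contour this is `s₁₁`, which it continues analytically to `D₊`. -/
def a (z : ℂ) : ℂ :=
  (ofCols (E.Ψ .plus 0 z 0 0) (E.Ψ .minus 1 z 0 0)).det / (1 + (E.q₀ : ℂ) ^ 2 / z ^ 2)

/-- The scattering coefficient `b = s₂₁` on the contour. -/
def b (z : ℂ) : ℂ := E.S z 1 0

/-- The reflection coefficient `ρ = s₂₁ / s₁₁` on the contour. -/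
def ρ (z : ℂ) : ℂ := E.S z 1 0 / E.S z 0 0

/-- The reflection coefficient `ρ̃ = s₁₂ / s₂₂` on the contour. -/
def ρTilde (z : ℂ) : ℂ := E.S z 0 1 / E.S z 1 1

/-! ### The Riemann–Hilbert problem -/

/-- `M⁺`, on `D₊ ∪ Σ`. -/
def MPlus (x t : ℝ) (z : ℂ) : Matrix (Fin 2) (Fin 2) ℂ :=
  ofCols ((E.a z)⁻¹ • E.μ .plus 0 x t z) (E.μ .minus 1 x t z)

/-- `M⁻`, on `D₋ ∪ Σ`. -/
def MMinus (x t : ℝ) (z : ℂ) : Matrix (Fin 2) (Fin 2) ℂ :=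
  ofCols (E.μ .minus 0 x t z) ((conj (E.a (conj z)))⁻¹ • E.μ .plus 1 x t z)

open Classical in
/-- The sectionally meromorphic matrix: `M⁺` on `D₊` and `M⁻` on `D₋`. -/
def M (x t : ℝ) (z : ℂ) : Matrix (Fin 2) (Fin 2) ℂ :=
  if z ∈ E.Dp then E.MPlus x t z else E.MMinus x t z

/-- The jump matrix. -/
def jump (x t : ℝ) (z : ℂ) : Matrix (Fin 2) (Fin 2) ℂ :=
  !![1 - E.ρ z * E.ρTilde z, -(Complex.exp (2 * Complex.I * E.θ x t z) * E.ρTilde z);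
    Complex.exp (-(2 * Complex.I * E.θ x t z)) * E.ρ z, 1]

end Data

end QNLS

end

open Set Filter Topology Matrix Asymptotics
open scoped ComplexConjugate

noncomputable section

namespace QNLS

open MeasureTheory

/-! Only one column has to be constructed. At fixed time, changing the signs of `x`, `q` and `z`
exchanges the two ends of the axis, and the antiunitary map `flip` together with `z ↦ conj z`
exchanges the two columns. Hence every Jost column is a transformed first column at `+∞`
(`modJost`). The matrix `Ω` diagonalizes the limiting spatial equation. After conjugation with it,
the column solves a Volterra equation on `(x, ∞)` whose kernel is integrable because `q - q_±` is,
and whose exponential `exp (2 i k (y - x))` is bounded by 1 since `Im k ≥ 0` on `D₊ ∪ Σ*`. In the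
weighted norm given by `exp (2 ∫_x^∞ g)` the Volterra operator is a contraction with factor 1/2.
This yields existence and uniqueness (`isModified_jost`, `jost_unique`); the Picard iterates
converge locally uniformly in `z`, which yields continuity up to `Σ*` and analyticity inside.

The nonlinear equation is the zero-curvature condition of the Lax pair (`zero_curvature`). A column
given at `t = 0` and continued by the `t`-equation therefore keeps solving the `x`-equation
(`hasDerivAt_of_zero_curvature`). Its normalization persists because the `t`-matrix converges as `x
→ ±∞` and the columns of `Ω`, with their phases in `t`, solve the limiting equation
(`tendsto_linear_ode`, `hasDerivAt_background`).

On `Σ*` the determinant of `Ψ_±` is the nonzero constant `1 + q₀² / z²`, so `Ψ_+ = Ψ_- S` with `S`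
independent of `x` and `t` (`ΨMat_plus`). The entries of `S` are Wronskians of columns; `flip` gives
the symmetry of `S`, and analyticity of the columns gives that of `a`. The jump condition is a
rearrangement of `Ψ_+ = Ψ_- S`.

For `z → ∞` the kernel in the constant gauge does not become small. Replacing the boundary value in
`Ω` by `q` itself produces a kernel of order `1 / z`, built from `|q|² - q₀²` and `q_x`; this is
where integrability of `q_x` enters (`exists_isVolterra_moving`, `jost_sub_le`). The behaviour at `z
= 0` follows by the symmetry `z ↦ -q₀² / conj z` (`jost_symm`). Finally `M⁻(z)` is the reflection of
`M⁺(conj z)` (`MMinus_eq`), so all statements about `M` need a proof on `D₊` only. -/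

/-! ### Matrix and vector preliminaries -/

/-- The sum of the absolute values of the entries of a `2 × 2` matrix. -/
def entrySum (A : Matrix (Fin 2) (Fin 2) ℂ) : ℝ := ∑ i, ∑ j, ‖A i j‖

lemma entrySum_eq (A : Matrix (Fin 2) (Fin 2) ℂ) :
    entrySum A = ‖A 0 0‖ + ‖A 0 1‖ + (‖A 1 0‖ + ‖A 1 1‖) := by
  simp [entrySum, Fin.sum_univ_two]

lemma entrySum_nonneg (A : Matrix (Fin 2) (Fin 2) ℂ) : 0 ≤ entrySum A := by
  rw [entrySum_eq]; positivity

lemma continuous_entrySum : Continuous entrySum := by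
  unfold entrySum; fun_prop

lemma mulVec_fin_two (A : Matrix (Fin 2) (Fin 2) ℂ) (v : Fin 2 → ℂ) :
    A *ᵥ v = ![A 0 0 * v 0 + A 0 1 * v 1, A 1 0 * v 0 + A 1 1 * v 1] := by
  ext i; fin_cases i <;> simp [Matrix.mulVec, dotProduct, Fin.sum_univ_two]

lemma norm_mulVec_le (A : Matrix (Fin 2) (Fin 2) ℂ) (v : Fin 2 → ℂ) :
    ‖A *ᵥ v‖ ≤ entrySum A * ‖v‖ := by
  have h0 := norm_le_pi_norm v 0
  have h1 := norm_le_pi_norm v 1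
  have key : ∀ a b : ℂ, ‖a * v 0 + b * v 1‖ ≤ (‖a‖ + ‖b‖) * ‖v‖ := fun a b => by
    refine (norm_add_le _ _).trans ?_
    rw [norm_mul, norm_mul, add_mul]
    gcongr
  rw [entrySum_eq, pi_norm_le_iff_of_nonneg (by positivity), mulVec_fin_two]
  intro i
  fin_cases i
  · exact (key _ _).trans (mul_le_mul_of_nonneg_right
      (le_add_of_nonneg_right (by positivity)) (norm_nonneg _))
  · exact (key _ _).trans (mul_le_mul_of_nonneg_right
      (le_add_of_nonneg_left (by positivity)) (norm_nonneg _))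

lemma entrySum_mul_le (A B : Matrix (Fin 2) (Fin 2) ℂ) :
    entrySum (A * B) ≤ entrySum A * entrySum B := by
  have key : ∀ a b c d : ℂ, ‖a * b + c * d‖ ≤ ‖a‖ * ‖b‖ + ‖c‖ * ‖d‖ := fun a b c d => by
    refine (norm_add_le _ _).trans ?_
    rw [norm_mul, norm_mul]
  simp only [entrySum_eq, Matrix.mul_apply, Fin.sum_univ_two]
  have := key (A 0 0) (B 0 0) (A 0 1) (B 1 0)
  have := key (A 0 0) (B 0 1) (A 0 1) (B 1 1)
  have := key (A 1 0) (B 0 0) (A 1 1) (B 1 0)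
  have := key (A 1 0) (B 0 1) (A 1 1) (B 1 1)
  have h := norm_nonneg (A 0 0)
  have : 0 ≤ ‖A 0 0‖ * ‖B 1 0‖ := by positivity
  have : 0 ≤ ‖A 0 0‖ * ‖B 1 1‖ := by positivity
  have : 0 ≤ ‖A 0 1‖ * ‖B 0 0‖ := by positivity
  have : 0 ≤ ‖A 0 1‖ * ‖B 0 1‖ := by positivity
  have : 0 ≤ ‖A 1 0‖ * ‖B 1 0‖ := by positivity
  have : 0 ≤ ‖A 1 0‖ * ‖B 1 1‖ := by positivity
  have : 0 ≤ ‖A 1 1‖ * ‖B 0 0‖ := by positivity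
  have : 0 ≤ ‖A 1 1‖ * ‖B 0 1‖ := by positivity
  nlinarith

lemma entrySum_smul (a : ℂ) (A : Matrix (Fin 2) (Fin 2) ℂ) :
    entrySum (a • A) = ‖a‖ * entrySum A := by
  simp only [entrySum_eq, Matrix.smul_apply, smul_eq_mul, norm_mul]; ring

/-- The action of `diag (1, exp w)` on a vector. -/
def twist (w : ℂ) (u : Fin 2 → ℂ) : Fin 2 → ℂ := ![u 0, Complex.exp w * u 1]

lemma norm_twist_le {w : ℂ} (hw : w.re ≤ 0) (u : Fin 2 → ℂ) : ‖twist w u‖ ≤ ‖u‖ := by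
  rw [pi_norm_le_iff_of_nonneg (norm_nonneg _)]
  intro i
  fin_cases i
  · exact norm_le_pi_norm u 0
  · simp only [twist, Fin.mk_one, cons_val_one, cons_val_fin_one, norm_mul, Complex.norm_exp]
    calc Real.exp w.re * ‖u 1‖ ≤ 1 * ‖u 1‖ := by gcongr; exact Real.exp_le_one_iff.2 hw
      _ ≤ ‖u‖ := by rw [one_mul]; exact norm_le_pi_norm u 1

lemma twist_sub (w : ℂ) (u v : Fin 2 → ℂ) : twist w (u - v) = twist w u - twist w v := by
  ext i; fin_cases i <;> simp [twist, mul_sub]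

lemma continuous_twist : Continuous fun p : ℂ × (Fin 2 → ℂ) => twist p.1 p.2 := by
  refine continuous_pi fun i => ?_
  fin_cases i
  · change Continuous fun p : ℂ × (Fin 2 → ℂ) => p.2 0
    fun_prop
  · change Continuous fun p : ℂ × (Fin 2 → ℂ) => Complex.exp p.1 * p.2 1
    fun_prop

/-! ### Integrals over half-lines -/

lemma hasDerivAt_integral_Ioi {F : Type*} [NormedAddCommGroup F] [NormedSpace ℝ F]
    [CompleteSpace F] {h : ℝ → F} (hc : Continuous h) (hi : ∀ x, IntegrableOn h (Ioi x)) (x : ℝ) :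
    HasDerivAt (fun x => ∫ y in Ioi x, h y) (-h x) x := by
  have h1 : HasDerivAt (fun u => ∫ y in x..u, h y) (h x) x :=
    intervalIntegral.integral_hasDerivAt_right (by simp)
      (hc.stronglyMeasurableAtFilter _ _) hc.continuousAt
  have : (fun u => ∫ y in Ioi u, h y) = fun u => (∫ y in Ioi x, h y) - ∫ y in x..u, h y := by
    ext u
    rw [← intervalIntegral.integral_Ioi_sub_Ioi' (hi x) (hi u)]
    abel
  rw [this]
  exact h1.const_sub _

/-- A continuous nonnegative function which is integrable at `+∞`. -/
structure IsMajorant (g : ℝ → ℝ) : Prop where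
  cont : Continuous g
  nonneg : ∀ x, 0 ≤ g x
  int : ∀ x, IntegrableOn g (Ioi x)

/-- The weight `exp (2 ∫_x^∞ g)`, which absorbs the Volterra kernel. -/
def weight (g : ℝ → ℝ) (x : ℝ) : ℝ := Real.exp (2 * ∫ y in Ioi x, g y)

lemma tendsto_integral_Ioi_atTop {F : Type*} [NormedAddCommGroup F] [NormedSpace ℝ F]
    [CompleteSpace F] {h : ℝ → F} (hi : ∀ x, IntegrableOn h (Ioi x)) :
    Tendsto (fun x => ∫ y in Ioi x, h y) atTop (𝓝 0) := by
  have h1 := intervalIntegral_tendsto_integral_Ioi 0 (hi 0) tendsto_id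
  have h2 := h1.const_sub (∫ y in Ioi 0, h y)
  rw [sub_self] at h2
  refine h2.congr fun x => ?_
  simp only [id]
  rw [← intervalIntegral.integral_Ioi_sub_Ioi' (hi 0) (hi x)]
  abel

namespace IsMajorant

variable {g : ℝ → ℝ} (hg : IsMajorant g)
include hg

lemma one_le_weight (x : ℝ) : 1 ≤ weight g x :=
  Real.one_le_exp (mul_nonneg zero_le_two (integral_nonneg fun y => hg.nonneg y))

lemma hasDerivAt_weight (x : ℝ) : HasDerivAt (weight g) (-(2 * (weight g x * g x))) x := by
  have := ((hasDerivAt_integral_Ioi hg.cont hg.int x).const_mul 2).exp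
  refine this.congr_deriv ?_
  simp only [weight]; ring

lemma continuous_weight : Continuous (weight g) :=
  continuous_iff_continuousAt.2 fun x => (hg.hasDerivAt_weight x).continuousAt

lemma antitone_weight : Antitone (weight g) :=
  antitone_of_hasDerivAt_nonpos hg.hasDerivAt_weight fun x => by
    have := hg.one_le_weight x
    have := hg.nonneg x
    exact neg_nonpos.2 (by positivity)

lemma integrable_weight_mul (x : ℝ) : IntegrableOn (fun y => weight g y * g y) (Ioi x) := by
  refine Integrable.mono' ((hg.int x).const_mul (weight g x))
    (hg.continuous_weight.mul hg.cont).aestronglyMeasurable ?_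
  filter_upwards [ae_restrict_mem measurableSet_Ioi] with y hy
  have h1 := hg.one_le_weight y
  have h2 := hg.nonneg y
  rw [Real.norm_of_nonneg (by positivity)]
  gcongr
  exact hg.antitone_weight (le_of_lt hy)

/-- The derivative of `weight g` is `-2 g` times itself and its limit at `+∞` is 1, so the integral
equals `(weight g x - 1) / 2`. This is the source of the contraction factor 1/2. -/
lemma integral_weight_mul_le (x : ℝ) : ∫ y in Ioi x, weight g y * g y ≤ weight g x / 2 := by
  have h1 : Tendsto (weight g) atTop (𝓝 1) := by
    have := (Real.continuous_exp.tendsto _).comp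
      ((tendsto_integral_Ioi_atTop hg.int).const_mul 2)
    simpa using! this
  have h2 := integral_Ioi_of_hasDerivAt_of_tendsto' (a := x) (m := 1)
    (fun y _ => hg.hasDerivAt_weight y) (((hg.integrable_weight_mul x).const_mul 2).neg) h1
  rw [integral_neg, integral_const_mul] at h2
  linarith

end IsMajorant

/-! ### Volterra equations -/

/-- The Volterra operator `v ↦ ∫_x^∞ diag (1, exp (c (y - x))) B(y) v(y) dy`. -/
def volterra (c : ℂ) (B : ℝ → Matrix (Fin 2) (Fin 2) ℂ) (v : ℝ → Fin 2 → ℂ) (x : ℝ) : Fin 2 → ℂ :=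
  ∫ y in Ioi x, twist (c * (y - x)) (B y *ᵥ v y)

/-- The data of a Volterra equation whose kernel is dominated by `g`. -/
structure IsVolterra (g : ℝ → ℝ) (c : ℂ) (B : ℝ → Matrix (Fin 2) (Fin 2) ℂ) : Prop where
  maj : IsMajorant g
  cont : Continuous B
  le : ∀ y, entrySum (B y) ≤ g y
  re_nonpos : c.re ≤ 0

namespace IsVolterra

variable {g : ℝ → ℝ} {c : ℂ} {B : ℝ → Matrix (Fin 2) (Fin 2) ℂ} (h : IsVolterra g c B)
include h

lemma norm_kernel_le {x y : ℝ} (hxy : x ≤ y) (v : Fin 2 → ℂ) :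
    ‖twist (c * (y - x)) (B y *ᵥ v)‖ ≤ g y * ‖v‖ := by
  refine (norm_twist_le ?_ _).trans ((norm_mulVec_le _ _).trans ?_)
  · have : (c * (y - x)).re = c.re * (y - x) := by
      rw [← Complex.ofReal_sub, Complex.re_mul_ofReal]
    rw [this]
    exact mul_nonpos_of_nonpos_of_nonneg h.re_nonpos (sub_nonneg.2 hxy)
  · gcongr
    exact h.le y

omit h in
lemma continuous_kernel (hB : Continuous B) {v : ℝ → Fin 2 → ℂ} (hv : Continuous v) (x : ℝ) :
    Continuous fun y : ℝ => twist (c * (y - x)) (B y *ᵥ v y) :=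
  continuous_twist.comp ((by fun_prop : Continuous fun y : ℝ => c * ((y : ℂ) - x)).prodMk
    (hB.matrix_mulVec hv))

lemma norm_kernel_le_weight {v : ℝ → Fin 2 → ℂ} {M : ℝ} {x y : ℝ} (hxy : x < y)
    (hv : ‖v y‖ ≤ M * weight g y) :
    ‖twist (c * (y - x)) (B y *ᵥ v y)‖ ≤ M * (weight g y * g y) := by
  refine (h.norm_kernel_le hxy.le _).trans ?_
  have := mul_le_mul_of_nonneg_left hv (h.maj.nonneg y)
  linarith

lemma integrable_kernel {v : ℝ → Fin 2 → ℂ} (hv : Continuous v) {M : ℝ} {x : ℝ}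
    (hM : ∀ y, x < y → ‖v y‖ ≤ M * weight g y) :
    IntegrableOn (fun y : ℝ => twist (c * (y - x)) (B y *ᵥ v y)) (Ioi x) := by
  refine Integrable.mono' ((h.maj.integrable_weight_mul x).const_mul M)
    (continuous_kernel h.cont hv x).aestronglyMeasurable ?_
  filter_upwards [ae_restrict_mem measurableSet_Ioi] with y hy
  exact h.norm_kernel_le_weight hy (hM y hy)

/-- The operator halves the best constant `M` in a bound `‖v‖ ≤ M * weight g`. The bound is required
only to the right of `x`, so the estimate can be iterated on a half-line. -/
lemma norm_volterra_le {v : ℝ → Fin 2 → ℂ} {M : ℝ} (hM0 : 0 ≤ M) {x : ℝ}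
    (hM : ∀ y, x < y → ‖v y‖ ≤ M * weight g y) :
    ‖volterra c B v x‖ ≤ M * weight g x / 2 := by
  refine (norm_integral_le_of_norm_le ((h.maj.integrable_weight_mul x).const_mul M) ?_).trans ?_
  · filter_upwards [ae_restrict_mem measurableSet_Ioi] with y hy
    exact h.norm_kernel_le_weight hy (hM y hy)
  · rw [integral_const_mul, mul_div_assoc]
    gcongr
    exact h.maj.integral_weight_mul_le x

lemma volterra_sub {v w : ℝ → Fin 2 → ℂ} (hv : Continuous v) (hw : Continuous w) {M N : ℝ} {x : ℝ}
    (hM : ∀ y, x < y → ‖v y‖ ≤ M * weight g y) (hN : ∀ y, x < y → ‖w y‖ ≤ N * weight g y) :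
    volterra c B v x - volterra c B w x = volterra c B (v - w) x := by
  simp only [volterra]
  rw [← integral_sub (h.integrable_kernel hv hM) (h.integrable_kernel hw hN)]
  simp only [Pi.sub_apply, Matrix.mulVec_sub, twist_sub]

lemma hasDerivAt_volterra {v : ℝ → Fin 2 → ℂ} (hv : Continuous v) {M : ℝ}
    (hM : ∀ y, ‖v y‖ ≤ M * weight g y) (x : ℝ) :
    HasDerivAt (volterra c B v) (-(B x *ᵥ v x) - ![0, c * volterra c B v x 1]) x := by
  have hBv : Continuous fun y => B y *ᵥ v y := h.cont.matrix_mulVec hv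
  have hint := fun x => h.integrable_kernel hv (x := x) fun y _ => hM y
  have hi0 : ∀ x, IntegrableOn (fun y => (B y *ᵥ v y) 0) (Ioi x) := fun x =>
    (hint x).eval 0
  have hi1 : ∀ x : ℝ, IntegrableOn (fun y : ℝ => Complex.exp (c * (y - x)) * (B y *ᵥ v y) 1) (Ioi x) :=
    fun x => (hint x).eval 1
  have hexp : ∀ x y : ℝ, Complex.exp (c * y) * (B y *ᵥ v y) 1 =
      Complex.exp (c * x) * (Complex.exp (c * (y - x)) * (B y *ᵥ v y) 1) := fun x y => by
    rw [← mul_assoc, ← Complex.exp_add]; ring_nf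
  have hi2 : ∀ x, IntegrableOn (fun y : ℝ => Complex.exp (c * y) * (B y *ᵥ v y) 1) (Ioi x) :=
    fun x => by
      simp_rw [hexp x]
      exact (hi1 x).const_mul _
  have e0 : ∀ x, volterra c B v x 0 = ∫ y in Ioi x, (B y *ᵥ v y) 0 := fun x =>
    eval_integral (fun i => (hint x).eval i) 0
  -- Pulling `exp (-c x)` out leaves an integrand independent of `x`; the second component then
  -- differentiates as a product.
  have e1 : ∀ x, volterra c B v x 1 =
      Complex.exp (-(c * x)) * ∫ y in Ioi x, Complex.exp (c * y) * (B y *ᵥ v y) 1 := fun x => by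
    simp_rw [hexp x]
    rw [integral_const_mul, ← mul_assoc, ← Complex.exp_add, neg_add_cancel, Complex.exp_zero,
      one_mul]
    exact eval_integral (fun i => (hint x).eval i) 1
  rw [hasDerivAt_pi]
  intro i
  fin_cases i
  · simp only [Fin.zero_eta, e0]
    refine (hasDerivAt_integral_Ioi (by fun_prop) hi0 x).congr_deriv ?_
    simp
  · simp only [Fin.mk_one]
    have hE : HasDerivAt (fun x : ℝ => Complex.exp (-(c * x))) (Complex.exp (-(c * x)) * -c) x := by
      have := ((Complex.ofRealCLM.hasDerivAt (x := x)).const_mul c).neg.cexp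
      simpa using this
    have := hE.mul (hasDerivAt_integral_Ioi (h := fun y : ℝ =>
      Complex.exp (c * y) * (B y *ᵥ v y) 1) (by fun_prop) hi2 x)
    refine (this.congr_of_eventuallyEq (Eventually.of_forall e1)).congr_deriv ?_
    have hx : Complex.exp (-(c * x)) * Complex.exp (c * x) = 1 := by
      rw [← Complex.exp_add, neg_add_cancel, Complex.exp_zero]
    simp only [e1, Pi.sub_apply, Pi.neg_apply, cons_val_one, cons_val_fin_one]
    linear_combination (-(B x *ᵥ v x) 1) * hx

lemma continuous_volterra {v : ℝ → Fin 2 → ℂ} (hv : Continuous v) {M : ℝ}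
    (hM : ∀ y, ‖v y‖ ≤ M * weight g y) : Continuous (volterra c B v) :=
  continuous_iff_continuousAt.2 fun x => (h.hasDerivAt_volterra hv hM x).continuousAt

/-- A bounded solution of the homogeneous Volterra inequality vanishes. -/
lemma eq_zero_of_norm_le {v : ℝ → Fin 2 → ℂ} {M x₀ : ℝ} (hM : ∀ y, x₀ ≤ y → ‖v y‖ ≤ M)
    (hv : ∀ x, x₀ ≤ x → v x = -volterra c B v x) : v x₀ = 0 := by
  have hM0 : 0 ≤ M := (norm_nonneg _).trans (hM x₀ le_rfl)
  -- As `v` reproduces itself up to sign under the operator, each application halves the constant.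
  -- The start of the induction uses `1 ≤ weight g`.
  have key : ∀ n : ℕ, ∀ x, x₀ ≤ x → ‖v x‖ ≤ M / 2 ^ n * weight g x := by
    intro n
    induction n with
    | zero =>
      intro x hx
      have := h.maj.one_le_weight x
      have := hM x hx
      simp only [pow_zero, div_one]
      nlinarith
    | succ n ih =>
      intro x hx
      rw [hv x hx, norm_neg]
      refine (h.norm_volterra_le (by positivity) fun y hy => ih y (hx.trans hy.le)).trans
        (le_of_eq ?_)
      rw [pow_succ]; ring
  have h2 : Tendsto (fun n : ℕ => M / 2 ^ n * weight g x₀) atTop (𝓝 0) := by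
    have := (tendsto_pow_atTop_nhds_zero_of_lt_one (r := (1 / 2 : ℝ)) (by norm_num)
      (by norm_num)).const_mul (M * weight g x₀)
    simp only [mul_zero] at this
    refine this.congr fun n => ?_
    rw [one_div, inv_pow]; ring
  have := ge_of_tendsto' h2 fun n => key n x₀ le_rfl
  exact norm_le_zero_iff.1 this

end IsVolterra

/-! ### Picard iteration for the Volterra equation -/

/-- Picard iterates of the Volterra equation `w = f - volterra c B w`. -/
def picardIter (f : Fin 2 → ℂ) (c : ℂ) (B : ℝ → Matrix (Fin 2) (Fin 2) ℂ) : ℕ → ℝ → Fin 2 → ℂ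
  | 0 => fun _ => 0
  | n + 1 => fun x => f - volterra c B (picardIter f c B n) x

/-- The solution of the Volterra equation `w = f - volterra c B w`. -/
def volterraSol (f : Fin 2 → ℂ) (c : ℂ) (B : ℝ → Matrix (Fin 2) (Fin 2) ℂ) (x : ℝ) : Fin 2 → ℂ :=
  limUnder atTop fun n => picardIter f c B n x

namespace IsVolterra

variable {g : ℝ → ℝ} {c : ℂ} {B : ℝ → Matrix (Fin 2) (Fin 2) ℂ} (h : IsVolterra g c B)
  (f : Fin 2 → ℂ)
include h

/-- The weighted ball of radius `2 ‖f‖` is invariant: the inhomogeneity costs `‖f‖`, as `1 ≤ weight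
g`, and the operator returns at most half of `2 ‖f‖`. -/
lemma picardIter_bound (n : ℕ) : Continuous (picardIter f c B n) ∧
    ∀ x, ‖picardIter f c B n x‖ ≤ 2 * ‖f‖ * weight g x := by
  induction n with
  | zero =>
    refine ⟨continuous_const, fun x => ?_⟩
    have := h.maj.one_le_weight x
    simp only [picardIter, norm_zero]
    positivity
  | succ n ih =>
    refine ⟨continuous_const.sub (h.continuous_volterra ih.1 ih.2), fun x => ?_⟩
    refine (norm_sub_le _ _).trans ?_
    have h1 := h.norm_volterra_le (x := x) (by positivity) fun y _ => ih.2 y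
    have h2 := h.maj.one_le_weight x
    have := norm_nonneg f
    nlinarith

lemma norm_picardIter_sub_le (n : ℕ) (x : ℝ) :
    ‖picardIter f c B (n + 1) x - picardIter f c B n x‖ ≤ ‖f‖ * weight g x / 2 ^ n := by
  induction n generalizing x with
  | zero =>
    have h1 := h.maj.one_le_weight x
    have h2 := norm_nonneg f
    have : volterra c B (fun _ => 0) x = 0 := by
      simp [volterra, twist, Matrix.mulVec_zero]
    simp only [picardIter, this, sub_zero, pow_zero, div_one]
    nlinarith
  | succ n ih =>
    have e : picardIter f c B (n + 1 + 1) x - picardIter f c B (n + 1) x =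
        -volterra c B (picardIter f c B (n + 1) - picardIter f c B n) x := by
      rw [← h.volterra_sub (h.picardIter_bound f (n + 1)).1 (h.picardIter_bound f n).1
        (fun y _ => (h.picardIter_bound f (n + 1)).2 y) (fun y _ => (h.picardIter_bound f n).2 y)]
      simp only [picardIter]
      abel
    rw [e, norm_neg]
    refine (h.norm_volterra_le (M := ‖f‖ / 2 ^ n) (by positivity) fun y _ => ?_).trans
      (le_of_eq ?_)
    · refine (ih y).trans (le_of_eq ?_)
      ring
    · rw [pow_succ]; ring

lemma dist_picardIter_le (x : ℝ) (n : ℕ) :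
    dist (picardIter f c B n x) (picardIter f c B (n + 1) x) ≤
      (2 * ‖f‖ * weight g x) / 2 / 2 ^ n := by
  rw [dist_comm, dist_eq_norm]
  refine (h.norm_picardIter_sub_le f n x).trans (le_of_eq ?_)
  ring

lemma tendsto_picardIter (x : ℝ) :
    Tendsto (fun n => picardIter f c B n x) atTop (𝓝 (volterraSol f c B x)) :=
  (cauchySeq_of_le_geometric_two (h.dist_picardIter_le f x)).tendsto_limUnder

lemma norm_picardIter_sub_sol_le (x : ℝ) (n : ℕ) :
    ‖picardIter f c B n x - volterraSol f c B x‖ ≤ 2 * ‖f‖ * weight g x / 2 ^ n := by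
  rw [← dist_eq_norm]
  exact dist_le_of_le_geometric_two_of_tendsto (h.dist_picardIter_le f x)
    (h.tendsto_picardIter f x) n

lemma norm_volterraSol_le (x : ℝ) : ‖volterraSol f c B x‖ ≤ 2 * ‖f‖ * weight g x :=
  le_of_tendsto (h.tendsto_picardIter f x).norm
    (Eventually.of_forall fun n => (h.picardIter_bound f n).2 x)

omit h in
lemma tendsto_const_div_two_pow (C : ℝ) : Tendsto (fun n : ℕ => C / 2 ^ n) atTop (𝓝 0) := by
  have := (tendsto_pow_atTop_nhds_zero_of_lt_one (r := (1 / 2 : ℝ)) (by norm_num)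
      (by norm_num)).const_mul C
  simpa [div_eq_mul_inv] using this

lemma continuous_volterraSol : Continuous (volterraSol f c B) := by
  refine (TendstoLocallyUniformly.continuous (F := fun n : ℕ => picardIter f c B n) (p := atTop) ?_
    (Frequently.of_forall fun n => (h.picardIter_bound f n).1))
  rw [Metric.tendstoLocallyUniformly_iff]
  intro ε hε x
  -- The error is proportional to `weight g`, which is antitone, so on `Ioi (x - 1)` it is
  -- controlled by the value at `x - 1`.
  refine ⟨Ioi (x - 1), Ioi_mem_nhds (by linarith), ?_⟩
  filter_upwards [(tendsto_const_div_two_pow (2 * ‖f‖ * weight g (x - 1))).eventually_lt_const hε]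
    with n hn y hy
  rw [dist_comm, dist_eq_norm]
  refine (h.norm_picardIter_sub_sol_le f y n).trans_lt (lt_of_le_of_lt ?_ hn)
  gcongr
  exact h.maj.antitone_weight (le_of_lt hy)

lemma volterraSol_eq (x : ℝ) : volterraSol f c B x = f - volterra c B (volterraSol f c B) x := by
  refine tendsto_nhds_unique ((h.tendsto_picardIter f x).comp (tendsto_add_atTop_nat 1)) ?_
  rw [tendsto_iff_norm_sub_tendsto_zero]
  refine squeeze_zero (fun _ => norm_nonneg _) (fun n => ?_)
    (tendsto_const_div_two_pow (‖f‖ * weight g x))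
  have e : picardIter f c B (n + 1) x - (f - volterra c B (volterraSol f c B) x) =
      -volterra c B (picardIter f c B n - volterraSol f c B) x := by
    rw [← h.volterra_sub (h.picardIter_bound f n).1 (h.continuous_volterraSol f)
        (fun y _ => (h.picardIter_bound f n).2 y) (fun y _ => h.norm_volterraSol_le f y)]
    simp only [picardIter]
    abel
  simp only [Function.comp]
  rw [e, norm_neg]
  refine (h.norm_volterra_le (M := 2 * ‖f‖ / 2 ^ n) (by positivity) fun y _ => ?_).trans
      (le_of_eq ?_)
  · refine (h.norm_picardIter_sub_sol_le f y n).trans (le_of_eq ?_)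
    ring
  · ring

lemma hasDerivAt_volterraSol (x : ℝ) :
    HasDerivAt (volterraSol f c B)
      (B x *ᵥ volterraSol f c B x + ![0, c * (f 1 - volterraSol f c B x 1)]) x := by
  have e : volterraSol f c B = fun x => f - volterra c B (volterraSol f c B) x :=
    funext (h.volterraSol_eq f)
  have := (h.hasDerivAt_volterra (h.continuous_volterraSol f)
    (fun y => h.norm_volterraSol_le f y) x).const_sub f
  rw [← e] at this
  refine this.congr_deriv ?_
  have e1 : volterra c B (volterraSol f c B) x = f - volterraSol f c B x := by
    have := h.volterraSol_eq f x
    rw [eq_sub_iff_add_eq] at this ⊢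
    rw [add_comm]; exact this
  rw [e1]
  simp only [Pi.sub_apply]
  abel

lemma tendsto_volterraSol : Tendsto (volterraSol f c B) atTop (𝓝 f) := by
  rw [tendsto_iff_norm_sub_tendsto_zero]
  refine squeeze_zero' (Eventually.of_forall fun _ => norm_nonneg _) ?_
    (?_ : Tendsto (fun x => 2 * ‖f‖ * weight g 0 * ∫ y in Ioi x, g y) atTop (𝓝 0))
  · filter_upwards [eventually_ge_atTop 0] with x hx
    have e1 : volterraSol f c B x - f = - volterra c B (volterraSol f c B) x := by
      have := h.volterraSol_eq f x
      rw [sub_eq_iff_eq_add, neg_add_eq_sub]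
      exact this
    rw [e1, norm_neg, ← integral_const_mul]
    refine norm_integral_le_of_norm_le ((h.maj.int x).const_mul _) ?_
    filter_upwards [ae_restrict_mem measurableSet_Ioi] with y hy
    refine (h.norm_kernel_le (le_of_lt hy) _).trans ?_
    rw [mul_comm]
    have := h.maj.nonneg y
    gcongr
    refine (h.norm_volterraSol_le f y).trans ?_
    gcongr
    exact h.maj.antitone_weight (hx.trans (le_of_lt hy))
  · simpa using (tendsto_integral_Ioi_atTop h.maj.int).const_mul (2 * ‖f‖ * weight g 0)

end IsVolterra

/-! ### Volterra equations and differential equations -/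

lemma exists_norm_le_Ici {F : Type*} [NormedAddCommGroup F] {v : ℝ → F} (hv : Continuous v) {l : F}
    (hl : Tendsto v atTop (𝓝 l)) (x₀ : ℝ) : ∃ M, ∀ y, x₀ ≤ y → ‖v y‖ ≤ M := by
  obtain ⟨N, hN⟩ := eventually_atTop.1 (hl.norm.eventually_le_const (lt_add_one ‖l‖))
  obtain ⟨M, hM⟩ := isCompact_Icc.exists_bound_of_continuousOn (s := Icc x₀ N) hv.continuousOn
  refine ⟨max M (‖l‖ + 1), fun y hy => ?_⟩
  rcases le_total y N with h | h
  · exact (hM y ⟨hy, h⟩).trans (le_max_left _ _)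
  · exact (hN y h).trans (le_max_right _ _)

namespace IsVolterra

variable {g : ℝ → ℝ} {c : ℂ} {B : ℝ → Matrix (Fin 2) (Fin 2) ℂ} (h : IsVolterra g c B)
include h

/-- Variation of constants: `exp (c x)` removes the linear term of the second component, and
integration up to `+∞` leaves no boundary term there because `w 1 → 0` and `c.re ≤ 0`. The first
component may have any limit. -/
lemma eq_sub_volterra {w : ℝ → Fin 2 → ℂ} {f₀ : ℂ}
    (hw : ∀ x, HasDerivAt w (B x *ᵥ w x - ![0, c * w x 1]) x)
    (hlim : Tendsto w atTop (𝓝 ![f₀, 0])) (x : ℝ) : w x = ![f₀, 0] - volterra c B w x := by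
  have hwc : Continuous w := continuous_iff_continuousAt.2 fun x => (hw x).continuousAt
  obtain ⟨M, hM⟩ := exists_norm_le_Ici hwc hlim x
  have hM0 : 0 ≤ M := (norm_nonneg _).trans (hM x le_rfl)
  have hint : IntegrableOn (fun y : ℝ => twist (c * (y - x)) (B y *ᵥ w y)) (Ioi x) :=
    h.integrable_kernel hwc (M := M) fun y hy => (hM y hy.le).trans
      (le_mul_of_one_le_right hM0 (h.maj.one_le_weight y))
  have hexp : ∀ y : ℝ, Complex.exp (c * y) * (B y *ᵥ w y) 1 =
      Complex.exp (c * x) * (Complex.exp (c * (y - x)) * (B y *ᵥ w y) 1) := fun y => by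
    rw [← mul_assoc, ← Complex.exp_add]; ring_nf
  have e0 : volterra c B w x 0 = f₀ - w x 0 := by
    refine (eval_integral (fun i => hint.eval i) 0).trans ?_
    refine integral_Ioi_of_hasDerivAt_of_tendsto' (f := fun y => w y 0) (fun y _ => ?_)
      (hint.eval 0) ?_
    · refine ((hasDerivAt_pi.1 (hw y)) 0).congr_deriv ?_
      simp [twist]
    · simpa using (tendsto_pi_nhds.1 hlim) 0
  have e1 : volterra c B w x 1 = 0 - w x 1 := by
    have hx : Complex.exp (-(c * x)) * Complex.exp (c * x) = 1 := by
      rw [← Complex.exp_add, neg_add_cancel, Complex.exp_zero]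
    have i1 : IntegrableOn (fun y : ℝ => Complex.exp (c * y) * (B y *ᵥ w y) 1) (Ioi x) := by
      simp_rw [hexp]
      exact (hint.eval 1).const_mul _
    have k1 : ∫ y in Ioi x, Complex.exp (c * y) * (B y *ᵥ w y) 1 =
        0 - Complex.exp (c * x) * w x 1 := by
      refine integral_Ioi_of_hasDerivAt_of_tendsto' (f := fun y : ℝ => Complex.exp (c * y) * w y 1)
        (fun y _ => ?_) i1 ?_
      · have hE : HasDerivAt (fun x : ℝ => Complex.exp (c * x)) (Complex.exp (c * y) * c) y := by
          have := ((Complex.ofRealCLM.hasDerivAt (x := y)).const_mul c).cexp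
          simpa using this
        refine (hE.mul ((hasDerivAt_pi.1 (hw y)) 1)).congr_deriv ?_
        simp only [Pi.sub_apply, cons_val_one, cons_val_fin_one]
        ring
      · refine squeeze_zero_norm' (a := fun y : ℝ => ‖w y 1‖) ?_ ?_
        · filter_upwards [eventually_ge_atTop 0] with y hy
          rw [norm_mul, Complex.norm_exp, Complex.re_mul_ofReal]
          refine mul_le_of_le_one_left (norm_nonneg _) (Real.exp_le_one_iff.2 ?_)
          exact mul_nonpos_of_nonpos_of_nonneg h.re_nonpos hy
        · simpa using ((tendsto_pi_nhds.1 hlim) 1).norm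
    have k2 : volterra c B w x 1 =
        Complex.exp (-(c * x)) * ∫ y in Ioi x, Complex.exp (c * y) * (B y *ᵥ w y) 1 := by
      simp_rw [hexp]
      rw [integral_const_mul, ← mul_assoc, hx, one_mul]
      exact eval_integral (fun i => hint.eval i) 1
    rw [k2, k1]
    linear_combination (-w x 1) * hx
  ext i
  fin_cases i
  · simp [e0]
  · simp [e1]

lemma eq_of_hasDerivAt {w w' : ℝ → Fin 2 → ℂ} {f₀ : ℂ}
    (hw : ∀ x, HasDerivAt w (B x *ᵥ w x - ![0, c * w x 1]) x)
    (hlim : Tendsto w atTop (𝓝 ![f₀, 0]))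
    (hw' : ∀ x, HasDerivAt w' (B x *ᵥ w' x - ![0, c * w' x 1]) x)
    (hlim' : Tendsto w' atTop (𝓝 ![f₀, 0])) : w = w' := by
  ext1 x
  have h0 : (![0, 0] : Fin 2 → ℂ) = 0 := by ext i; fin_cases i <;> rfl
  have hd : ∀ x, HasDerivAt (w - w') (B x *ᵥ (w - w') x - ![0, c * (w - w') x 1]) x := fun x => by
    refine ((hw x).sub (hw' x)).congr_deriv ?_
    ext i; fin_cases i <;> simp [Matrix.mulVec_sub]; ring
  have hl : Tendsto (w - w') atTop (𝓝 ![0, 0]) := by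
    have := hlim.sub hlim'
    rw [sub_self] at this
    rw [h0]
    exact this
  have hc : Continuous (w - w') := continuous_iff_continuousAt.2 fun x => (hd x).continuousAt
  obtain ⟨M, hM⟩ := exists_norm_le_Ici hc hl x
  have := h.eq_zero_of_norm_le hM fun y _ => by
    have := h.eq_sub_volterra hd hl y
    rw [h0, zero_sub] at this
    exact this
  exact sub_eq_zero.1 this

end IsVolterra

/-! ### Dependence on a parameter -/

/-- Only the integrand itself has to be dominated. Cauchy's estimate on discs of radius `ε / 2`
dominates its derivative, and the derivative is measurable as a limit of difference quotients along
a sequence. -/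
lemma differentiableOn_integral_of_dominated {F : Type*} [NormedAddCommGroup F] [NormedSpace ℂ F]
    [CompleteSpace F] {α : Type*} [MeasurableSpace α] {m : Measure α} {U : Set ℂ} (hU : IsOpen U)
    {φ : ℂ → α → F} {bound : α → ℝ} (hb : Integrable bound m)
    (hmeas : ∀ z ∈ U, AEStronglyMeasurable (φ z) m)
    (hle : ∀ᵐ a ∂m, ∀ z ∈ U, ‖φ z a‖ ≤ bound a)
    (hd : ∀ᵐ a ∂m, DifferentiableOn ℂ (fun z => φ z a) U) :
    DifferentiableOn ℂ (fun z => ∫ a, φ z a ∂m) U := by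
  intro z₀ hz₀
  obtain ⟨ε, hε, hball⟩ := Metric.isOpen_iff.1 hU z₀ hz₀
  have hr : 0 < ε / 2 := by positivity
  have hsub : Metric.ball z₀ (ε / 2) ⊆ U :=
    (Metric.ball_subset_ball (by linarith)).trans hball
  have hnhds : Metric.ball z₀ (ε / 2) ∈ 𝓝 z₀ := Metric.ball_mem_nhds _ hr
  have hda : ∀ᵐ a ∂m, ∀ z ∈ U, HasDerivAt (fun z => φ z a) (deriv (fun z => φ z a) z) z := by
    filter_upwards [hd] with a ha z hz
    exact ((ha z hz).differentiableAt (hU.mem_nhds hz)).hasDerivAt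
  have hbd : ∀ᵐ a ∂m, ∀ z ∈ Metric.ball z₀ (ε / 2),
      ‖deriv (fun z => φ z a) z‖ ≤ bound a / (ε / 2) := by
    filter_upwards [hd, hle] with a ha hla z hz
    have hcl : Metric.closedBall z (ε / 2) ⊆ U := fun w hw => hball (by
      rw [Metric.mem_closedBall] at hw
      rw [Metric.mem_ball] at hz ⊢
      linarith [dist_triangle w z z₀])
    refine Complex.norm_deriv_le_of_forall_mem_sphere_norm_le hr ?_ fun w hw =>
      hla w (hcl (Metric.sphere_subset_closedBall hw))
    refine DifferentiableOn.diffContOnCl (ha.mono ?_)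
    rwa [closure_ball _ hr.ne']
  have hmeas' : AEStronglyMeasurable (fun a => deriv (fun z => φ z a) z₀) m := by
    have hseq : Tendsto (fun n : ℕ => z₀ + ((1 / ((n : ℝ) + 1) : ℝ) : ℂ)) atTop (𝓝[≠] z₀) := by
      rw [tendsto_nhdsWithin_iff]
      constructor
      · have := (Complex.continuous_ofReal.tendsto 0).comp
          tendsto_one_div_add_atTop_nhds_zero_nat
        simpa using! this.const_add z₀
      · refine Eventually.of_forall fun n => ?_
        have : ((1 / ((n : ℝ) + 1) : ℝ) : ℂ) ≠ 0 := by
          exact_mod_cast (by positivity : (1 / ((n : ℝ) + 1) : ℝ) ≠ 0)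
        simpa only [mem_compl_iff, mem_singleton_iff, add_eq_left]
    have hU' : ∀ᶠ n : ℕ in atTop, z₀ + ((1 / ((n : ℝ) + 1) : ℝ) : ℂ) ∈ U :=
      (hseq.mono_right nhdsWithin_le_nhds).eventually (hU.mem_nhds hz₀)
    obtain ⟨N, hN⟩ := eventually_atTop.1 hU'
    refine aestronglyMeasurable_of_tendsto_ae (u := atTop)
      (f := fun n : ℕ => fun a => slope (fun z => φ z a) z₀ (z₀ + ((1 / (((n + N : ℕ) : ℝ) + 1) : ℝ) : ℂ)))
      (fun n => ?_) ?_
    · simp only [slope_def_module]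
      exact ((hmeas _ (hN _ (Nat.le_add_left _ _))).sub (hmeas _ hz₀)).const_smul _
    · filter_upwards [hda] with a ha
      exact ((hasDerivAt_iff_tendsto_slope.1 (ha z₀ hz₀)).comp hseq).comp (tendsto_add_atTop_nat N)
  have hint : Integrable (φ z₀) m :=
    Integrable.mono' hb (hmeas z₀ hz₀) (hle.mono fun a ha => ha z₀ hz₀)
  exact (hasDerivAt_integral_of_dominated_loc_of_deriv_le hnhds
    (by filter_upwards [hnhds] with z hz using hmeas z (hsub hz)) hint hmeas' hbd
    (hb.div_const _)
    (hda.mono fun a ha z hz => ha z (hsub hz))).2.differentiableAt.differentiableWithinAt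

lemma continuous_mulVec_prod :
    Continuous fun p : Matrix (Fin 2) (Fin 2) ℂ × (Fin 2 → ℂ) => p.1 *ᵥ p.2 :=
  continuous_fst.matrix_mulVec continuous_snd

section Parameter

variable {g : ℝ → ℝ} {c : ℂ → ℂ} {B : ℂ → ℝ → Matrix (Fin 2) (Fin 2) ℂ} {Z : Set ℂ}
  (h : ∀ z ∈ Z, IsVolterra g (c z) (B z)) (f : Fin 2 → ℂ)
include h

/-- The majorant `g` is common to all `z` in `Z`. It dominates the integrals that define the
iterates and makes their convergence uniform on `Z`. -/
lemma continuousOn_volterraSol (hc : ContinuousOn c Z)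
    (hB : ∀ y, ContinuousOn (fun z => B z y) Z) (x : ℝ) :
    ContinuousOn (fun z => volterraSol f (c z) (B z) x) Z := by
  have key : ∀ n x, ContinuousOn (fun z => picardIter f (c z) (B z) n x) Z := by
    intro n
    induction n with
    | zero => exact fun x => continuousOn_const
    | succ n ih =>
      intro x
      refine continuousOn_const.sub fun z₀ hz₀ => ?_
      refine continuousWithinAt_of_dominated (bound := fun y => 2 * ‖f‖ * (weight g y * g y)) ?_ ?_
        (((h z₀ hz₀).maj.integrable_weight_mul x).const_mul _) ?_
      · filter_upwards [self_mem_nhdsWithin] with z hz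
        exact (IsVolterra.continuous_kernel (h z hz).cont
          ((h z hz).picardIter_bound f n).1 x).aestronglyMeasurable
      · filter_upwards [self_mem_nhdsWithin] with z hz
        filter_upwards [ae_restrict_mem measurableSet_Ioi] with y hy
        exact (h z hz).norm_kernel_le_weight hy (((h z hz).picardIter_bound f n).2 y)
      · refine Eventually.of_forall fun y => ?_
        have h1 : ContinuousWithinAt (fun z => B z y *ᵥ picardIter f (c z) (B z) n y) Z z₀ :=
          ContinuousAt.comp_continuousWithinAt
            (f := fun z => ((B z y, picardIter f (c z) (B z) n y) :
              Matrix (Fin 2) (Fin 2) ℂ × (Fin 2 → ℂ)))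
            continuous_mulVec_prod.continuousAt (((hB y) z₀ hz₀).prodMk (ih y z₀ hz₀))
        exact ContinuousAt.comp_continuousWithinAt
          (f := fun z => ((c z * (y - x), B z y *ᵥ picardIter f (c z) (B z) n y) :
              ℂ × (Fin 2 → ℂ)))
          continuous_twist.continuousAt
          (((hc z₀ hz₀).mul continuousWithinAt_const).prodMk h1)
  refine TendstoUniformlyOn.continuousOn (p := atTop)
    (F := fun n : ℕ => fun z => picardIter f (c z) (B z) n x) ?_
    (Frequently.of_forall fun n => key n x)
  rw [Metric.tendstoUniformlyOn_iff]
  intro ε hε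
  filter_upwards [(IsVolterra.tendsto_const_div_two_pow (2 * ‖f‖ * weight g x)).eventually_lt_const hε]
    with n hn z hz
  rw [dist_comm, dist_eq_norm]
  exact ((h z hz).norm_picardIter_sub_sol_le f x n).trans_lt hn

lemma differentiableOn_volterraSol (hZ : IsOpen Z) (hc : DifferentiableOn ℂ c Z)
    (hB : ∀ y i j, DifferentiableOn ℂ (fun z => B z y i j) Z) (x : ℝ) :
    DifferentiableOn ℂ (fun z => volterraSol f (c z) (B z) x) Z := by
  have key : ∀ n x, DifferentiableOn ℂ (fun z => picardIter f (c z) (B z) n x) Z := by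
    intro n
    induction n with
    | zero => exact fun x => differentiableOn_const _
    | succ n ih =>
      intro x
      refine (differentiableOn_const _).sub ?_
      rcases Z.eq_empty_or_nonempty with rfl | ⟨z₀, hz₀⟩
      · exact differentiableOn_empty
      refine differentiableOn_integral_of_dominated hZ
        (((h z₀ hz₀).maj.integrable_weight_mul x).const_mul (2 * ‖f‖)) (fun z hz => ?_) ?_ ?_
      · exact (IsVolterra.continuous_kernel (h z hz).cont
          ((h z hz).picardIter_bound f n).1 x).aestronglyMeasurable
      · filter_upwards [ae_restrict_mem measurableSet_Ioi] with y hy z hz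
        exact (h z hz).norm_kernel_le_weight hy (((h z hz).picardIter_bound f n).2 y)
      · refine Eventually.of_forall fun y => ?_
        have hi := differentiableOn_pi.1 (ih y)
        have hb := hB y
        rw [differentiableOn_pi]
        intro i
        fin_cases i
        · simp only [twist, mulVec_fin_two, Fin.zero_eta, cons_val_zero]
          exact ((hb 0 0).mul (hi 0)).add ((hb 0 1).mul (hi 1))
        · simp only [twist, mulVec_fin_two, Fin.mk_one, cons_val_one, cons_val_fin_one]
          exact ((hc.mul_const _).cexp).mul (((hb 1 0).mul (hi 0)).add ((hb 1 1).mul (hi 1)))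
  refine TendstoLocallyUniformlyOn.differentiableOn (φ := atTop)
    (F := fun n : ℕ => fun z => picardIter f (c z) (B z) n x) ?_
    (Eventually.of_forall fun n => key n x) hZ
  refine TendstoUniformlyOn.tendstoLocallyUniformlyOn ?_
  rw [Metric.tendstoUniformlyOn_iff]
  intro ε hε
  filter_upwards [(IsVolterra.tendsto_const_div_two_pow (2 * ‖f‖ * weight g x)).eventually_lt_const
    hε] with n hn z hz
  rw [dist_comm, dist_eq_norm]
  exact ((h z hz).norm_picardIter_sub_sol_le f x n).trans_lt hn

end Parameter

/-! ### Linear differential equations -/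

/-- The coefficient of `y' = A(t) y` in the time variable `s` with `t = σ exp (-s)`. -/
def logTimeCoeff (A : ℝ → Matrix (Fin 2) (Fin 2) ℂ) (σ s : ℝ) : Matrix (Fin 2) (Fin 2) ℂ :=
  (-(σ * Real.exp (-s) : ℝ) : ℂ) • A (σ * Real.exp (-s))

/-- As `s → +∞` the argument of `A` stays in a compact interval, while the Jacobian factor decays
like `exp (-s)`; this is the required integrability. -/
lemma isVolterra_logTimeCoeff {A : ℝ → Matrix (Fin 2) (Fin 2) ℂ} (hA : Continuous A) (σ : ℝ) :
    IsVolterra (fun s => entrySum (logTimeCoeff A σ s)) 0 (logTimeCoeff A σ) := by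
  have hc : Continuous (logTimeCoeff A σ) := by
    unfold logTimeCoeff
    have h1 : Continuous fun s : ℝ => σ * Real.exp (-s) := by fun_prop
    exact (Complex.continuous_ofReal.comp h1).neg.smul (hA.comp h1)
  refine ⟨⟨continuous_entrySum.comp hc, fun x => entrySum_nonneg _, fun x => ?_⟩, hc,
    fun _ => le_rfl, le_rfl⟩
  obtain ⟨M, hM⟩ := (isCompact_Icc (a := -(|σ| * Real.exp (-x)))
    (b := |σ| * Real.exp (-x))).exists_bound_of_continuousOn
    (continuous_entrySum.comp hA).continuousOn
  refine Integrable.mono' ((integrableOn_exp_neg_Ioi x).const_mul (|σ| * M))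
    (continuous_entrySum.comp hc).aestronglyMeasurable ?_
  filter_upwards [ae_restrict_mem measurableSet_Ioi] with s hs
  rw [Real.norm_of_nonneg (entrySum_nonneg _), logTimeCoeff, entrySum_smul, norm_neg,
    Complex.norm_real, norm_mul, Real.norm_eq_abs, Real.norm_of_nonneg (Real.exp_nonneg _)]
  have h1 : σ * Real.exp (-s) ∈ Icc (-(|σ| * Real.exp (-x))) (|σ| * Real.exp (-x)) := by
    rw [mem_Icc, ← abs_le, abs_mul, abs_of_pos (Real.exp_pos _)]
    gcongr
    exact le_of_lt hs
  have h2 := (le_abs_self _).trans (hM _ h1)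
  calc |σ| * Real.exp (-s) * entrySum (A (σ * Real.exp (-s)))
      ≤ |σ| * Real.exp (-s) * M := by gcongr; exact h2
    _ = |σ| * M * Real.exp (-s) := by ring

/-- Linear differential equations with continuous coefficients have global solutions. -/
theorem exists_linear_ode {A : ℝ → Matrix (Fin 2) (Fin 2) ℂ} (hA : Continuous A)
    (y₀ : Fin 2 → ℂ) : ∃ y : ℝ → Fin 2 → ℂ, y 0 = y₀ ∧ ∀ t, HasDerivAt y (A t *ᵥ y t) t := by
  classical
  -- The substitution `s = -log |t|` moves the initial time to `+∞`, where the Volterra equation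
  -- prescribes the value. The choices `σ = 1` and `σ = -1` cover positive and negative times.
  set w : ℝ → ℝ → Fin 2 → ℂ := fun σ => volterraSol y₀ 0 (logTimeCoeff A σ) with hw
  have hlim : ∀ σ, Tendsto (w σ) atTop (𝓝 y₀) := fun σ =>
    (isVolterra_logTimeCoeff hA σ).tendsto_volterraSol y₀
  have hder : ∀ σ s, HasDerivAt (w σ) (logTimeCoeff A σ s *ᵥ w σ s) s := fun σ s => by
    refine ((isVolterra_logTimeCoeff hA σ).hasDerivAt_volterraSol y₀ s).congr_deriv ?_
    ext i; fin_cases i <;> simp [hw]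
  set y : ℝ → Fin 2 → ℂ := fun t =>
    if t = 0 then y₀ else if 0 < t then w 1 (-Real.log t) else w (-1) (-Real.log t) with hy
  have hy0 : y 0 = y₀ := by simp [hy]
  have hpos : ∀ t, 0 < t → y t = w 1 (-Real.log t) := fun t ht => by simp [hy, ht, ht.ne']
  have hneg : ∀ t, t < 0 → y t = w (-1) (-Real.log t) := fun t ht => by
    simp [hy, ht.le.not_gt, ht.ne]
  have hcomp : ∀ σ t : ℝ, t ≠ 0 → σ * Real.exp (Real.log t) = t →
      HasDerivAt (fun t => w σ (-Real.log t)) (A t *ᵥ w σ (-Real.log t)) t := fun σ t ht hσ => by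
    have h1 : HasDerivAt (fun t => -Real.log t) (-t⁻¹) t := (Real.hasDerivAt_log ht).neg
    refine ((hder σ (-Real.log t)).scomp t h1).congr_deriv ?_
    rw [logTimeCoeff, neg_neg, hσ, Matrix.smul_mulVec, ← Complex.coe_smul, smul_smul]
    have : ((-t⁻¹ : ℝ) : ℂ) * -((t : ℝ) : ℂ) = 1 := by
      have : (t : ℂ) ≠ 0 := by exact_mod_cast ht
      push_cast; field_simp
    rw [this, one_smul]
  have hne : ∀ t, t ≠ 0 → HasDerivAt y (A t *ᵥ y t) t := fun t ht => by
    rcases lt_or_gt_of_ne ht with h | h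
    · rw [hneg t h]
      refine (hcomp (-1) t ht ?_).congr_of_eventuallyEq ?_
      · rw [Real.exp_log_eq_abs ht, abs_of_neg h]; ring
      · filter_upwards [Iio_mem_nhds h] with u hu using hneg u hu
    · rw [hpos t h]
      refine (hcomp 1 t ht ?_).congr_of_eventuallyEq ?_
      · rw [Real.exp_log h, one_mul]
      · filter_upwards [Ioi_mem_nhds h] with u hu using hpos u hu
  have hyc : ContinuousAt y 0 := by
    rw [← continuousWithinAt_compl_self]
    have hlog : Tendsto (fun t => -Real.log t) (𝓝[≠] 0) atTop :=
      tendsto_neg_atBot_atTop.comp Real.tendsto_log_nhdsNE_zero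
    unfold ContinuousWithinAt
    rw [hy0]
    have h1 := (hlim 1).comp hlog
    have h2 := (hlim (-1)).comp hlog
    rw [tendsto_def] at h1 h2 ⊢
    intro s hs
    filter_upwards [h1 s hs, h2 s hs, self_mem_nhdsWithin] with t a b ht
    rcases lt_or_gt_of_ne ht with h | h
    · rw [mem_preimage, hneg t h]; exact b
    · rw [mem_preimage, hpos t h]; exact a
  refine ⟨y, hy0, fun t => ?_⟩
  rcases eq_or_ne t 0 with rfl | ht
  -- At the junction the derivative comes from continuity of `y` and from the limit of its
  -- derivatives at nearby points.
  · refine hasDerivAt_of_hasDerivAt_of_ne (g := fun t => A t *ᵥ y t) (fun t ht => hne t ht) hyc ?_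
    exact continuous_mulVec_prod.continuousAt.comp
      (f := fun t => ((A t, y t) : Matrix (Fin 2) (Fin 2) ℂ × (Fin 2 → ℂ)))
      (hA.continuousAt.prodMk hyc)
  · exact hne t ht

/-! ### Gronwall estimates, compatibility and limits of linear systems -/

/-- Both time directions at once, negative times being reduced to positive ones by `s ↦ -s`. The
bound is deliberately linear in `δ` and `ε`, so that small data give a small result. -/
lemma norm_le_gronwall_abs {F : Type*} [NormedAddCommGroup F] [NormedSpace ℝ F] {f f' : ℝ → F}
    {δ K ε R : ℝ} (hK : 0 < K) (hδ : 0 ≤ δ) (hε : 0 ≤ ε) (hf : ∀ s, HasDerivAt f (f' s) s)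
    (h0 : ‖f 0‖ ≤ δ) (hb : ∀ s, |s| ≤ R → ‖f' s‖ ≤ K * ‖f s‖ + ε) {t : ℝ} (ht : |t| ≤ R) :
    ‖f t‖ ≤ (δ + ε / K) * Real.exp (K * R) := by
  have hgb : ∀ x, 0 ≤ x → x ≤ R → gronwallBound δ K ε x ≤ (δ + ε / K) * Real.exp (K * R) := by
    intro x _ hxR
    rw [gronwallBound_of_K_ne_0 hK.ne', add_mul]
    have : Real.exp (K * x) ≤ Real.exp (K * R) := by gcongr
    have h2 : 0 ≤ ε / K := by positivity
    refine add_le_add (by gcongr) ?_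
    gcongr
    linarith
  have key : ∀ (f f' : ℝ → F), (∀ s, HasDerivAt f (f' s) s) → ‖f 0‖ ≤ δ →
      (∀ s, |s| ≤ R → ‖f' s‖ ≤ K * ‖f s‖ + ε) → ∀ t, 0 ≤ t → t ≤ R →
      ‖f t‖ ≤ (δ + ε / K) * Real.exp (K * R) := by
    intro f f' hf h0 hb t ht0 htR
    have := norm_le_gronwallBound_of_norm_deriv_right_le (f := f) (f' := f') (a := 0) (b := t)
      (fun s _ => (hf s).continuousAt.continuousWithinAt) (fun s _ => (hf s).hasDerivWithinAt) h0
      (fun s hs => hb s (by rw [abs_of_nonneg hs.1]; linarith [hs.2])) t ⟨ht0, le_rfl⟩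
    rw [sub_zero] at this
    exact this.trans (hgb t ht0 htR)
  rcases le_total 0 t with h | h
  · exact key f f' hf h0 hb t h (by rwa [abs_of_nonneg h] at ht)
  · have := key (fun s => f (-s)) (fun s => -f' (-s)) (fun s => by
      have := (hf (-s)).scomp s (hasDerivAt_neg s)
      simpa using! this) (by simpa using h0) (fun s hs => by
      rw [norm_neg]; exact hb (-s) (by rwa [abs_neg])) (-t) (by linarith)
      (by rwa [abs_of_nonpos h] at ht)
    simpa using this

lemma hasDerivAt_mulVec {A : ℝ → Matrix (Fin 2) (Fin 2) ℂ} {A' : Matrix (Fin 2) (Fin 2) ℂ}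
    {v : ℝ → Fin 2 → ℂ} {v' : Fin 2 → ℂ} {t : ℝ}
    (hA : ∀ i j, HasDerivAt (fun s => A s i j) (A' i j) t) (hv : HasDerivAt v v' t) :
    HasDerivAt (fun s => A s *ᵥ v s) (A' *ᵥ v t + A t *ᵥ v') t := by
  have hv := hasDerivAt_pi.1 hv
  rw [hasDerivAt_pi]
  intro i
  simp only [Matrix.mulVec, dotProduct, Fin.sum_univ_two, Pi.add_apply]
  exact (((hA i 0).mul (hv 0)).add ((hA i 1).mul (hv 1))).congr_deriv (by ring)

lemma exists_uniform_close {F : Type*} [NormedAddCommGroup F] {ψ : ℝ → ℝ → F}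
    (hψ : Continuous fun p : ℝ × ℝ => ψ p.1 p.2) (x R : ℝ) {η : ℝ} (hη : 0 < η) :
    ∃ δ > 0, ∀ h, |h| < δ → ∀ s, |s| ≤ R → ‖ψ (x + h) s - ψ x s‖ ≤ η := by
  have hcpt : IsCompact (Icc (x - 1) (x + 1) ×ˢ Icc (-R) R) := isCompact_Icc.prod isCompact_Icc
  have huc := hcpt.uniformContinuousOn_of_continuous hψ.continuousOn
  obtain ⟨δ, hδ, H⟩ := Metric.uniformContinuousOn_iff.1 huc η hη
  refine ⟨min δ 1, by positivity, fun h hh s hs => ?_⟩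
  have h1 : |h| < 1 := hh.trans_le (min_le_right _ _)
  have h1' := abs_lt.1 h1
  have := H (x + h, s) ⟨⟨by simp; linarith, by simp; linarith⟩, abs_le.1 hs⟩ (x, s)
    ⟨⟨by simp, by simp⟩, abs_le.1 hs⟩ (by
      simp only [Prod.dist_eq, dist_self, Real.dist_eq, add_sub_cancel_left]
      rw [max_eq_left (abs_nonneg _)]
      exact hh.trans_le (min_le_left _ _))
  rw [dist_eq_norm] at this
  exact this.le

/-- If `X` and `T` satisfy the zero-curvature equation, `Y` solves `Y_t = T Y` and `Y_x = X Y`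
holds for `t = 0`, then `Y_x = X Y` holds everywhere. -/
theorem hasDerivAt_of_zero_curvature {X T Xt Tx : ℝ → ℝ → Matrix (Fin 2) (Fin 2) ℂ}
    (hX : ∀ x t i j, HasDerivAt (fun t => X x t i j) (Xt x t i j) t)
    (hT : ∀ x t i j, HasDerivAt (fun x => T x t i j) (Tx x t i j) x)
    (hTc : Continuous fun p : ℝ × ℝ => T p.1 p.2) (hTxc : Continuous fun p : ℝ × ℝ => Tx p.1 p.2)
    (zc : ∀ x t, Xt x t - Tx x t + X x t * T x t - T x t * X x t = 0)
    {Y : ℝ → ℝ → Fin 2 → ℂ} (hY : ∀ x t, HasDerivAt (Y x) (T x t *ᵥ Y x t) t)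
    (h0 : ∀ x, HasDerivAt (fun x => Y x 0) (X x 0 *ᵥ Y x 0) x) (x t : ℝ) :
    HasDerivAt (fun x => Y x t) (X x t *ᵥ Y x t) x := by
  -- `F` is the candidate for the `x`-derivative of `Y`. Zero curvature says that it solves the
  -- `t`-equation formally differentiated in `x`.
  set F : ℝ → Fin 2 → ℂ := fun s => X x s *ᵥ Y x s with hF
  have hF' : ∀ s, HasDerivAt F (Tx x s *ᵥ Y x s + T x s *ᵥ F s) s := fun s => by
    refine (hasDerivAt_mulVec (fun i j => hX x s i j) (hY x s)).congr_deriv ?_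
    rw [hF, Matrix.mulVec_mulVec, Matrix.mulVec_mulVec, ← Matrix.add_mulVec, ← Matrix.add_mulVec]
    congr 1
    have := zc x s
    rw [sub_eq_zero] at this
    rw [← this]; abel
  have hYc : Continuous (Y x) := continuous_iff_continuousAt.2 fun s => (hY x s).continuousAt
  have hFc : Continuous F := continuous_iff_continuousAt.2 fun s => (hF' s).continuousAt
  set R := |t| with hR
  obtain ⟨K₀, hK₀⟩ := ((isCompact_Icc (a := x - 1) (b := x + 1)).prod
    (isCompact_Icc (a := -R) (b := R))).exists_bound_of_continuousOn
    (continuous_entrySum.comp hTc).continuousOn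
  set K := max K₀ 1 with hKdef
  have hK : 0 < K := lt_max_of_lt_right one_pos
  have hTK : ∀ h s : ℝ, |h| ≤ 1 → |s| ≤ R → entrySum (T (x + h) s) ≤ K := fun h s hh hs => by
    have h1 := abs_le.1 hh
    refine (le_abs_self _).trans ((hK₀ (x + h, s) ⟨⟨?_, ?_⟩, abs_le.1 hs⟩).trans (le_max_left _ _))
    · simp only; linarith
    · simp only; linarith
  have hφ' : Continuous fun p : ℝ × ℝ => Tx p.1 p.2 *ᵥ Y x p.2 :=
    hTxc.matrix_mulVec (hYc.comp continuous_snd)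
  have hφF : Continuous fun p : ℝ × ℝ => T p.1 p.2 *ᵥ F p.2 :=
    hTc.matrix_mulVec (hFc.comp continuous_snd)
  rw [hasDerivAt_iff_isLittleO_nhds_zero, isLittleO_iff]
  intro c hc
  -- Gronwall is applied to `Y (x + h) - Y x - h F`: its initial value is at most `η |h|` by `h0`,
  -- and its forcing at most `2 η |h|`, one part from linearizing `T` and one from the increment of
  -- `T F`. `D` is the resulting constant.
  set D := (1 + 2 / K) * Real.exp (K * R) with hD
  have hDpos : 0 < D := by positivity
  set η := c / D with hη
  have hηpos : 0 < η := by positivity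
  obtain ⟨δ₁, hδ₁, H1⟩ := exists_uniform_close (ψ := fun ξ s => Tx ξ s *ᵥ Y x s) hφ' x R hηpos
  obtain ⟨δ₂, hδ₂, H2⟩ := exists_uniform_close (ψ := fun ξ s => T ξ s *ᵥ F s) hφF x R hηpos
  have H0 := isLittleO_iff.1 (hasDerivAt_iff_isLittleO_nhds_zero.1 (h0 x)) hηpos
  filter_upwards [H0, Metric.ball_mem_nhds (0 : ℝ) hδ₁, Metric.ball_mem_nhds (0 : ℝ) hδ₂,
    Metric.ball_mem_nhds (0 : ℝ) one_pos] with h hh0 hh1 hh2 hh3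
  simp only [mem_ball_zero_iff, Real.norm_eq_abs] at hh1 hh2 hh3 hh0 ⊢
  have hlin : ∀ s, |s| ≤ R →
      ‖T (x + h) s *ᵥ Y x s - T x s *ᵥ Y x s - h • (Tx x s *ᵥ Y x s)‖ ≤ η * |h| := fun s hs => by
    have hd : ∀ ξ ∈ Metric.ball x δ₁, HasDerivWithinAt
        (fun ξ => T ξ s *ᵥ Y x s - ξ • (Tx x s *ᵥ Y x s))
        (Tx ξ s *ᵥ Y x s - Tx x s *ᵥ Y x s) (Metric.ball x δ₁) ξ := fun ξ _ => by
      have h1 := hasDerivAt_mulVec (fun i j => hT ξ s i j) (hasDerivAt_const ξ (Y x s))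
      have h2 := (hasDerivAt_id ξ).smul_const (Tx x s *ᵥ Y x s)
      refine ((h1.sub h2).congr_deriv ?_).hasDerivWithinAt
      simp
    have hbd : ∀ ξ ∈ Metric.ball x δ₁, ‖Tx ξ s *ᵥ Y x s - Tx x s *ᵥ Y x s‖ ≤ η := fun ξ hξ => by
      have := H1 (ξ - x) (by rwa [Metric.mem_ball, Real.dist_eq] at hξ) s hs
      simpa using this
    have := (convex_ball x δ₁).norm_image_sub_le_of_norm_hasDerivWithin_le hd hbd
      (Metric.mem_ball_self hδ₁) (y := x + h) (by simpa using hh1)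
    simp only [add_sub_cancel_left, Real.norm_eq_abs] at this
    refine le_trans (le_of_eq ?_) this
    congr 1
    rw [add_smul]; abel
  have hbound := norm_le_gronwall_abs (f := fun s => Y (x + h) s - Y x s - h • F s)
    (f' := fun s => T (x + h) s *ᵥ Y (x + h) s - T x s *ᵥ Y x s -
      h • (Tx x s *ᵥ Y x s + T x s *ᵥ F s)) (δ := η * |h|) (K := K) (ε := 2 * η * |h|) (R := R)
    hK (by positivity) (by positivity)
    (fun s => ((hY (x + h) s).sub (hY x s)).sub ((hF' s).const_smul h)) hh0 (fun s hs => by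
      have e : T (x + h) s *ᵥ Y (x + h) s - T x s *ᵥ Y x s -
          h • (Tx x s *ᵥ Y x s + T x s *ᵥ F s) =
          T (x + h) s *ᵥ (Y (x + h) s - Y x s - h • F s) +
          (T (x + h) s *ᵥ Y x s - T x s *ᵥ Y x s - h • (Tx x s *ᵥ Y x s)) +
          h • (T (x + h) s *ᵥ F s - T x s *ᵥ F s) := by
        rw [Matrix.mulVec_sub, Matrix.mulVec_sub, Matrix.mulVec_smul, smul_add, smul_sub]
        abel
      rw [e]
      refine (norm_add_le _ _).trans ((add_le_add (norm_add_le _ _) le_rfl).trans ?_)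
      have b1 := (norm_mulVec_le (T (x + h) s) (Y (x + h) s - Y x s - h • F s)).trans
        (mul_le_mul_of_nonneg_right (hTK h s hh3.le hs) (norm_nonneg _))
      have b2 := hlin s hs
      have b3 : ‖h • (T (x + h) s *ᵥ F s - T x s *ᵥ F s)‖ ≤ |h| * η := by
        rw [norm_smul, Real.norm_eq_abs]
        gcongr
        exact H2 h hh2 s hs
      linarith) (t := t) le_rfl
  refine hbound.trans (le_of_eq ?_)
  have : (η * |h| + 2 * η * |h| / K) * Real.exp (K * R) = η * D * |h| := by
    rw [hD]; ring
  rw [this, hη, div_mul_cancel₀ _ hDpos.ne']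

/-- Solutions of linear differential equations converge if the coefficients converge boundedly. -/
theorem tendsto_linear_ode {l : Filter ℝ} [l.IsCountablyGenerated]
    {T : ℝ → ℝ → Matrix (Fin 2) (Fin 2) ℂ} {T' : ℝ → Matrix (Fin 2) (Fin 2) ℂ}
    {v : ℝ → ℝ → Fin 2 → ℂ} {w : ℝ → Fin 2 → ℂ} (hTc : ∀ x, Continuous (T x))
    (hTc' : Continuous T') (hK : ∀ R, ∃ K, ∀ x s, |s| ≤ R → entrySum (T x s) ≤ K)
    (hlim : ∀ s, Tendsto (fun x => T x s) l (𝓝 (T' s)))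
    (hv : ∀ x s, HasDerivAt (v x) (T x s *ᵥ v x s) s) (hw : ∀ s, HasDerivAt w (T' s *ᵥ w s) s)
    (h0 : Tendsto (fun x => v x 0) l (𝓝 (w 0))) (t : ℝ) :
    Tendsto (fun x => v x t) l (𝓝 (w t)) := by
  have hwc : Continuous w := continuous_iff_continuousAt.2 fun s => (hw s).continuousAt
  set R := |t| with hR
  have hR0 : 0 ≤ R := abs_nonneg t
  obtain ⟨K₀, hK₀⟩ := hK R
  set K := max K₀ 1
  have hKpos : 0 < K := lt_max_of_lt_right one_pos
  have hTK : ∀ x s, |s| ≤ R → entrySum (T x s) ≤ K := fun x s hs =>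
    (hK₀ x s hs).trans (le_max_left _ _)
  obtain ⟨K', hK'⟩ := (isCompact_Icc (a := -R) (b := R)).exists_bound_of_continuousOn
    (continuous_entrySum.comp hTc').continuousOn
  obtain ⟨C, hC⟩ := (isCompact_Icc (a := -R) (b := R)).exists_bound_of_continuousOn
    hwc.continuousOn
  set ρ : ℝ → ℝ → Fin 2 → ℂ := fun x σ => T x σ *ᵥ w σ - T' σ *ᵥ w σ with hρ
  have hρc : ∀ x, Continuous (ρ x) := fun x =>
    ((hTc x).matrix_mulVec hwc).sub (hTc'.matrix_mulVec hwc)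
  set J : ℝ → ℝ := fun x => ∫ σ in (-R)..R, ‖ρ x σ‖ with hJ
  have hJ0 : ∀ x, 0 ≤ J x := fun x =>
    intervalIntegral.integral_nonneg (by linarith) fun _ _ => norm_nonneg _
  have hJlim : Tendsto J l (𝓝 0) := by
    have := intervalIntegral.tendsto_integral_filter_of_dominated_convergence (μ := volume)
      (a := -R) (b := R) (l := l) (F := fun x σ => ‖ρ x σ‖) (f := fun _ => (0 : ℝ))
      (fun _ => (K + K') * C)
      (Eventually.of_forall fun x => (hρc x).norm.aestronglyMeasurable)
      (Eventually.of_forall fun x => Eventually.of_forall fun σ hσ => ?_)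
      intervalIntegrable_const (Eventually.of_forall fun σ _ => ?_)
    · simpa using this
    · have hσ' : σ ∈ Icc (-R) R := by
        rw [uIoc_of_le (by linarith)] at hσ
        exact Ioc_subset_Icc_self hσ
      rw [norm_norm]
      refine (norm_sub_le _ _).trans ?_
      rw [add_mul]
      have h1 := hC σ hσ'
      have h2 := hTK x σ (abs_le.2 hσ')
      have h3 := (le_abs_self _).trans (hK' σ hσ')
      refine add_le_add ((norm_mulVec_le _ _).trans ?_) ((norm_mulVec_le _ _).trans ?_)
      · gcongr
      · gcongr
        · exact (entrySum_nonneg _).trans h3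
        · exact h3
    · have h1 : Tendsto (fun x => T x σ *ᵥ w σ) l (𝓝 (T' σ *ᵥ w σ)) :=
        ((continuous_id.matrix_mulVec continuous_const :
          Continuous fun A : Matrix (Fin 2) (Fin 2) ℂ => A *ᵥ w σ).tendsto _).comp (hlim σ)
      have := (h1.sub_const (T' σ *ᵥ w σ)).norm
      rwa [sub_self, norm_zero] at this
  -- The coefficients converge only pointwise in time, so the forcing `ρ` is small merely in the
  -- mean. Subtracting its primitive `r`, which is uniformly small, leaves the forcing `T r`, to
  -- which Gronwall applies.
  set r : ℝ → ℝ → Fin 2 → ℂ := fun x s => ∫ σ in (0 : ℝ)..s, ρ x σ with hr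
  have hr' : ∀ x s, HasDerivAt (r x) (ρ x s) s := fun x s =>
    intervalIntegral.integral_hasDerivAt_right ((hρc x).intervalIntegrable _ _)
      ((hρc x).stronglyMeasurableAtFilter _ _) (hρc x).continuousAt
  have hrJ : ∀ x s, |s| ≤ R → ‖r x s‖ ≤ J x := fun x s hs => by
    refine (intervalIntegral.norm_integral_le_abs_integral_norm).trans ?_
    rw [hJ]
    refine (intervalIntegral.abs_integral_mono_interval (c := -R) (d := R) ?_
      (Eventually.of_forall fun _ => norm_nonneg _)
      ((hρc x).norm.intervalIntegrable _ _)).trans (le_of_eq (abs_of_nonneg (hJ0 x)))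
    have := abs_le.1 hs
    rw [uIoc_of_le (by linarith : -R ≤ R)]
    intro σ hσ
    rw [mem_uIoc] at hσ
    constructor <;> rcases hσ with hσ | hσ <;> linarith [hσ.1, hσ.2]
  have hr0 : ∀ x, r x 0 = 0 := fun x => by simp [hr]
  have hbound : ∀ x, ‖v x t - w t‖ ≤ (‖v x 0 - w 0‖ + K * J x / K) * Real.exp (K * R) + J x := by
    intro x
    have := norm_le_gronwall_abs (f := fun s => v x s - w s - r x s)
      (f' := fun s => T x s *ᵥ v x s - T' s *ᵥ w s - ρ x s) (δ := ‖v x 0 - w 0‖) (K := K)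
      (ε := K * J x) (R := R) hKpos (norm_nonneg _) (mul_nonneg hKpos.le (hJ0 x))
      (fun s => ((hv x s).sub (hw s)).sub (hr' x s)) (by simp [hr0]) (fun s hs => by
        have e : T x s *ᵥ v x s - T' s *ᵥ w s - ρ x s =
            T x s *ᵥ (v x s - w s - r x s) + T x s *ᵥ r x s := by
          simp only [hρ, Matrix.mulVec_sub]; abel
        rw [e]
        refine (norm_add_le _ _).trans (add_le_add ?_ ?_)
        · refine (norm_mulVec_le _ _).trans ?_
          gcongr
          exact hTK x s hs
        · refine (norm_mulVec_le _ _).trans ?_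
          have := hrJ x s hs
          have := hTK x s hs
          gcongr) (t := t) le_rfl
    have e : v x t - w t = (v x t - w t - r x t) + r x t := by abel
    rw [e]
    exact (norm_add_le _ _).trans (add_le_add this (hrJ x t le_rfl))
  rw [tendsto_iff_norm_sub_tendsto_zero] at h0 ⊢
  refine squeeze_zero (fun _ => norm_nonneg _) hbound ?_
  have := ((h0.add ((hJlim.const_mul K).div_const K)).mul_const (Real.exp (K * R))).add hJlim
  simpa using this

lemma eq_zero_of_linear_ode {A : ℝ → Matrix (Fin 2) (Fin 2) ℂ} (hA : Continuous A)
    {v : ℝ → Fin 2 → ℂ} (hv : ∀ s, HasDerivAt v (A s *ᵥ v s) s) {s₀ : ℝ} (h0 : v s₀ = 0) (s : ℝ) :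
    v s = 0 := by
  obtain ⟨K₀, hK₀⟩ := (isCompact_Icc (a := s₀ - |s - s₀|)
    (b := s₀ + |s - s₀|)).exists_bound_of_continuousOn (continuous_entrySum.comp hA).continuousOn
  have := norm_le_gronwall_abs (f := fun r => v (s₀ + r)) (f' := fun r => A (s₀ + r) *ᵥ v (s₀ + r))
    (δ := 0) (K := max K₀ 1) (ε := 0) (R := |s - s₀|) (lt_max_of_lt_right one_pos) le_rfl le_rfl
    (fun r => by
      have := (hv (s₀ + r)).scomp r ((hasDerivAt_id r).const_add s₀)
      simpa using! this) (by simp [h0]) (fun r hr => by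
      have hr' := abs_le.1 hr
      rw [add_zero]
      refine (norm_mulVec_le _ _).trans ?_
      gcongr
      exact (le_abs_self _).trans ((hK₀ (s₀ + r) ⟨by linarith, by linarith⟩).trans
        (le_max_left _ _))) (t := s - s₀) le_rfl
  simpa using this

/-! ### The spatial problem for a first column at `+∞` -/

/-- The uniformized wave number `k(z)` for the amplitude `r`. -/
def waveK (r : ℝ) (z : ℂ) : ℂ := (z + (r : ℂ) ^ 2 / z) / 2

/-- The uniformized spectral parameter `λ(z)` for the amplitude `r`. -/
def specL (r : ℝ) (z : ℂ) : ℂ := (z - (r : ℂ) ^ 2 / z) / 2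

/-- The spatial Lax matrix with spectral parameter `l` and potential value `p`. -/
def xMat (l p : ℂ) : Matrix (Fin 2) (Fin 2) ℂ :=
  !![Complex.I * l, Complex.I * conj p; Complex.I * p, -(Complex.I * l)]

/-- A potential of the spatial problem with background value `u₀` at `+∞`. -/
structure IsPotential (r : ℝ) (u u' : ℝ → ℂ) (u₀ : ℂ) : Prop where
  pos : 0 < r
  norm_eq : ‖u₀‖ = r
  deriv : ∀ x, HasDerivAt u (u' x) x
  cont : Continuous u'
  bdd : ∃ C, ∀ x, ‖u x‖ ≤ C
  lim : Tendsto u atTop (𝓝 u₀)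
  int : ∀ x, IntegrableOn (fun y => u y - u₀) (Ioi x)
  int' : ∀ x, IntegrableOn u' (Ioi x)

/-- `m` is the first column of the modified Jost solution at `+∞` of the potential `u`. -/
structure IsModified (r : ℝ) (u : ℝ → ℂ) (u₀ z : ℂ) (m : ℝ → Fin 2 → ℂ) : Prop where
  ode : ∀ x, HasDerivAt m
    (xMat (specL r z) (u x) *ᵥ m x - (Complex.I * waveK r z) • m x) x
  lim : Tendsto m atTop (𝓝 ![1, u₀ / z])

/-- The values of `z` for which the first Jost column at `+∞` is considered. -/
def zone (r : ℝ) : Set ℂ := {z | z ≠ 0 ∧ z ^ 2 + (r : ℂ) ^ 2 ≠ 0 ∧ 0 ≤ (waveK r z).im}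

/-- The interior part of `zone`. -/
def zoneInt (r : ℝ) : Set ℂ := {z | z ≠ 0 ∧ 0 < (waveK r z).im}

lemma zoneInt_subset (r : ℝ) : zoneInt r ⊆ zone r := by
  rintro z ⟨h0, h1⟩
  refine ⟨h0, fun h => ?_, h1.le⟩
  have : waveK r z = 0 := by
    have : waveK r z = (z ^ 2 + (r : ℂ) ^ 2) / (2 * z) := by
      rw [waveK]; field_simp
    rw [this, h, zero_div]
  rw [this] at h1
  simp at h1

lemma continuousOn_waveK (r : ℝ) : ContinuousOn (waveK r) {0}ᶜ := by
  unfold waveK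
  refine (continuousOn_id.add (continuousOn_const.div continuousOn_id fun z hz => hz)).div_const _

lemma isOpen_zoneInt (r : ℝ) : IsOpen (zoneInt r) :=
  (Complex.continuous_im.comp_continuousOn (continuousOn_waveK r)).isOpen_inter_preimage
    isOpen_compl_singleton (isOpen_Ioi (a := 0))

/-! ### Gauge transformations of the spatial equation -/

/-- The gauge matrix `I - σ₃ P / z`. -/
def gauge (p z : ℂ) : Matrix (Fin 2) (Fin 2) ℂ := !![1, -(conj p / z); p / z, 1]

/-- The inverse of the gauge matrix. -/
def gaugeInv (p z : ℂ) : Matrix (Fin 2) (Fin 2) ℂ :=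
  (1 + p * conj p / z ^ 2)⁻¹ • !![1, conj p / z; -(p / z), 1]

lemma gauge_mul_gaugeInv {p z : ℂ} (h : 1 + p * conj p / z ^ 2 ≠ 0) :
    gauge p z * gaugeInv p z = 1 := by
  rw [gauge, gaugeInv, Matrix.mul_smul]
  have : (!![1, -(conj p / z); p / z, 1] * !![1, conj p / z; -(p / z), 1] :
      Matrix (Fin 2) (Fin 2) ℂ) = (1 + p * conj p / z ^ 2) • 1 := by
    ext i j; fin_cases i <;> fin_cases j <;> simp [Matrix.mul_apply, Fin.sum_univ_two] <;> ring
  rw [this, smul_smul, inv_mul_cancel₀ h, one_smul]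

lemma gaugeInv_mul_gauge {p z : ℂ} (h : 1 + p * conj p / z ^ 2 ≠ 0) :
    gaugeInv p z * gauge p z = 1 :=
  mul_eq_one_comm.1 (gauge_mul_gaugeInv h)

/-- The defect `X Ω - i k Ω σ₃ - Ω'` of the gauge matrix with value `p` and derivative `p'`. -/
def gaugeDefect (r : ℝ) (z u p p' : ℂ) : Matrix (Fin 2) (Fin 2) ℂ :=
  !![Complex.I / z * (conj u * p - (r : ℂ) ^ 2), Complex.I * (conj u - conj p) + conj p' / z;
    Complex.I * (u - p) - p' / z, Complex.I / z * ((r : ℂ) ^ 2 - u * conj p)]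

/-- The last term comes from `i k (1 - σ₃) = diag (0, 2 i k)`: a first column is stripped of the
phase `exp (i k x)`, so only the second component of `w` keeps an exponent. -/
lemma gaugeDefect_mulVec {r : ℝ} {z : ℂ} (hz : z ≠ 0) (u p p' : ℂ) (w : Fin 2 → ℂ) :
    gaugeDefect r z u p p' *ᵥ w = xMat (specL r z) u *ᵥ (gauge p z *ᵥ w) -
      (Complex.I * waveK r z) • (gauge p z *ᵥ w) -
      !![0, -(conj p' / z); p' / z, 0] *ᵥ w +
      gauge p z *ᵥ ![0, 2 * Complex.I * waveK r z * w 1] := by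
  ext i
  fin_cases i <;>
  · simp only [mulVec_fin_two, gaugeDefect, gauge, xMat, specL, waveK, Pi.sub_apply, Pi.add_apply,
      Pi.smul_apply, smul_eq_mul, Matrix.of_apply, cons_val_zero, cons_val_one, cons_val_fin_one,
      cons_val', Fin.zero_eta, Fin.mk_one]
    field_simp
    ring

lemma hasDerivAt_conj {u : ℝ → ℂ} {u' : ℂ} {x : ℝ} (h : HasDerivAt u u' x) :
    HasDerivAt (fun x => conj (u x)) (conj u') x := by
  have := h.star
  simpa using! this

lemma hasDerivAt_gauge {p : ℝ → ℂ} {p' z : ℂ} {x : ℝ} (h : HasDerivAt p p' x) (i j : Fin 2) :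
    HasDerivAt (fun x => gauge (p x) z i j)
      ((!![0, -(conj p' / z); p' / z, 0] : Matrix (Fin 2) (Fin 2) ℂ) i j) x := by
  fin_cases i <;> fin_cases j
  · exact hasDerivAt_const _ _
  · exact ((hasDerivAt_conj h).div_const z).neg
  · exact h.div_const z
  · exact hasDerivAt_const _ _

section Gauge

variable {r : ℝ} {u p p' : ℝ → ℂ} {z : ℂ}

lemma hasDerivAt_of_gauge (hz : z ≠ 0) (hp : ∀ x, HasDerivAt p (p' x) x)
    (hne : ∀ x, 1 + p x * conj (p x) / z ^ 2 ≠ 0) {w : ℝ → Fin 2 → ℂ}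
    (hw : ∀ x, HasDerivAt w ((gaugeInv (p x) z * gaugeDefect r z (u x) (p x) (p' x)) *ᵥ w x -
      ![0, 2 * Complex.I * waveK r z * w x 1]) x) (x : ℝ) :
    HasDerivAt (fun x => gauge (p x) z *ᵥ w x) (xMat (specL r z) (u x) *ᵥ (gauge (p x) z *ᵥ w x) -
      (Complex.I * waveK r z) • (gauge (p x) z *ᵥ w x)) x := by
  refine (hasDerivAt_mulVec (hasDerivAt_gauge (hp x)) (hw x)).congr_deriv ?_
  rw [Matrix.mulVec_sub, Matrix.mulVec_mulVec, ← mul_assoc, gauge_mul_gaugeInv (hne x), one_mul,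
    gaugeDefect_mulVec hz]
  abel

lemma hasDerivAt_gaugeInv_mulVec (hz : z ≠ 0) (hp : ∀ x, HasDerivAt p (p' x) x)
    (hne : ∀ x, 1 + p x * conj (p x) / z ^ 2 ≠ 0) {m : ℝ → Fin 2 → ℂ}
    (hm : ∀ x, HasDerivAt m (xMat (specL r z) (u x) *ᵥ m x - (Complex.I * waveK r z) • m x) x)
    (x : ℝ) :
    HasDerivAt (fun x => gaugeInv (p x) z *ᵥ m x)
      ((gaugeInv (p x) z * gaugeDefect r z (u x) (p x) (p' x)) *ᵥ (gaugeInv (p x) z *ᵥ m x) -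
      ![0, 2 * Complex.I * waveK r z * (gaugeInv (p x) z *ᵥ m x) 1]) x := by
  set w : ℝ → Fin 2 → ℂ := fun x => gaugeInv (p x) z *ᵥ m x with hw
  have hmw : ∀ x, gauge (p x) z *ᵥ w x = m x := fun x => by
    rw [hw, Matrix.mulVec_mulVec, gauge_mul_gaugeInv (hne x), Matrix.one_mulVec]
  have hpx := (hp x).differentiableAt
  have hcx := (hasDerivAt_conj (hp x)).differentiableAt
  have hd : DifferentiableAt ℝ w x := by
    have hent : ∀ i j, DifferentiableAt ℝ (fun x => gaugeInv (p x) z i j) x := by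
      have h0 : DifferentiableAt ℝ (fun x => (1 + p x * conj (p x) / z ^ 2)⁻¹) x :=
        DifferentiableAt.inv (((hpx.mul hcx).div_const _).const_add 1) (hne x)
      intro i j
      fin_cases i <;> fin_cases j
      · exact h0.mul (differentiableAt_const _)
      · exact h0.mul (hcx.div_const z)
      · exact h0.mul (hpx.div_const z).neg
      · exact h0.mul (differentiableAt_const _)
    exact (hasDerivAt_mulVec (A' := fun i j => deriv (fun x => gaugeInv (p x) z i j) x)
      (fun i j => (hent i j).hasDerivAt) (hm x)).differentiableAt
  -- Once `w` is known to be differentiable, its derivative is read off from `gauge * w = m`, so the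
  -- inverse gauge is never differentiated explicitly.
  have h1 := hasDerivAt_mulVec (hasDerivAt_gauge (z := z) (hp x)) hd.hasDerivAt
  simp only [hmw] at h1
  have h2 := h1.unique (hm x)
  have h3 : deriv w x = gaugeInv (p x) z *ᵥ (gauge (p x) z *ᵥ deriv w x) := by
    rw [Matrix.mulVec_mulVec, gaugeInv_mul_gauge (hne x), Matrix.one_mulVec]
  refine hd.hasDerivAt.congr_deriv ?_
  rw [h3, eq_sub_of_add_eq' h2, ← Matrix.mulVec_mulVec, gaugeDefect_mulVec hz, hmw,
    Matrix.mulVec_add, Matrix.mulVec_mulVec _ (gaugeInv (p x) z) (gauge (p x) z),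
    gaugeInv_mul_gauge (hne x), Matrix.one_mulVec]
  abel

end Gauge

lemma entrySum_gaugeInv (p z : ℂ) : entrySum (gaugeInv p z) =
    ‖1 + p * conj p / z ^ 2‖⁻¹ * (2 + 2 * (‖p‖ / ‖z‖)) := by
  rw [gaugeInv, entrySum_smul, norm_inv, entrySum_eq]
  simp
  ring_nf
  simp

lemma mul_conj_eq_of_norm {p : ℂ} {r : ℝ} (h : ‖p‖ = r) : p * conj p = (r : ℂ) ^ 2 := by
  rw [Complex.mul_conj, Complex.normSq_eq_norm_sq, h]; push_cast; rfl

/-! ### The first Jost column at `+∞` -/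

namespace IsPotential

variable {r : ℝ} {u u' : ℝ → ℂ} {u₀ : ℂ} (hu : IsPotential r u u' u₀)
include hu

lemma continuous : Continuous u :=
  continuous_iff_continuousAt.2 fun x => (hu.deriv x).continuousAt

lemma mul_conj : u₀ * conj u₀ = (r : ℂ) ^ 2 := mul_conj_eq_of_norm hu.norm_eq

lemma det_ne {z : ℂ} (hz : z ∈ zone r) : 1 + u₀ * conj u₀ / z ^ 2 ≠ 0 := by
  rw [hu.mul_conj]
  have h0 := hz.1
  intro h
  apply hz.2.1
  field_simp at h
  simpa using h

omit hu in
/-- The coefficient matrix of the spatial problem in the constant gauge. -/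
def coeff (r : ℝ) (u : ℝ → ℂ) (u₀ z : ℂ) (x : ℝ) : Matrix (Fin 2) (Fin 2) ℂ :=
  gaugeInv u₀ z * gaugeDefect r z (u x) u₀ 0

omit hu in
/-- The constant in the bound for `coeff`. -/
def coeffBound (r : ℝ) (z : ℂ) : ℝ :=
  ‖1 + (r : ℂ) ^ 2 / z ^ 2‖⁻¹ * (2 + 2 * (r / ‖z‖)) * (2 + 2 * (r / ‖z‖))

/-- Because `u₀ * conj u₀ = r²`, every entry of the defect in the constant gauge is a multiple of `u
x - u₀` or of its conjugate. Integrability of that difference makes the Volterra theory applicable.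
-/
lemma entrySum_coeff_le (z : ℂ) (x : ℝ) :
    entrySum (coeff r u u₀ z x) ≤ coeffBound r z * ‖u x - u₀‖ := by
  refine (entrySum_mul_le _ _).trans (le_of_eq ?_)
  rw [entrySum_gaugeInv, hu.mul_conj, coeffBound, mul_assoc _ _ ‖u x - u₀‖, hu.norm_eq]
  congr 1
  have e1 : conj (u x) * u₀ - (r : ℂ) ^ 2 = conj (u x - u₀) * u₀ := by
    rw [← hu.mul_conj, map_sub]; ring
  have e2 : (r : ℂ) ^ 2 - u x * conj u₀ = -((u x - u₀) * conj u₀) := by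
    rw [← hu.mul_conj]; ring
  rw [entrySum_eq, gaugeDefect, e1, e2, ← map_sub]
  simp only [Matrix.of_apply, cons_val_zero, cons_val_one, cons_val_fin_one, cons_val', map_zero,
    zero_div, add_zero, sub_zero, norm_mul, norm_neg, norm_div, Complex.norm_I, RCLike.norm_conj,
    hu.norm_eq]
  ring

lemma isMajorant {C : ℝ} (hC : 0 ≤ C) : IsMajorant fun x => C * ‖u x - u₀‖ where
  cont := by have := hu.continuous; fun_prop
  nonneg x := by positivity
  int x := (hu.int x).norm.const_mul C

omit hu in
lemma re_two_I_waveK (r : ℝ) (z : ℂ) : (2 * Complex.I * waveK r z).re = -(2 * (waveK r z).im) := by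
  simp

lemma continuous_coeff (z : ℂ) : Continuous (coeff r u u₀ z) := by
  have := hu.continuous
  unfold coeff gaugeDefect
  refine continuous_const.matrix_mul (continuous_matrix fun i j => ?_)
  fin_cases i <;> fin_cases j <;> simp <;> fun_prop

/-- The slack between `coeffBound r z` and `C` allows one majorant for all `z` near a given point,
as the dependence on the parameter requires. -/
lemma isVolterra {z : ℂ} (hz : z ∈ zone r) {C : ℝ} (hC : coeffBound r z ≤ C) :
    IsVolterra (fun x => C * ‖u x - u₀‖) (2 * Complex.I * waveK r z) (coeff r u u₀ z) where
  maj := hu.isMajorant (le_trans (by have := hu.pos; unfold coeffBound; positivity) hC)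
  cont := hu.continuous_coeff z
  le y := (hu.entrySum_coeff_le z y).trans (by gcongr)
  re_nonpos := by rw [re_two_I_waveK]; linarith [hz.2.2]

omit hu in
/-- The first column of the modified Jost solution at `+∞`. -/
def jost (r : ℝ) (u : ℝ → ℂ) (u₀ z : ℂ) (x : ℝ) : Fin 2 → ℂ :=
  gauge u₀ z *ᵥ volterraSol ![1, 0] (2 * Complex.I * waveK r z) (coeff r u u₀ z) x

lemma isModified_jost {z : ℂ} (hz : z ∈ zone r) : IsModified r u u₀ z (jost r u u₀ z) := by
  have hV := hu.isVolterra hz le_rfl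
  constructor
  · refine hasDerivAt_of_gauge (p := fun _ => u₀) (p' := fun _ => 0) hz.1
      (fun x => hasDerivAt_const _ _) (fun _ => hu.det_ne hz) fun x => ?_
    refine (hV.hasDerivAt_volterraSol ![1, 0] x).congr_deriv ?_
    refine (congrArg₂ (· + ·) rfl ?_).trans (sub_eq_add_neg _ _).symm
    ext i; fin_cases i <;> simp
  · have h1 : Continuous fun v : Fin 2 → ℂ => gauge u₀ z *ᵥ v :=
      continuous_const.matrix_mulVec continuous_id
    have := (h1.tendsto _).comp (hV.tendsto_volterraSol ![1, 0])
    have e : (![1, u₀ / z] : Fin 2 → ℂ) = gauge u₀ z *ᵥ ![1, 0] := by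
      ext i; fin_cases i <;> simp [gauge]
    rw [e]
    exact this

/-- The inverse gauge carries the prescribed limit to `(1, 0)`, the form for which the Volterra
equation has at most one solution. -/
lemma jost_unique {z : ℂ} (hz : z ∈ zone r) {m : ℝ → Fin 2 → ℂ} (hm : IsModified r u u₀ z m) :
    m = jost r u u₀ z := by
  have hV := hu.isVolterra hz le_rfl
  have hinv : ∀ m, IsModified r u u₀ z m → Tendsto (fun x => gaugeInv u₀ z *ᵥ m x) atTop
      (𝓝 ![1, 0]) := fun m hm => by
    have h1 : Continuous fun v : Fin 2 → ℂ => gaugeInv u₀ z *ᵥ v :=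
      continuous_const.matrix_mulVec continuous_id
    have := (h1.tendsto _).comp hm.lim
    have e : (![1, u₀ / z] : Fin 2 → ℂ) = gauge u₀ z *ᵥ ![1, 0] := by
      ext i; fin_cases i <;> simp [gauge]
    rwa [e, Matrix.mulVec_mulVec, gaugeInv_mul_gauge (hu.det_ne hz), Matrix.one_mulVec] at this
  have hode := fun (m : ℝ → Fin 2 → ℂ) (hm : IsModified r u u₀ z m) =>
    hasDerivAt_gaugeInv_mulVec (p := fun _ => u₀) (p' := fun _ => 0) hz.1
      (fun x => hasDerivAt_const _ _) (fun _ => hu.det_ne hz) hm.ode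
  have hj := hu.isModified_jost hz
  have key := hV.eq_of_hasDerivAt (hode m hm) (hinv m hm) (hode _ hj) (hinv _ hj)
  ext1 x
  have := congrArg (fun v => gauge u₀ z *ᵥ v) (congrFun key x)
  simpa only [Matrix.mulVec_mulVec, gauge_mul_gaugeInv (hu.det_ne hz), Matrix.one_mulVec] using this

lemma continuousAt_coeffBound {z : ℂ} (hz : z ∈ zone r) : ContinuousAt (coeffBound r) z := by
  have h0 := hz.1
  have h1 := hu.det_ne hz
  rw [hu.mul_conj] at h1
  unfold coeffBound
  have h2 : ContinuousAt (fun z : ℂ => ‖1 + (r : ℂ) ^ 2 / z ^ 2‖⁻¹) z := by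
    refine ContinuousAt.inv₀ ?_ (norm_ne_zero_iff.2 h1)
    exact (continuousAt_const.add (continuousAt_const.div (continuousAt_id.pow 2)
      (pow_ne_zero 2 h0))).norm
  have h3 : ContinuousAt (fun z : ℂ => 2 + 2 * (r / ‖z‖)) z :=
    continuousAt_const.add (continuousAt_const.mul (continuousAt_const.div continuousAt_id.norm
      (norm_ne_zero_iff.2 h0)))
  exact (h2.mul h3).mul h3

lemma differentiableOn_coeff (x : ℝ) (i j : Fin 2) :
    DifferentiableOn ℂ (fun z => coeff r u u₀ z x i j) (zone r) := by
  have hinv : DifferentiableOn ℂ (fun z : ℂ => z⁻¹) (zone r) := fun z hz =>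
    (differentiableAt_inv hz.1).differentiableWithinAt
  have hdet : DifferentiableOn ℂ (fun z : ℂ => (1 + u₀ * conj u₀ / z ^ 2)⁻¹) (zone r) := by
    refine DifferentiableOn.inv ?_ fun z hz => hu.det_ne hz
    simp only [div_eq_mul_inv, ← inv_pow]
    exact (differentiableOn_const _).add ((differentiableOn_const _).mul (hinv.pow 2))
  simp only [coeff, Matrix.mul_apply, Fin.sum_univ_two, gaugeInv, gaugeDefect, Matrix.smul_apply,
    smul_eq_mul, div_eq_mul_inv] at hdet ⊢
  fin_cases i <;> fin_cases j <;> simp <;> fun_prop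

omit hu in
lemma differentiableOn_waveK (r : ℝ) : DifferentiableOn ℂ (waveK r) {0}ᶜ := by
  unfold waveK
  exact (differentiableOn_id.add ((differentiableOn_const _).div differentiableOn_id
    fun z hz => hz)).div_const _

omit hu in
lemma differentiableOn_gauge (p : ℂ) (i j : Fin 2) :
    DifferentiableOn ℂ (fun z => gauge p z i j) {0}ᶜ := by
  have h : ∀ q : ℂ, DifferentiableOn ℂ (fun z : ℂ => q / z) {0}ᶜ := fun q =>
    (differentiableOn_const _).div differentiableOn_id fun z hz => hz
  fin_cases i <;> fin_cases j
  · exact differentiableOn_const _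
  · exact (h _).neg
  · exact h _
  · exact differentiableOn_const _

lemma continuousOn_jost (x : ℝ) : ContinuousOn (fun z => jost r u u₀ z x) (zone r) := by
  intro z₀ hz₀
  set Z := zone r ∩ {z | coeffBound r z < coeffBound r z₀ + 1} with hZ
  have hZn : Z ∈ 𝓝[zone r] z₀ := inter_mem self_mem_nhdsWithin (mem_nhdsWithin_of_mem_nhds
    ((hu.continuousAt_coeffBound hz₀).eventually_lt_const (lt_add_one _)))
  have hz₀Z : z₀ ∈ Z := ⟨hz₀, lt_add_one (coeffBound r z₀)⟩
  have h0 : ∀ z ∈ Z, z ∈ ({0}ᶜ : Set ℂ) := fun z hz => hz.1.1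
  have h1 := continuousOn_volterraSol (Z := Z) (fun z hz => hu.isVolterra hz.1 (le_of_lt hz.2))
    ![1, 0] (continuousOn_const.mul ((continuousOn_waveK r).mono h0)) (fun y =>
      continuousOn_pi.2 fun i => continuousOn_pi.2 fun j =>
        (hu.differentiableOn_coeff y i j).continuousOn.mono inter_subset_left) x
  have h2 : ContinuousWithinAt (fun z => gauge u₀ z) Z z₀ :=
    continuousWithinAt_pi.2 fun i => continuousWithinAt_pi.2 fun j =>
      ((differentiableOn_gauge u₀ i j).continuousOn.mono h0) z₀ hz₀Z
  refine ContinuousWithinAt.mono_of_mem_nhdsWithin (t := Z) ?_ hZn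
  exact ContinuousAt.comp_continuousWithinAt
    (f := fun z => ((gauge u₀ z, volterraSol ![1, 0] (2 * Complex.I * waveK r z)
      (coeff r u u₀ z) x) : Matrix (Fin 2) (Fin 2) ℂ × (Fin 2 → ℂ)))
    continuous_mulVec_prod.continuousAt (h2.prodMk (h1 z₀ hz₀Z))

lemma differentiableOn_jost (x : ℝ) :
    DifferentiableOn ℂ (fun z => jost r u u₀ z x) (zoneInt r) := by
  intro z₀ hz₀
  set Z := zoneInt r ∩ coeffBound r ⁻¹' Iio (coeffBound r z₀ + 1) with hZ
  have hZo : IsOpen Z := ContinuousOn.isOpen_inter_preimage (fun z hz =>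
    (hu.continuousAt_coeffBound (zoneInt_subset r hz)).continuousWithinAt) (isOpen_zoneInt r)
    isOpen_Iio
  have hz₀Z : z₀ ∈ Z := ⟨hz₀, lt_add_one (coeffBound r z₀)⟩
  have h0 : ∀ z ∈ Z, z ∈ ({0}ᶜ : Set ℂ) := fun z hz => hz.1.1
  have h1 := differentiableOn_pi.1 (differentiableOn_volterraSol (Z := Z)
    (fun z hz => hu.isVolterra (zoneInt_subset r hz.1) (le_of_lt hz.2))
    ![1, 0] hZo ((differentiableOn_const _).mul ((differentiableOn_waveK r).mono h0)) (fun y i j =>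
      (hu.differentiableOn_coeff y i j).mono fun z hz => zoneInt_subset r hz.1) x)
  have h2 := fun i j => (differentiableOn_gauge u₀ i j).mono h0
  have h3 : DifferentiableOn ℂ (fun z => jost r u u₀ z x) Z := by
    refine differentiableOn_pi.2 fun i => ?_
    simp only [jost, Matrix.mulVec, dotProduct, Fin.sum_univ_two]
    exact ((h2 i 0).mul (h1 0)).add ((h2 i 1).mul (h1 1))
  exact ((h3 z₀ hz₀Z).differentiableAt (hZo.mem_nhds hz₀Z)).differentiableWithinAt

end IsPotential

/-! ### Symmetry and asymptotic behaviour -/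

/-- The antiunitary map `v ↦ (-conj v₁, conj v₀)`. -/
def flip (v : Fin 2 → ℂ) : Fin 2 → ℂ := ![-conj (v 1), conj (v 0)]

lemma continuous_flip : Continuous flip := by
  refine continuous_pi fun i => ?_
  fin_cases i
  · exact (Complex.continuous_conj.comp (continuous_apply 1)).neg
  · exact Complex.continuous_conj.comp (continuous_apply 0)

lemma flip_flip (v : Fin 2 → ℂ) : flip (flip v) = -v := by
  ext i; fin_cases i <;> simp [flip]

lemma flip_neg (v : Fin 2 → ℂ) : flip (-v) = -flip v := by
  ext i; fin_cases i <;> simp [flip]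

lemma flip_smul (a : ℂ) (v : Fin 2 → ℂ) : flip (a • v) = conj a • flip v := by
  ext i; fin_cases i <;> simp [flip]

lemma flip_sub (v w : Fin 2 → ℂ) : flip (v - w) = flip v - flip w := by
  ext i
  fin_cases i
  · simp [flip]; ring
  · simp [flip]

lemma norm_flip_le (v : Fin 2 → ℂ) : ‖flip v‖ ≤ ‖v‖ := by
  rw [pi_norm_le_iff_of_nonneg (norm_nonneg _)]
  intro i
  fin_cases i
  · simpa [flip] using norm_le_pi_norm v 1
  · simpa [flip] using norm_le_pi_norm v 0

lemma hasDerivAt_flip {v : ℝ → Fin 2 → ℂ} {v' : Fin 2 → ℂ} {x : ℝ} (h : HasDerivAt v v' x) :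
    HasDerivAt (fun x => flip (v x)) (flip v') x := by
  have h := hasDerivAt_pi.1 h
  rw [hasDerivAt_pi]
  intro i
  fin_cases i
  · exact (hasDerivAt_conj (h 1)).neg
  · exact hasDerivAt_conj (h 0)

/-- For real `l` the matrix lies in `su(2)`, whose elements commute with `flip`. Since `flip` is
antilinear, a complex `l` is conjugated. -/
lemma flip_xMat_mulVec (l p : ℂ) (v : Fin 2 → ℂ) :
    flip (xMat l p *ᵥ v) = xMat (conj l) p *ᵥ flip v := by
  rw [mulVec_fin_two, mulVec_fin_two]
  ext i
  fin_cases i <;> simp [flip, xMat]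
  ring

namespace IsModified

variable {r : ℝ} {u : ℝ → ℂ} {u₀ z : ℂ} {m : ℝ → Fin 2 → ℂ}

/-- The image of `z` under the symmetry `z ↦ -r² / conj z`. -/
lemma waveK_symm (r : ℝ) {z : ℂ} (hr : r ≠ 0) (hz : z ≠ 0) :
    waveK r (-((r : ℂ) ^ 2 / conj z)) = -conj (waveK r z) := by
  have h1 : conj z ≠ 0 := (map_ne_zero _).2 hz
  have h2 : (r : ℂ) ≠ 0 := by exact_mod_cast hr
  simp only [waveK, map_div₀, map_add, map_pow, Complex.conj_ofReal, map_ofNat]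
  field_simp
  ring

lemma specL_symm (r : ℝ) {z : ℂ} (hr : r ≠ 0) (hz : z ≠ 0) :
    specL r (-((r : ℂ) ^ 2 / conj z)) = conj (specL r z) := by
  have h1 : conj z ≠ 0 := (map_ne_zero _).2 hz
  have h2 : (r : ℂ) ≠ 0 := by exact_mod_cast hr
  simp only [specL, map_div₀, map_sub, map_pow, Complex.conj_ofReal, map_ofNat]
  field_simp
  ring

lemma zone_symm {r : ℝ} {z : ℂ} (hr : r ≠ 0) (hz : z ∈ zone r) :
    -((r : ℂ) ^ 2 / conj z) ∈ zone r := by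
  have h1 : conj z ≠ 0 := (map_ne_zero _).2 hz.1
  have h2 : (r : ℂ) ≠ 0 := by exact_mod_cast hr
  refine ⟨neg_ne_zero.2 (div_ne_zero (pow_ne_zero 2 h2) h1), fun h => hz.2.1 ?_, ?_⟩
  · field_simp at h
    have h3 : (r : ℂ) ^ 2 + conj z ^ 2 = 0 := by
      rcases mul_eq_zero.1 (show ((r : ℂ) ^ 2) * ((r : ℂ) ^ 2 + conj z ^ 2) = 0 by
        linear_combination h) with h | h
      · exact absurd h (pow_ne_zero 2 h2)
      · exact h
    have := congrArg conj h3
    simp only [map_add, map_pow, Complex.conj_ofReal, Complex.conj_conj, map_zero] at this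
    rw [add_comm]; exact this
  · rw [waveK_symm r hr hz.1]
    simpa using hz.2.2

/-- The map `z ↦ -r² / conj z` sends `λ` to `conj λ` and `k` to `-conj k`, so `flip` restores the
original spatial equation. The factor `u₀ / z` restores the normalization, by `|u₀| = r`. -/
lemma symm (hr : r ≠ 0) (hz : z ≠ 0) (hu₀ : ‖u₀‖ = r)
    (hm : IsModified r u u₀ (-((r : ℂ) ^ 2 / conj z)) m) :
    IsModified r u u₀ z fun x => (u₀ / z) • flip (m x) := by
  have h1 : conj z ≠ 0 := (map_ne_zero _).2 hz
  have h2 : (r : ℂ) ≠ 0 := by exact_mod_cast hr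
  constructor
  · intro x
    refine ((hasDerivAt_flip (hm.ode x)).const_smul (u₀ / z)).congr_deriv ?_
    rw [specL_symm r hr hz, waveK_symm r hr hz, flip_sub, flip_smul, flip_xMat_mulVec, smul_sub,
      Complex.conj_conj, Matrix.mulVec_smul]
    congr 1
    rw [smul_smul, smul_smul]
    congr 1
    simp
    ring
  · have h3 := ((continuous_flip.tendsto _).comp hm.lim).const_smul (u₀ / z)
    have hc := mul_conj_eq_of_norm hu₀
    have e : (u₀ / z) • flip ![1, u₀ / -((r : ℂ) ^ 2 / conj z)] = ![1, u₀ / z] := by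
      ext i; fin_cases i
      · simp [flip]
        field_simp
        linear_combination hc
      · simp [flip]
    rw [e] at h3
    exact h3

end IsModified

lemma continuousAt_gaugeInv {p₀ z : ℂ} (h : 1 + p₀ * conj p₀ / z ^ 2 ≠ 0) :
    ContinuousAt (fun p => gaugeInv p z) p₀ := by
  have h0 : ContinuousAt (fun p : ℂ => (1 + p * conj p / z ^ 2)⁻¹) p₀ :=
    ContinuousAt.inv₀ (by fun_prop) h
  refine continuousAt_pi.2 fun i => continuousAt_pi.2 fun j => ?_
  fin_cases i <;> fin_cases j
  · exact h0.mul continuousAt_const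
  · exact h0.mul (Complex.continuous_conj.continuousAt.div_const z)
  · exact h0.mul (continuousAt_id.div_const z).neg
  · exact h0.mul continuousAt_const

namespace IsPotential

variable {r : ℝ} {u u' : ℝ → ℂ} {u₀ : ℂ} (hu : IsPotential r u u' u₀)
include hu

lemma jost_symm {z : ℂ} (hz : z ∈ zone r) (x : ℝ) :
    jost r u u₀ z x = (u₀ / z) • flip (jost r u u₀ (-((r : ℂ) ^ 2 / conj z)) x) := by
  have h := (hu.isModified_jost (IsModified.zone_symm hu.pos.ne' hz)).symm hu.pos.ne' hz.1
    hu.norm_eq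
  exact (congrFun (hu.jost_unique hz h) x).symm

/-- With `u x` in place of `u₀` in the gauge, the off-diagonal terms without a factor `1 / z`
cancel. What remains is `(|u|² - r²) / z` on the diagonal and `u' / z` off it, so the kernel is of
order `1 / ‖z‖`. -/
lemma exists_isVolterra_moving : ∃ C h, 0 < C ∧ (∀ x, ‖u x‖ ≤ C) ∧ IsMajorant h ∧
    ∀ z ∈ zone r, 2 * C ≤ ‖z‖ →
    (∀ x, 1 + u x * conj (u x) / z ^ 2 ≠ 0) ∧ (∀ x, entrySum (gaugeInv (u x) z) ≤ 4) ∧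
    IsVolterra (fun x => 8 / ‖z‖ * h x) (2 * Complex.I * waveK r z)
      (fun x => gaugeInv (u x) z * gaugeDefect r z (u x) (u x) (u' x)) := by
  obtain ⟨C₀, hC₀⟩ := hu.bdd
  have hr := hu.pos
  have huc := hu.continuous
  have hu'c := hu.cont
  set C := max C₀ r with hC
  have hCpos : 0 < C := lt_max_of_lt_right hr
  have huC : ∀ x, ‖u x‖ ≤ C := fun x => (hC₀ x).trans (le_max_left _ _)
  set h : ℝ → ℝ := fun x => 2 * C * ‖u x - u₀‖ + ‖u' x‖ with hh
  have hmaj : IsMajorant h :=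
    ⟨by fun_prop, fun x => by positivity,
      fun x => ((hu.int x).norm.const_mul (2 * C)).add (hu.int' x).norm⟩
  refine ⟨C, h, hCpos, huC, hmaj, fun z hz hzC => ?_⟩
  have hz0 : 0 < ‖z‖ := norm_pos_iff.2 hz.1
  -- The ratio 1/2 keeps the determinant of the gauge above 3/4 in modulus and the entries of its
  -- inverse below `(3/4)⁻¹ * 3 = 4` in total; together with the bound `2 / ‖z‖ * h` for the defect
  -- this gives the factor 8.
  have hratio : ∀ x, ‖u x‖ / ‖z‖ ≤ 1 / 2 := fun x => by
    rw [div_le_iff₀ hz0]; linarith [huC x]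
  have hdet : ∀ x, 3 / 4 ≤ ‖1 + u x * conj (u x) / z ^ 2‖ := fun x => by
    have h1 : ‖u x * conj (u x) / z ^ 2‖ ≤ 1 / 4 := by
      have : ‖u x * conj (u x) / z ^ 2‖ = (‖u x‖ / ‖z‖) ^ 2 := by
        rw [norm_div, norm_mul, norm_pow, RCLike.norm_conj, div_pow, pow_two ‖u x‖]
      rw [this]
      have := hratio x
      have : 0 ≤ ‖u x‖ / ‖z‖ := by positivity
      nlinarith
    have h2 := norm_sub_le_norm_add (1 : ℂ) (u x * conj (u x) / z ^ 2)
    rw [norm_one] at h2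
    linarith
  have hne : ∀ x, 1 + u x * conj (u x) / z ^ 2 ≠ 0 := fun x h0 => by
    have := hdet x
    rw [h0, norm_zero] at this
    linarith
  have hginv : ∀ x, entrySum (gaugeInv (u x) z) ≤ 4 := fun x => by
    rw [entrySum_gaugeInv]
    have h1 : ‖1 + u x * conj (u x) / z ^ 2‖⁻¹ ≤ (3 / 4)⁻¹ := by
      have := hdet x
      gcongr
    have h2 : 2 + 2 * (‖u x‖ / ‖z‖) ≤ 3 := by linarith [hratio x]
    calc _ ≤ (3 / 4 : ℝ)⁻¹ * 3 := by gcongr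
      _ = 4 := by norm_num
  refine ⟨hne, hginv, ⟨by fun_prop (disch := exact hmaj.cont) , fun x => ?_, fun x => ?_⟩, ?_,
    fun x => ?_, ?_⟩
  · have := hmaj.nonneg x
    positivity
  · exact (hmaj.int x).const_mul _
  · refine Continuous.matrix_mul (continuous_iff_continuousAt.2 fun x =>
      (continuousAt_gaugeInv (hne x)).comp' huc.continuousAt) (continuous_matrix fun i j => ?_)
    · fin_cases i <;> fin_cases j <;> simp [gaugeDefect] <;> fun_prop
  · refine (entrySum_mul_le _ _).trans ?_
    have hd : entrySum (gaugeDefect r z (u x) (u x) (u' x)) ≤ 2 / ‖z‖ * h x := by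
      have hmod : ‖u x * conj (u x) - (r : ℂ) ^ 2‖ ≤ 2 * C * ‖u x - u₀‖ := by
        have e : u x * conj (u x) - (r : ℂ) ^ 2 = (u x - u₀) * conj (u x) +
            u₀ * conj (u x - u₀) := by
          rw [← hu.mul_conj, map_sub]; ring
        rw [e]
        refine (norm_add_le _ _).trans ?_
        rw [norm_mul, norm_mul, RCLike.norm_conj, RCLike.norm_conj, hu.norm_eq]
        have h1 := huC x
        have h2 : r ≤ C := le_max_right _ _
        have := norm_nonneg (u x - u₀)
        nlinarith
      have hmod' : ‖(r : ℂ) ^ 2 - u x * conj (u x)‖ ≤ 2 * C * ‖u x - u₀‖ := by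
        rwa [norm_sub_rev]
      rw [entrySum_eq, gaugeDefect]
      simp only [Matrix.of_apply, cons_val_zero, cons_val_one, cons_val_fin_one, cons_val',
        sub_self, mul_zero, zero_add, zero_sub, norm_mul, norm_neg, norm_div, Complex.norm_I,
        RCLike.norm_conj, mul_comm (conj (u x)) (u x)]
      have h3 : 0 ≤ 1 / ‖z‖ := by positivity
      have h4 := mul_le_mul_of_nonneg_left hmod h3
      have h5 := mul_le_mul_of_nonneg_left hmod' h3
      simp only [hh]
      have : 2 / ‖z‖ * (2 * C * ‖u x - u₀‖ + ‖u' x‖) = 1 / ‖z‖ * (2 * C * ‖u x - u₀‖) +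
        ‖u' x‖ / ‖z‖ + (‖u' x‖ / ‖z‖ + 1 / ‖z‖ * (2 * C * ‖u x - u₀‖)) := by ring
      rw [this]
      gcongr
    calc _ ≤ 4 * (2 / ‖z‖ * h x) :=
          mul_le_mul (hginv x) hd (entrySum_nonneg _) (by norm_num)
      _ = 8 / ‖z‖ * h x := by ring
  · rw [re_two_I_waveK]; linarith [hz.2.2]

lemma jost_sub_le (x₀ : ℝ) : ∃ K R, 0 < R ∧ ∀ z ∈ zone r, R ≤ ‖z‖ →
    ‖jost r u u₀ z x₀ - ![1, 0]‖ ≤ K / ‖z‖ := by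
  obtain ⟨C, h, hC, huC, hmaj, key⟩ := hu.exists_isVolterra_moving
  set H := ∫ y in Ioi x₀, h y with hH
  have hH0 : 0 ≤ H := integral_nonneg fun y => hmaj.nonneg y
  -- The condition `16 H ≤ ‖z‖` keeps the weight at `x₀` below `e`, hence `‖w‖ ≤ 2 e`. The summand
  -- with `H` then bounds the Volterra integral, and the one with `C` the return from `w` to `m`
  -- through the off-diagonal part of the gauge.
  refine ⟨2 * C * (2 * Real.exp 1) + 16 * Real.exp 1 * H, max (2 * C) (16 * H), by positivity,
    fun z hz hzR => ?_⟩
  obtain ⟨hne, hginv, hV⟩ := key z hz ((le_max_left _ _).trans hzR)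
  have hz0 : 0 < ‖z‖ := norm_pos_iff.2 hz.1
  set m := jost r u u₀ z with hm
  have hmod := hu.isModified_jost hz
  set w : ℝ → Fin 2 → ℂ := fun x => gaugeInv (u x) z *ᵥ m x with hw
  have hode := hasDerivAt_gaugeInv_mulVec (p := u) (p' := u') hz.1 hu.deriv hne hmod.ode
  have hlim : Tendsto w atTop (𝓝 ![1, 0]) := by
    have hdet := hu.det_ne hz
    have h1 := continuousAt_gaugeInv hdet
    have h2 := (continuous_mulVec_prod.tendsto (gaugeInv u₀ z, ![1, u₀ / z])).comp
      ((h1.tendsto.comp hu.lim).prodMk_nhds hmod.lim)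
    have e : (![1, u₀ / z] : Fin 2 → ℂ) = gauge u₀ z *ᵥ ![1, 0] := by
      ext i; fin_cases i <;> simp [gauge]
    have e2 : gaugeInv u₀ z *ᵥ ![1, u₀ / z] = ![1, 0] := by
      rw [e, Matrix.mulVec_mulVec, gaugeInv_mul_gauge hdet, Matrix.one_mulVec]
    rw [← e2]
    exact h2
  have hsol : w = volterraSol ![1, 0] (2 * Complex.I * waveK r z)
      (fun x => gaugeInv (u x) z * gaugeDefect r z (u x) (u x) (u' x)) := by
    refine hV.eq_of_hasDerivAt hode hlim (fun x => ?_) (hV.tendsto_volterraSol _)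
    refine (hV.hasDerivAt_volterraSol ![1, 0] x).congr_deriv ?_
    refine (congrArg₂ (· + ·) rfl ?_).trans (sub_eq_add_neg _ _).symm
    ext i; fin_cases i <;> simp
  set g : ℝ → ℝ := fun x => 8 / ‖z‖ * h x with hg
  have hwt : weight g x₀ ≤ Real.exp 1 := by
    unfold weight
    gcongr
    rw [hg, integral_const_mul, ← hH]
    have := (le_max_right _ _).trans hzR
    rw [← mul_assoc, mul_div_assoc', div_mul_eq_mul_div, div_le_one hz0]
    linarith
  have hnorm1 : ‖(![1, 0] : Fin 2 → ℂ)‖ ≤ 1 := by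
    rw [pi_norm_le_iff_of_nonneg zero_le_one]
    intro i; fin_cases i <;> simp
  have hwb : ∀ y, x₀ ≤ y → ‖w y‖ ≤ 2 * Real.exp 1 := fun y hy => by
    rw [hsol]
    refine (hV.norm_volterraSol_le _ y).trans ?_
    have h1 := hV.maj.antitone_weight hy
    have h2 := hV.maj.one_le_weight y
    calc 2 * ‖(![1, 0] : Fin 2 → ℂ)‖ * weight g y ≤ 2 * 1 * weight g y := by gcongr
      _ ≤ 2 * Real.exp 1 := by linarith
  have hw1 : ‖w x₀ - ![1, 0]‖ ≤ 16 * Real.exp 1 * H / ‖z‖ := by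
    have := hV.eq_sub_volterra (w := w) hode hlim x₀
    rw [this, sub_sub_cancel_left, norm_neg]
    refine (norm_integral_le_of_norm_le ((hV.maj.int x₀).const_mul (2 * Real.exp 1)) ?_).trans
      (le_of_eq ?_)
    · filter_upwards [ae_restrict_mem measurableSet_Ioi] with y hy
      refine (hV.norm_kernel_le (le_of_lt hy) _).trans ?_
      rw [mul_comm]
      have := hV.maj.nonneg y
      gcongr
      exact hwb y (le_of_lt hy)
    · rw [integral_const_mul, hg, integral_const_mul, ← hH]
      ring
  have e : m x₀ - ![1, 0] = (w x₀ - ![1, 0]) +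
      !![0, -(conj (u x₀) / z); u x₀ / z, 0] *ᵥ w x₀ := by
    have e1 : m x₀ = gauge (u x₀) z *ᵥ w x₀ := by
      rw [hw, Matrix.mulVec_mulVec, gauge_mul_gaugeInv (hne x₀), Matrix.one_mulVec]
    rw [e1, mulVec_fin_two, mulVec_fin_two]
    ext i
    fin_cases i
    · simp only [gauge, Pi.sub_apply, Pi.add_apply, Matrix.of_apply, cons_val_zero, cons_val_one,
        cons_val_fin_one, cons_val', Fin.zero_eta]
      ring
    · simp only [gauge, Pi.sub_apply, Pi.add_apply, Matrix.of_apply, cons_val_zero, cons_val_one,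
        cons_val_fin_one, cons_val', Fin.mk_one]
      ring
  rw [e, add_div, add_comm]
  refine (norm_add_le _ _).trans (add_le_add ?_ hw1)
  refine (norm_mulVec_le _ _).trans ?_
  have h1 : entrySum !![0, -(conj (u x₀) / z); u x₀ / z, 0] ≤ 2 * C / ‖z‖ := by
    rw [entrySum_eq]
    simp
    have : ‖u x₀‖ / ‖z‖ ≤ C / ‖z‖ := by gcongr; exact huC x₀
    calc _ ≤ C / ‖z‖ + C / ‖z‖ := add_le_add this this
      _ = _ := by ring
  calc _ ≤ 2 * C / ‖z‖ * (2 * Real.exp 1) :=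
        mul_le_mul h1 (hwb x₀ le_rfl) (norm_nonneg _) (by positivity)
    _ = _ := by ring

end IsPotential

/-! ### The Lax pair -/

/-- The matrix of the `t`-part of the Lax pair with spectral parameter `l`, in terms of the values
`a`, `b`, `c`, `d` of the field and its first three derivatives. -/
def tMat (γ κ : ℝ) (l a b c d : ℂ) : Matrix (Fin 2) (Fin 2) ℂ :=
  let D := -8 * Complex.I * γ * l ^ 4 + Complex.I * l ^ 2 * (1 + 4 * γ * (a * conj a))
    + 2 * γ * l * (a * conj b - b * conj a)
    + (-3 * Complex.I * γ * (a * conj a) ^ 2 + Complex.I * γ * (b * conj b)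
      - Complex.I * γ * (conj a * c + a * conj c) - Complex.I / 2 * (a * conj a)
      + Complex.I * κ / 2)
  !![D, -8 * Complex.I * γ * l ^ 3 * conj a - 4 * γ * l ^ 2 * conj b
      + Complex.I * l * (conj a + 4 * γ * (a * conj a) * conj a + 2 * γ * conj c)
      + 1 / 2 * conj b + 6 * γ * (a * conj a) * conj b + γ * conj d;
    -8 * Complex.I * γ * l ^ 3 * a + 4 * γ * l ^ 2 * b
      + Complex.I * l * (a + 4 * γ * (a * conj a) * a + 2 * γ * c)
      - 1 / 2 * b - 6 * γ * (a * conj a) * b - γ * d, -D]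

/-- The derivative of `tMat` along `a' = b`, `b' = c`, `c' = d`, `d' = e`. -/
def tMatDeriv (γ : ℝ) (l a b c d e : ℂ) : Matrix (Fin 2) (Fin 2) ℂ :=
  let n' := b * conj a + a * conj b
  let D := Complex.I * l ^ 2 * (4 * γ * n')
    + 2 * γ * l * (a * conj c - c * conj a)
    + (-6 * Complex.I * γ * (a * conj a) * n' + Complex.I * γ * (c * conj b + b * conj c)
      - Complex.I * γ * (conj b * c + conj a * d + b * conj c + a * conj d)
      - Complex.I / 2 * n')
  !![D, -8 * Complex.I * γ * l ^ 3 * conj b - 4 * γ * l ^ 2 * conj c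
      + Complex.I * l * (conj b + 4 * γ * (n' * conj a + a * conj a * conj b) + 2 * γ * conj d)
      + 1 / 2 * conj c + 6 * γ * (n' * conj b + a * conj a * conj c) + γ * conj e;
    -8 * Complex.I * γ * l ^ 3 * b + 4 * γ * l ^ 2 * c
      + Complex.I * l * (b + 4 * γ * (n' * a + a * conj a * b) + 2 * γ * d)
      - 1 / 2 * c - 6 * γ * (n' * b + a * conj a * c) - γ * e, -D]

lemma continuous_tMat (γ κ : ℝ) (l : ℂ) :
    Continuous fun p : ℂ × ℂ × ℂ × ℂ => tMat γ κ l p.1 p.2.1 p.2.2.1 p.2.2.2 := by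
  refine continuous_matrix fun i j => ?_
  fin_cases i <;> fin_cases j <;> simp [tMat] <;> fun_prop

lemma continuous_tMatDeriv (γ : ℝ) (l : ℂ) :
    Continuous fun p : ℂ × ℂ × ℂ × ℂ × ℂ =>
      tMatDeriv γ l p.1 p.2.1 p.2.2.1 p.2.2.2.1 p.2.2.2.2 := by
  refine continuous_matrix fun i j => ?_
  fin_cases i <;> fin_cases j <;> simp [tMatDeriv] <;> fun_prop

lemma hasDerivAt_tMat (γ κ : ℝ) (l : ℂ) {a b c d : ℝ → ℂ} {e : ℂ} {x : ℝ}
    (ha : HasDerivAt a (b x) x) (hb : HasDerivAt b (c x) x) (hc : HasDerivAt c (d x) x)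
    (hd : HasDerivAt d e x) (i j : Fin 2) :
    HasDerivAt (fun x => tMat γ κ l (a x) (b x) (c x) (d x) i j)
      (tMatDeriv γ l (a x) (b x) (c x) (d x) e i j) x := by
  have ha' := hasDerivAt_conj ha
  have hb' := hasDerivAt_conj hb
  have hc' := hasDerivAt_conj hc
  have hd' := hasDerivAt_conj hd
  have hn := ha.mul ha'
  have hD := ((((hn.const_mul (4 * (γ : ℂ))).const_add 1).const_mul
      (Complex.I * l ^ 2)).const_add (-8 * Complex.I * γ * l ^ 4)).add
    (((ha.mul hb').sub (hb.mul ha')).const_mul (2 * γ * l)) |>.add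
    ((((((hn.pow 2).const_mul (-3 * Complex.I * γ)).add
      ((hb.mul hb').const_mul (Complex.I * γ))).sub
      (((ha'.mul hc).add (ha.mul hc')).const_mul (Complex.I * γ))).sub
      (hn.const_mul (Complex.I / 2))).add_const (Complex.I * κ / 2))
  fin_cases i <;> fin_cases j
  · refine hD.congr_deriv ?_
    simp [tMatDeriv]
    ring
  · refine (((((ha'.const_mul (-8 * Complex.I * γ * l ^ 3)).sub (hb'.const_mul (4 * γ * l ^ 2))).add
      (((ha'.add ((hn.const_mul (4 * (γ : ℂ))).mul ha')).add
        (hc'.const_mul (2 * (γ : ℂ)))).const_mul (Complex.I * l))).add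
      (hb'.const_mul (1 / 2))).add ((hn.const_mul (6 * (γ : ℂ))).mul hb')).add
      (hd'.const_mul (γ : ℂ)) |>.congr_deriv ?_
    simp [tMatDeriv]
    ring
  · refine (((((ha.const_mul (-8 * Complex.I * γ * l ^ 3)).add (hb.const_mul (4 * γ * l ^ 2))).add
      (((ha.add ((hn.const_mul (4 * (γ : ℂ))).mul ha)).add
        (hc.const_mul (2 * (γ : ℂ)))).const_mul (Complex.I * l))).sub
      (hb.const_mul (1 / 2))).sub ((hn.const_mul (6 * (γ : ℂ))).mul hb)).sub
      (hd.const_mul (γ : ℂ)) |>.congr_deriv ?_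
    simp [tMatDeriv]
    ring
  · refine hD.neg.congr_deriv ?_
    simp [tMatDeriv]
    ring

/-- The zero-curvature equation in terms of the values of the field and its derivatives. -/
lemma zero_curvature {γ κ : ℝ} (l : ℂ) {a b c d e a' : ℂ}
    (h : Complex.I * a' + (1 / 2) * c + (‖a‖ : ℂ) ^ 2 * a - κ * a
      + γ * (e + 6 * (‖a‖ : ℂ) ^ 4 * a + 4 * a * conj b * b + 2 * a ^ 2 * conj c
      + 6 * conj a * b ^ 2 + 8 * (‖a‖ : ℂ) ^ 2 * c) = 0) :
    !![0, Complex.I * conj a'; Complex.I * a', 0] - tMatDeriv γ l a b c d e +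
      xMat l a * tMat γ κ l a b c d - tMat γ κ l a b c d * xMat l a = 0 := by
  have hn : (‖a‖ : ℂ) ^ 2 = a * conj a := (Complex.mul_conj' a).symm
  have hn4 : (‖a‖ : ℂ) ^ 4 = (a * conj a) ^ 2 := by rw [← hn]; ring
  rw [hn, hn4] at h
  have h' := congrArg conj h
  simp only [map_add, map_mul, map_sub, map_pow, map_div₀, map_one, map_ofNat, map_zero,
    Complex.conj_I, Complex.conj_ofReal, Complex.conj_conj] at h'
  have hI : Complex.I ^ 2 = -1 := Complex.I_sq
  -- The diagonal entries vanish identically up to `I ^ 2 = -1`; the lower left entry is the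
  -- equation and the upper right one its conjugate.
  ext i j
  fin_cases i <;> fin_cases j <;>
    simp only [Fin.zero_eta, Fin.mk_one, Matrix.add_apply, Matrix.sub_apply, Matrix.mul_apply,
      Fin.sum_univ_two, tMat, tMatDeriv, xMat, Matrix.of_apply, cons_val', cons_val_zero,
      cons_val_one, cons_val_fin_one, Matrix.zero_apply]
  · linear_combination (2 * l * γ * (conj a * c - a * conj c)) * hI
  · linear_combination (-1) * h' + (γ * (4 * l ^ 2 * conj c - 2 * conj b * b * conj a
      + 2 * conj c * conj a * a + 2 * conj a ^ 2 * c + 6 * conj a ^ 3 * a ^ 2)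
      - conj a * κ + conj a ^ 2 * a) * hI
  · linear_combination h - (γ * (4 * l ^ 2 * c - 2 * conj b * b * a
      + 2 * c * conj a * a + 2 * a ^ 2 * conj c + 6 * a ^ 3 * conj a ^ 2)
      - a * κ + a ^ 2 * conj a) * hI
  · linear_combination (-(2 * l * γ * (conj a * c - a * conj c))) * hI

namespace Data

variable (E : Data)

lemma laxX_eq (x t : ℝ) (z : ℂ) : E.laxX x t z = xMat (specL E.q₀ z) (E.q x t) := by
  ext i j
  fin_cases i <;> fin_cases j <;>
    simp [laxX, xMat, σ₃, Q, potential, dx, lam, specL]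

lemma laxT_eq (x t : ℝ) (z : ℂ) : E.laxT x t z =
    tMat E.γ E.κ (specL E.q₀ z) (E.q x t) (E.dx 1 x t) (E.dx 2 x t) (E.dx 3 x t) := by
  have h0 : E.dx 0 x t = E.q x t := by simp [dx]
  have hl : specL E.q₀ z = E.lam z := rfl
  rw [hl]
  simp only [laxT, A₂, A₁, A₀, Q, h0]
  generalize E.q x t = a
  generalize E.dx 1 x t = b
  generalize E.dx 2 x t = c
  generalize E.dx 3 x t = d
  generalize E.lam z = l
  -- `Q²` is the scalar `|q|²`, so all powers of `Q` in the Lax matrix reduce to scalar multiples of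
  -- `1` or `Q`.
  have hsq : potential a ^ 2 = (a * conj a) • (1 : Matrix (Fin 2) (Fin 2) ℂ) := by
    rw [pow_two]
    ext i j; fin_cases i <;> fin_cases j <;>
      simp [potential, Matrix.mul_apply, Fin.sum_univ_two, mul_comm]
  have hcu : potential a ^ 3 = (a * conj a) • potential a := by
    rw [pow_succ, hsq, smul_mul_assoc, one_mul]
  have hqu : potential a ^ 4 = (a * conj a) ^ 2 • (1 : Matrix (Fin 2) (Fin 2) ℂ) := by
    rw [show 4 = 2 * 2 by rfl, pow_mul, hsq, smul_pow, one_pow]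
  have hb : potential b ^ 2 = (b * conj b) • (1 : Matrix (Fin 2) (Fin 2) ℂ) := by
    rw [pow_two]
    ext i j; fin_cases i <;> fin_cases j <;>
      simp [potential, Matrix.mul_apply, Fin.sum_univ_two, mul_comm]
  rw [hsq, hcu, hqu, hb]
  ext i j
  fin_cases i <;> fin_cases j <;>
    simp [potential, Matrix.mul_apply, Fin.sum_univ_two, σ₃, tMat] <;> ring

end Data

/-! ### Reduction of all columns to the first column at `+∞` -/

/-- The sign of an end of the axis. -/
def Side.sgn : Side → ℝ
  | .minus => -1
  | .plus => 1

lemma Side.sgn_mul_self (s : Side) : s.sgn * s.sgn = 1 := by cases s <;> simp [Side.sgn]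

lemma Side.sgn_ne (s : Side) : s.sgn ≠ 0 := by cases s <;> simp [Side.sgn]

lemma Side.sgn_mul_sgn_mul (s : Side) (x : ℝ) : s.sgn * (s.sgn * x) = x := by
  rw [← mul_assoc, s.sgn_mul_self, one_mul]

lemma Side.sgn_mul_self' (s : Side) : (s.sgn : ℂ) * s.sgn = 1 := by
  exact_mod_cast s.sgn_mul_self

lemma Side.tendsto_sgn_mul (s : Side) : Tendsto (fun x => s.sgn * x) atTop s.filter := by
  cases s
  · simpa [Side.sgn, Side.filter] using tendsto_neg_atTop_atBot
  · simpa [Side.sgn, Side.filter] using! tendsto_id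

lemma Side.tendsto_sgn_mul' (s : Side) : Tendsto (fun x => s.sgn * x) s.filter atTop := by
  cases s
  · simpa [Side.sgn, Side.filter] using tendsto_neg_atBot_atTop
  · simpa [Side.sgn, Side.filter] using! tendsto_id

instance (s : Side) : s.filter.IsCountablyGenerated := by
  cases s
  · exact inferInstanceAs (atBot : Filter ℝ).IsCountablyGenerated
  · exact inferInstanceAs (atTop : Filter ℝ).IsCountablyGenerated

instance (s : Side) : s.filter.NeBot := by
  cases s
  · exact inferInstanceAs (atBot : Filter ℝ).NeBot
  · exact inferInstanceAs (atTop : Filter ℝ).NeBot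

lemma Side.sgn_mul_mem_halfLine (s : Side) (x : ℝ) : s.sgn * x ∈ s.halfLine ↔ x ∈ Ici 0 := by
  cases s <;> simp [Side.sgn, Side.halfLine]

lemma integrableOn_Ioi_of_Ici {f : ℝ → ℂ} (hf : Continuous f) (h : IntegrableOn f (Ici 0))
    (x : ℝ) : IntegrableOn f (Ioi x) := by
  have h1 : IntegrableOn f (Icc x 0) := hf.continuousOn.integrableOn_Icc
  refine (h1.union h).mono_set fun y hy => ?_
  rcases le_total y 0 with h | h
  · exact Or.inl ⟨le_of_lt hy, h⟩
  · exact Or.inr h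

/-- The sign of the exponent of the `j`-th column. -/
def colSign : Fin 2 → ℂ := ![1, -1]

lemma tendsto_tMat {α : Type*} {f : Filter α} {γ κ : ℝ} {l : ℂ} {a b c d : α → ℂ} {a₀ b₀ c₀ d₀ : ℂ}
    (ha : Tendsto a f (𝓝 a₀)) (hb : Tendsto b f (𝓝 b₀)) (hc : Tendsto c f (𝓝 c₀))
    (hd : Tendsto d f (𝓝 d₀)) :
    Tendsto (fun x => tMat γ κ l (a x) (b x) (c x) (d x)) f (𝓝 (tMat γ κ l a₀ b₀ c₀ d₀)) :=
  Tendsto.comp (g := fun p : ℂ × ℂ × ℂ × ℂ => tMat γ κ l p.1 p.2.1 p.2.2.1 p.2.2.2)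
    (f := fun x => (a x, b x, c x, d x)) ((continuous_tMat γ κ l).tendsto (a₀, b₀, c₀, d₀))
    (ha.prodMk_nhds (hb.prodMk_nhds (hc.prodMk_nhds hd)))

/-- On the background the `t`-matrix is `l - 8 γ l³ + 4 γ l r²` times the `x`-matrix, minus `(i ω /
2) σ₃`. The scalar factor produces the dispersion relation in `θ`; the last term compensates the
rotation of `q_±(t)`. -/
lemma tMat_background {γ κ r : ℝ} {l a : ℂ} (h : a * conj a = (r : ℂ) ^ 2) :
    tMat γ κ l a 0 0 0 =
      !![Complex.I * l * (l - 8 * γ * l ^ 3 + 4 * γ * l * (r : ℂ) ^ 2)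
            - Complex.I * ((r : ℂ) ^ 2 + 6 * γ * (r : ℂ) ^ 4 - κ) / 2,
          Complex.I * (l - 8 * γ * l ^ 3 + 4 * γ * l * (r : ℂ) ^ 2) * conj a;
        Complex.I * (l - 8 * γ * l ^ 3 + 4 * γ * l * (r : ℂ) ^ 2) * a,
          -(Complex.I * l * (l - 8 * γ * l ^ 3 + 4 * γ * l * (r : ℂ) ^ 2)
            - Complex.I * ((r : ℂ) ^ 2 + 6 * γ * (r : ℂ) ^ 4 - κ) / 2)] := by
  ext i j
  fin_cases i <;> fin_cases j <;> simp [tMat, h] <;> ring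

namespace Data

variable (E : Data)

/-- The factor of `t` in the phase. -/
def freq (z : ℂ) : ℂ :=
  E.k z * (E.lam z - 8 * E.γ * E.lam z ^ 3 + 4 * E.γ * E.lam z * (E.q₀ : ℂ) ^ 2) - E.ω / 2

lemma θ_eq (x t : ℝ) (z : ℂ) : E.θ x t z = E.k z * x + E.freq z * t := rfl

lemma expσ₃_apply (w : ℂ) (j : Fin 2) :
    expσ₃ w j j = Complex.exp (Complex.I * (colSign j * w)) := by
  fin_cases j <;> simp [expσ₃, colSign]

lemma modified_eq (j : Fin 2) (z : ℂ) (Ψ : ℝ → ℝ → Fin 2 → ℂ) (x t : ℝ) : E.modified j z Ψ x t =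
    Complex.exp (-(colSign j * Complex.I * (E.k z * x + E.freq z * t))) • Ψ x t := by
  rw [modified, expσ₃_apply, θ_eq]
  congr 2
  ring

/-- `m` solves the spatial problem at time `t` for the modified `j`-th column at the end `s`. -/
structure IsModCol (s : Side) (j : Fin 2) (t : ℝ) (z : ℂ) (m : ℝ → Fin 2 → ℂ) : Prop where
  ode : ∀ x, HasDerivAt m (E.laxX x t z *ᵥ m x - (colSign j * Complex.I * E.k z) • m x) x
  lim : Tendsto m s.filter (𝓝 fun i => E.Ω s t z i j)

/-- The potential at time `t`, reflected so that the end `s` becomes `+∞`. -/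
def pot (s : Side) (t x : ℝ) : ℂ := s.sgn * E.q (s.sgn * x) t

/-- The limit of `pot` at `+∞`. -/
def bg (s : Side) (t : ℝ) : ℂ := s.sgn * E.qLim s t

/-- The modified `j`-th Jost column at the end `s`. -/
def modJost (s : Side) (j : Fin 2) (t : ℝ) (z : ℂ) (x : ℝ) : Fin 2 → ℂ :=
  match j with
  | 0 => IsPotential.jost E.q₀ (E.pot s t) (E.bg s t) (s.sgn * z) (s.sgn * x)
  | 1 => flip (IsPotential.jost E.q₀ (E.pot s t) (E.bg s t) (s.sgn * conj z) (s.sgn * x))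

lemma k_conj (z : ℂ) : E.k (conj z) = conj (E.k z) := by
  simp only [k, map_div₀, map_add, map_pow, Complex.conj_ofReal, map_ofNat]

lemma lam_conj (z : ℂ) : E.lam (conj z) = conj (E.lam z) := by
  simp only [lam, map_div₀, map_sub, map_pow, Complex.conj_ofReal, map_ofNat]

lemma Ω_col_zero (s : Side) (t : ℝ) (z : ℂ) :
    (fun i => E.Ω s t z i 0) = ![1, E.qLim s t / z] := by
  ext i; fin_cases i <;> simp [Ω, σ₃, QLim, potential]; ring

lemma Ω_col_one (s : Side) (t : ℝ) (z : ℂ) :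
    (fun i => E.Ω s t z i 1) = ![-(conj (E.qLim s t) / z), 1] := by
  ext i; fin_cases i <;> simp [Ω, σ₃, QLim, potential]; ring

variable {E}

lemma IsModCol.flip_zero {s : Side} {t : ℝ} {z : ℂ} {m : ℝ → Fin 2 → ℂ}
    (h : E.IsModCol s 0 t (conj z) m) : E.IsModCol s 1 t z fun x => flip (m x) := by
  constructor
  · intro x
    refine (hasDerivAt_flip (h.ode x)).congr_deriv ?_
    have hl : conj (specL E.q₀ (conj z)) = specL E.q₀ z := by
      change conj (E.lam (conj z)) = E.lam z
      rw [lam_conj, Complex.conj_conj]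
    rw [flip_sub, flip_smul, laxX_eq, laxX_eq, flip_xMat_mulVec, hl, k_conj]
    simp [colSign]
  · have := (continuous_flip.tendsto _).comp h.lim
    rw [Ω_col_zero] at this
    have e : flip ![1, E.qLim s t / conj z] = ![-(conj (E.qLim s t) / z), 1] := by
      ext i; fin_cases i <;> simp [flip]
    rw [Ω_col_one, ← e]
    exact this

lemma IsModCol.flip_one {s : Side} {t : ℝ} {z : ℂ} {m : ℝ → Fin 2 → ℂ}
    (h : E.IsModCol s 1 t z m) : E.IsModCol s 0 t (conj z) fun x => -flip (m x) := by
  constructor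
  · intro x
    refine (hasDerivAt_flip (h.ode x)).neg.congr_deriv ?_
    have hl : conj (specL E.q₀ z) = specL E.q₀ (conj z) := (E.lam_conj z).symm
    rw [flip_sub, flip_smul, laxX_eq, laxX_eq, flip_xMat_mulVec, hl, k_conj, Matrix.mulVec_neg]
    simp only [colSign, cons_val_one, cons_val_fin_one, cons_val_zero, map_mul, map_neg,
      Complex.conj_I, neg_mul, one_mul, neg_neg, smul_neg]
    abel
  · have := ((continuous_flip.tendsto _).comp h.lim).neg
    rw [Ω_col_one] at this
    have e : -flip ![-(conj (E.qLim s t) / z), 1] = ![1, E.qLim s t / conj z] := by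
      ext i; fin_cases i <;> simp [flip]
    rw [Ω_col_zero, ← e]
    exact this

variable (E)

lemma waveK_sgn (r : ℝ) (s : Side) (z : ℂ) : waveK r (s.sgn * z) = s.sgn * waveK r z := by
  cases s
  · simp [Side.sgn, waveK, div_neg]; ring
  · simp [Side.sgn]

lemma specL_sgn (r : ℝ) (s : Side) (z : ℂ) : specL r (s.sgn * z) = s.sgn * specL r z := by
  cases s
  · simp [Side.sgn, specL, div_neg]; ring
  · simp [Side.sgn]

/-- The sign that reflection of `x` puts in front of the equation is absorbed by changing the signs
of `λ` and of the potential. This dictates the signs in `pot`, `bg` and `modJost`. -/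
lemma xMat_sgn (s : Side) (l p : ℂ) : xMat (s.sgn * l) (s.sgn * p) = (s.sgn : ℂ) • xMat l p := by
  ext i j
  fin_cases i <;> fin_cases j <;> simp [xMat] <;> ring

variable {E}

lemma IsModCol.isModified {s : Side} {t : ℝ} {z : ℂ} {m : ℝ → Fin 2 → ℂ}
    (h : E.IsModCol s 0 t z m) :
    IsModified E.q₀ (E.pot s t) (E.bg s t) (s.sgn * z) fun x => m (s.sgn * x) := by
  constructor
  · intro x
    have h1 : HasDerivAt (fun x => s.sgn * x) s.sgn x := by
      simpa using (hasDerivAt_id x).const_mul s.sgn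
    refine ((h.ode (s.sgn * x)).scomp x h1).congr_deriv ?_
    rw [pot, specL_sgn, waveK_sgn, xMat_sgn, laxX_eq, Matrix.smul_mulVec, ← Complex.coe_smul,
      smul_sub, smul_smul]
    congr 1
    congr 1
    simp [colSign, k, waveK]
    ring
  · have := h.lim.comp s.tendsto_sgn_mul
    rw [Ω_col_zero] at this
    rw [bg, mul_div_mul_left _ _ (by exact_mod_cast s.sgn_ne : (s.sgn : ℂ) ≠ 0)]
    exact this

lemma _root_.QNLS.IsModified.isModCol {s : Side} {t : ℝ} {z : ℂ} {m : ℝ → Fin 2 → ℂ}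
    (h : IsModified E.q₀ (E.pot s t) (E.bg s t) (s.sgn * z) m) :
    E.IsModCol s 0 t z fun x => m (s.sgn * x) := by
  constructor
  · intro x
    have h1 : HasDerivAt (fun x => s.sgn * x) s.sgn x := by
      simpa using (hasDerivAt_id x).const_mul s.sgn
    refine ((h.ode (s.sgn * x)).scomp x h1).congr_deriv ?_
    rw [pot, specL_sgn, waveK_sgn, s.sgn_mul_sgn_mul, xMat_sgn, laxX_eq, Matrix.smul_mulVec,
      ← Complex.coe_smul, smul_sub, smul_smul, smul_smul, s.sgn_mul_self', one_smul]
    congr 1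
    congr 1
    simp [colSign, k, waveK]
    linear_combination (Complex.I * (z + E.q₀ ^ 2 / z) / 2) * s.sgn_mul_self'
  · have := h.lim.comp s.tendsto_sgn_mul'
    rw [bg, mul_div_mul_left _ _ (by exact_mod_cast s.sgn_ne : (s.sgn : ℂ) ≠ 0)] at this
    rw [Ω_col_zero]
    exact this

/-! ### Regularity, boundedness and limits of the Lax matrices -/

namespace IsSolution

variable (hE : E.IsSolution)
include hE

omit hE in
lemma dx_zero (x t : ℝ) : E.dx 0 x t = E.q x t := by simp [dx]

lemma hasDerivAt_dx {n : ℕ} (hn : n ≤ 3) (x t : ℝ) :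
    HasDerivAt (fun y => E.dx n y t) (E.dx (n + 1) x t) x := by
  have h := (hE.contDiff_x t).differentiable_iteratedDeriv n (by
    exact_mod_cast (by omega : n < 4)) x
  have := h.hasDerivAt
  rw [← iteratedDeriv_succ] at this
  exact this

lemma hasDerivAt_q_x (x t : ℝ) : HasDerivAt (fun y => E.q y t) (E.dx 1 x t) x := by
  simpa only [dx_zero, zero_add] using hE.hasDerivAt_dx (n := 0) (by norm_num) x t

lemma hasDerivAt_q_t (x t : ℝ) : HasDerivAt (fun s => E.q x s) (E.dt x t) t :=
  (hE.differentiable_t x t).hasDerivAt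

lemma continuous_q : Continuous fun p : ℝ × ℝ => E.q p.1 p.2 := by
  simpa only [dx_zero] using hE.continuous_dx 0 (by norm_num)

lemma continuous_laxT (z : ℂ) : Continuous fun p : ℝ × ℝ => E.laxT p.1 p.2 z := by
  simp only [laxT_eq]
  exact continuous_iff_continuousAt.2 fun p => tendsto_tMat hE.continuous_q.continuousAt
    (hE.continuous_dx 1 (by norm_num)).continuousAt (hE.continuous_dx 2 (by norm_num)).continuousAt
    (hE.continuous_dx 3 (by norm_num)).continuousAt

lemma continuous_laxX (z : ℂ) (t : ℝ) : Continuous fun x => E.laxX x t z := by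
  have : Continuous fun x => E.q x t := hE.continuous_q.comp (continuous_id.prodMk continuous_const)
  simp only [laxX_eq]
  refine continuous_matrix fun i j => ?_
  fin_cases i <;> fin_cases j <;> simp [xMat] <;> fun_prop

lemma norm_qLim (s : Side) (t : ℝ) : ‖E.qLim s t‖ = E.q₀ := by
  have h1 : ‖Complex.exp (Complex.I * E.ω * t)‖ = 1 := by
    rw [Complex.norm_exp]
    simp
  cases s
  · simp [qLim, h1, hE.norm_qMinus]
  · simp [qLim, h1, hE.norm_qPlus]

lemma qLim_mul_conj (s : Side) (t : ℝ) : E.qLim s t * conj (E.qLim s t) = (E.q₀ : ℂ) ^ 2 :=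
  mul_conj_eq_of_norm (hE.norm_qLim s t)

omit hE in
lemma hasDerivAt_qLim (s : Side) (t : ℝ) :
    HasDerivAt (E.qLim s) (Complex.I * E.ω * E.qLim s t) t := by
  have h : HasDerivAt (fun t : ℝ => Complex.exp (Complex.I * E.ω * t))
      (Complex.exp (Complex.I * E.ω * t) * (Complex.I * E.ω)) t := by
    have := ((Complex.ofRealCLM.hasDerivAt (x := t)).const_mul (Complex.I * (E.ω : ℂ))).cexp
    simpa using this
  cases s
  · refine (h.const_mul E.qMinus).congr_deriv ?_
    simp only [qLim]; ring
  · refine (h.const_mul E.qPlus).congr_deriv ?_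
    simp only [qLim]; ring

lemma isPotential (s : Side) (t : ℝ) :
    IsPotential E.q₀ (E.pot s t) (fun x => E.dx 1 (s.sgn * x) t) (E.bg s t) := by
  have hn : ‖(s.sgn : ℂ)‖ = 1 := by cases s <;> simp [Side.sgn]
  have hd : ∀ x, HasDerivAt (E.pot s t) (E.dx 1 (s.sgn * x) t) x := fun x => by
    have h1 : HasDerivAt (fun x => s.sgn * x) s.sgn x := by
      simpa using (hasDerivAt_id x).const_mul s.sgn
    refine (((hE.hasDerivAt_q_x (s.sgn * x) t).scomp x h1).const_mul (s.sgn : ℂ)).congr_deriv ?_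
    rw [← Complex.coe_smul, smul_eq_mul, ← mul_assoc, s.sgn_mul_self', one_mul]
  have hc : Continuous (E.pot s t) := continuous_iff_continuousAt.2 fun x => (hd x).continuousAt
  refine ⟨hE.q₀_pos, ?_, hd, ?_, ?_, ?_, ?_, ?_⟩
  · rw [bg, norm_mul, hn, one_mul, hE.norm_qLim]
  · exact (hE.continuous_dx 1 (by norm_num)).comp
      ((continuous_const.mul continuous_id).prodMk continuous_const)
  · obtain ⟨C, hC⟩ := hE.bounded_dx 0 (by norm_num) |t|
    refine ⟨C, fun x => ?_⟩
    rw [pot, norm_mul, hn, one_mul, ← dx_zero]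
    exact hC _ _ le_rfl
  · exact ((hE.tendsto_q s t).comp s.tendsto_sgn_mul).const_mul _
  · refine integrableOn_Ioi_of_Ici (hc.sub continuous_const) ?_
    have hm : MeasurableSet s.halfLine := by
      cases s
      · exact measurableSet_Iic
      · exact measurableSet_Ici
    have h1 := ((integrable_indicator_iff hm).2 (hE.integrable_q s t)).comp_mul_left' s.sgn_ne
    rw [← integrable_indicator_iff measurableSet_Ici]
    refine (h1.const_mul (s.sgn : ℂ)).congr (Eventually.of_forall fun x => ?_)
    by_cases hx : x ∈ Ici (0 : ℝ)
    · simp only [indicator_of_mem hx, indicator_of_mem ((s.sgn_mul_mem_halfLine x).2 hx), pot, bg]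
      ring
    · simp only [indicator_of_notMem hx,
        indicator_of_notMem (fun h => hx ((s.sgn_mul_mem_halfLine x).1 h)), mul_zero]
  · exact fun x => ((hE.integrable_dx t).comp_mul_left' s.sgn_ne).integrableOn

lemma tendsto_laxT (s : Side) (t : ℝ) (z : ℂ) : Tendsto (fun x => E.laxT x t z) s.filter
    (𝓝 (tMat E.γ E.κ (specL E.q₀ z) (E.qLim s t) 0 0 0)) := by
  simp only [laxT_eq]
  exact tendsto_tMat (hE.tendsto_q s t) (hE.tendsto_dx 1 (by decide) s t)
    (hE.tendsto_dx 2 (by decide) s t) (hE.tendsto_dx 3 (by decide) s t)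

lemma exists_laxT_le (z : ℂ) (R : ℝ) : ∃ K, ∀ x t, |t| ≤ R → entrySum (E.laxT x t z) ≤ K := by
  obtain ⟨C0, h0⟩ := hE.bounded_dx 0 (by norm_num) R
  obtain ⟨C1, h1⟩ := hE.bounded_dx 1 (by norm_num) R
  obtain ⟨C2, h2⟩ := hE.bounded_dx 2 (by norm_num) R
  obtain ⟨C3, h3⟩ := hE.bounded_dx 3 (by norm_num) R
  obtain ⟨K, hK⟩ := ((isCompact_closedBall (0 : ℂ) C0).prod ((isCompact_closedBall (0 : ℂ) C1).prod
    ((isCompact_closedBall (0 : ℂ) C2).prod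
      (isCompact_closedBall (0 : ℂ) C3)))).exists_bound_of_continuousOn
    (continuous_entrySum.comp (continuous_tMat E.γ E.κ (specL E.q₀ z))).continuousOn
  refine ⟨K, fun x t ht => ?_⟩
  rw [laxT_eq, ← dx_zero]
  refine (le_abs_self _).trans (hK (E.dx 0 x t, E.dx 1 x t, E.dx 2 x t, E.dx 3 x t)
    ⟨?_, ?_, ?_, ?_⟩)
  · simpa using h0 x t ht
  · simpa using h1 x t ht
  · simpa using h2 x t ht
  · simpa using h3 x t ht

/-- The asymptotic form of the Jost columns solves the limiting `t`-equation. -/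
lemma hasDerivAt_background (s : Side) (j : Fin 2) {z : ℂ} (hz : z ≠ 0) (t : ℝ) :
    HasDerivAt (fun t : ℝ => Complex.exp (colSign j * Complex.I * (E.freq z * t)) •
        (fun i => E.Ω s t z i j))
      (tMat E.γ E.κ (specL E.q₀ z) (E.qLim s t) 0 0 0 *ᵥ
        (Complex.exp (colSign j * Complex.I * (E.freq z * t)) • (fun i => E.Ω s t z i j))) t := by
  have hq := hasDerivAt_qLim (E := E) s t
  have hqc := hasDerivAt_conj hq
  have hqq := hE.qLim_mul_conj s t
  have he : HasDerivAt (fun t : ℝ => Complex.exp (colSign j * Complex.I * (E.freq z * t)))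
      (Complex.exp (colSign j * Complex.I * (E.freq z * t)) *
        (colSign j * Complex.I * E.freq z)) t := by
    have := ((Complex.ofRealCLM.hasDerivAt (x := t)).const_mul (E.freq z)).const_mul
      (colSign j * Complex.I)
    simpa using this.cexp
  rw [tMat_background hqq, Matrix.mulVec_smul]
  set P : ℂ := specL E.q₀ z - 8 * E.γ * specL E.q₀ z ^ 3 +
    4 * E.γ * specL E.q₀ z * (E.q₀ : ℂ) ^ 2 with hP
  have hf : E.freq z = E.k z * P - E.ω / 2 := rfl
  have hω : (E.ω : ℂ) = (E.q₀ : ℂ) ^ 2 + 6 * E.γ * (E.q₀ : ℂ) ^ 4 - E.κ := by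
    simp [ω]
  rw [← hω]
  -- The relations `k + λ = z` and `k - λ = q₀² / z` express that the columns of `Ω` are
  -- eigenvectors of the background matrix.
  have hsum : E.k z + specL E.q₀ z = z := by
    simp only [k, specL]; ring
  have hqz : E.qLim s t / z * conj (E.qLim s t) = E.k z - specL E.q₀ z := by
    rw [div_mul_eq_mul_div, hqq]; simp only [k, specL]; ring
  clear_value P
  have hzq : z * (E.qLim s t / z) = E.qLim s t := by field_simp
  have hzq' : z * (conj (E.qLim s t) / z) = conj (E.qLim s t) := by field_simp
  have hqz' : conj (E.qLim s t) / z * E.qLim s t = E.k z - specL E.q₀ z := by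
    rw [← hqz]; ring
  fin_cases j
  · simp only [Fin.zero_eta, Ω_col_zero] at he ⊢
    refine (he.smul (hasDerivAt_pi.2 fun i => ?_ : HasDerivAt (fun t : ℝ => ![1, E.qLim s t / z])
      ![0, Complex.I * E.ω * E.qLim s t / z] t)).congr_deriv ?_
    · fin_cases i
      · exact hasDerivAt_const _ _
      · exact hq.div_const z
    · rw [mul_smul, ← smul_add, hf]
      congr 1
      rw [mulVec_fin_two]
      ext i; fin_cases i
      · simp [colSign]
        linear_combination (-Complex.I * P) * hqz
      · simp [colSign]
        linear_combination (Complex.I * P * (E.qLim s t / z)) * hsum + (Complex.I * P) * hzq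
  · simp only [Fin.mk_one, Ω_col_one] at he ⊢
    refine (he.smul (hasDerivAt_pi.2 fun i => ?_ : HasDerivAt
      (fun t : ℝ => ![-(conj (E.qLim s t) / z), 1])
      ![-(conj (Complex.I * E.ω * E.qLim s t) / z), 0] t)).congr_deriv ?_
    · fin_cases i
      · exact (hqc.div_const z).neg
      · exact hasDerivAt_const _ _
    · rw [mul_smul, ← smul_add, hf]
      congr 1
      rw [mulVec_fin_two]
      ext i; fin_cases i
      · simp [colSign]
        linear_combination (Complex.I * P * (conj (E.qLim s t) / z)) * hsum +
          (Complex.I * P) * hzq'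
      · simp [colSign]
        linear_combination (Complex.I * P) * hqz'

end IsSolution

end Data

/-! ### The regions of the `z`-plane -/

/-- This identifies `D_±` with the sets where `Im k` is positive or negative; on the contour `k` is
real. -/
lemma im_waveK (r : ℝ) {z : ℂ} (hz : z ≠ 0) :
    (waveK r z).im = (‖z‖ ^ 2 - r ^ 2) * z.im / (2 * ‖z‖ ^ 2) := by
  have h0 : ‖z‖ ≠ 0 := norm_ne_zero_iff.2 hz
  have h1 : (waveK r z).im = (z.im + ((r : ℂ) ^ 2 / z).im) / 2 := by
    rw [waveK, show (2 : ℂ) = ((2 : ℝ) : ℂ) by norm_num, Complex.div_ofReal_im, Complex.add_im]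
  have h2 : ((r : ℂ) ^ 2 / z).im = r ^ 2 * (-z.im / ‖z‖ ^ 2) := by
    rw [div_eq_mul_inv, ← Complex.ofReal_pow, Complex.im_ofReal_mul,
      Complex.inv_im, Complex.normSq_eq_norm_sq]
  rw [h1, h2]
  field_simp
  ring

lemma neg_mem_zone_iff {r : ℝ} {z : ℂ} :
    -z ∈ zone r ↔ z ≠ 0 ∧ z ^ 2 + (r : ℂ) ^ 2 ≠ 0 ∧ (waveK r z).im ≤ 0 := by
  have : waveK r (-z) = -waveK r z := by simpa [Side.sgn] using Data.waveK_sgn r .minus z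
  simp [zone, this]

lemma waveK_conj (r : ℝ) (z : ℂ) : waveK r (conj z) = conj (waveK r z) := by
  simp only [waveK, map_div₀, map_add, map_pow, Complex.conj_ofReal, map_ofNat]

lemma neg_conj_mem_zone_iff {r : ℝ} {z : ℂ} : -conj z ∈ zone r ↔ z ∈ zone r := by
  have h : conj z ^ 2 + (r : ℂ) ^ 2 = conj (z ^ 2 + (r : ℂ) ^ 2) := by simp
  rw [neg_mem_zone_iff, h, waveK_conj]
  simp only [zone, mem_ofPred_eq, map_ne_zero, Complex.conj_im, Left.neg_nonpos_iff]

namespace Data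

variable {E : Data}

lemma Dp_subset_zoneInt : E.Dp ⊆ zoneInt E.q₀ := by
  intro z hz
  have h0 : z ≠ 0 := by
    rintro rfl
    simp [Dp] at hz
  refine ⟨h0, ?_⟩
  rw [im_waveK _ h0]
  have := norm_pos_iff.2 h0
  exact div_pos hz (by positivity)

lemma sq_add_ne_of_mem_contour {z : ℂ} (hz : z ∈ E.contour) : z ^ 2 + (E.q₀ : ℂ) ^ 2 ≠ 0 := by
  intro h
  have : (z - Complex.I * E.q₀) * (z - -(Complex.I * E.q₀)) = 0 := by
    linear_combination h - (E.q₀ : ℂ) ^ 2 * Complex.I_sq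
  rcases mul_eq_zero.1 this with h | h
  · exact hz.2.2.1 (sub_eq_zero.1 h)
  · exact hz.2.2.2 (sub_eq_zero.1 h)

lemma im_waveK_of_mem_contour {z : ℂ} (hz : z ∈ E.contour) : (waveK E.q₀ z).im = 0 := by
  rw [im_waveK _ hz.2.1]
  rcases hz.1 with h | h <;> simp [h]

lemma union_contour_subset_zone : E.Dp ∪ E.contour ⊆ zone E.q₀ := by
  rintro z (hz | hz)
  · exact zoneInt_subset _ (Dp_subset_zoneInt hz)
  · exact ⟨hz.2.1, sq_add_ne_of_mem_contour hz, (im_waveK_of_mem_contour hz).ge⟩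

lemma conj_mem_Dp_iff {z : ℂ} : conj z ∈ E.Dp ↔ z ∈ E.Dm := by
  simp [Dp, Dm]

lemma conj_mem_Dm_iff {z : ℂ} : conj z ∈ E.Dm ↔ z ∈ E.Dp := by
  simp [Dp, Dm]

lemma conj_mem_contour {z : ℂ} (hz : z ∈ E.contour) : conj z ∈ E.contour := by
  refine ⟨by simpa using hz.1, by simpa using hz.2.1, fun h => hz.2.2.2 ?_, fun h => hz.2.2.1 ?_⟩
  · simpa using congrArg conj h
  · simpa using congrArg conj h

lemma conj_mem_union_contour {z : ℂ} (hz : z ∈ E.Dm ∪ E.contour) : conj z ∈ E.Dp ∪ E.contour :=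
  hz.imp conj_mem_Dp_iff.2 conj_mem_contour

/-- The argument at which a Jost column is expressed by the first column at `+∞`. -/
def jostArg (s : Side) (j : Fin 2) (z : ℂ) : ℂ :=
  match j with
  | 0 => s.sgn * z
  | 1 => s.sgn * conj z

/-- Both `z ↦ -z` and `z ↦ conj z` change the sign of `Im k`. Passing to the left end and passing to
the second column therefore each exchange `D₊` and `D₋`, which explains the pattern of the domains.
-/
lemma jostArg_mem_zone {s : Side} {j : Fin 2} {z : ℂ} (hz : z ∈ E.jostDomain s j) :
    jostArg s j z ∈ zone E.q₀ := by
  have key : ∀ {z}, z ∈ E.Dm ∪ E.contour → conj z ∈ zone E.q₀ := fun hz =>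
    union_contour_subset_zone (conj_mem_union_contour hz)
  fin_cases j <;> cases s
  · have : -conj (conj z) ∈ zone E.q₀ := neg_conj_mem_zone_iff.2 (key hz)
    simpa [jostArg, Side.sgn] using this
  · simpa [jostArg, Side.sgn] using union_contour_subset_zone hz
  · simpa [jostArg, Side.sgn] using neg_conj_mem_zone_iff.2 (union_contour_subset_zone hz)
  · simpa [jostArg, Side.sgn] using key hz

lemma ne_zero_of_mem_jostDomain {s : Side} {j : Fin 2} {z : ℂ} (hz : z ∈ E.jostDomain s j) :
    z ≠ 0 := by
  have := (jostArg_mem_zone hz).1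
  rintro rfl
  fin_cases j <;> simp [jostArg] at this

lemma hasDerivAt_exp_x (c k w : ℂ) (x : ℝ) :
    HasDerivAt (fun x : ℝ => Complex.exp (c * (k * x + w)))
      (Complex.exp (c * (k * x + w)) * (c * k)) x := by
  have := (((Complex.ofRealCLM.hasDerivAt (x := x)).const_mul k).add_const w).const_mul c
  simpa using this.cexp

lemma IsJostColumn.isModCol {s : Side} {j : Fin 2} {z : ℂ} {Ψ : ℝ → ℝ → Fin 2 → ℂ}
    (h : E.IsJostColumn s j z Ψ) (t : ℝ) : E.IsModCol s j t z fun x => E.modified j z Ψ x t := by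
  refine ⟨fun x => ?_, h.tendsto t⟩
  simp only [modified_eq]
  have he := hasDerivAt_exp_x (-(colSign j * Complex.I)) (E.k z) (E.freq z * t) x
  simp only [neg_mul (colSign j * Complex.I)] at he
  refine (he.smul (h.eq_x x t)).congr_deriv ?_
  rw [Matrix.mulVec_smul, smul_smul, mul_neg, neg_smul, sub_eq_add_neg, mul_comm (Complex.exp _)]

/-! ### Simultaneous solutions of the Lax pair -/

namespace IsSolution

variable (hE : E.IsSolution)
include hE

lemma continuous_laxT_t (z : ℂ) (x : ℝ) : Continuous fun t => E.laxT x t z :=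
  Continuous.comp (g := fun p : ℝ × ℝ => E.laxT p.1 p.2 z) (f := fun t => (x, t))
    (hE.continuous_laxT z) (continuous_const.prodMk continuous_id)

lemma hasDerivAt_laxX_t (z : ℂ) (x t : ℝ) (i j : Fin 2) :
    HasDerivAt (fun t => E.laxX x t z i j)
      ((!![0, Complex.I * conj (E.dt x t); Complex.I * E.dt x t, 0] : Matrix _ _ ℂ) i j) t := by
  have h := hE.hasDerivAt_q_t x t
  simp only [laxX_eq]
  fin_cases i <;> fin_cases j
  · exact hasDerivAt_const _ _
  · exact (hasDerivAt_conj h).const_mul Complex.I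
  · exact h.const_mul Complex.I
  · exact hasDerivAt_const _ _

lemma hasDerivAt_laxT_x (z : ℂ) (x t : ℝ) (i j : Fin 2) :
    HasDerivAt (fun x => E.laxT x t z i j) (tMatDeriv E.γ (specL E.q₀ z) (E.q x t) (E.dx 1 x t)
      (E.dx 2 x t) (E.dx 3 x t) (E.dx 4 x t) i j) x := by
  simp only [laxT_eq]
  exact hasDerivAt_tMat _ _ _ (hE.hasDerivAt_q_x x t) (hE.hasDerivAt_dx (by norm_num) x t)
    (hE.hasDerivAt_dx (by norm_num) x t) (hE.hasDerivAt_dx (by norm_num) x t) i j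

lemma continuous_laxT_deriv (z : ℂ) : Continuous fun p : ℝ × ℝ =>
    tMatDeriv E.γ (specL E.q₀ z) (E.q p.1 p.2) (E.dx 1 p.1 p.2)
      (E.dx 2 p.1 p.2) (E.dx 3 p.1 p.2) (E.dx 4 p.1 p.2) :=
  Continuous.comp (g := fun p : ℂ × ℂ × ℂ × ℂ × ℂ =>
      tMatDeriv E.γ (specL E.q₀ z) p.1 p.2.1 p.2.2.1 p.2.2.2.1 p.2.2.2.2)
    (f := fun p : ℝ × ℝ => (E.q p.1 p.2, E.dx 1 p.1 p.2, E.dx 2 p.1 p.2, E.dx 3 p.1 p.2,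
      E.dx 4 p.1 p.2)) (continuous_tMatDeriv _ _)
    (hE.continuous_q.prodMk ((hE.continuous_dx 1 (by norm_num)).prodMk
      ((hE.continuous_dx 2 (by norm_num)).prodMk
        ((hE.continuous_dx 3 (by norm_num)).prodMk (hE.continuous_dx 4 le_rfl)))))

lemma exists_laxT_deriv (z : ℂ) : ∃ Tx : ℝ → ℝ → Matrix (Fin 2) (Fin 2) ℂ,
    (∀ x t i j, HasDerivAt (fun x => E.laxT x t z i j) (Tx x t i j) x) ∧
    (Continuous fun p : ℝ × ℝ => Tx p.1 p.2) ∧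
    ∀ x t, !![0, Complex.I * conj (E.dt x t); Complex.I * E.dt x t, 0] - Tx x t
      + E.laxX x t z * E.laxT x t z - E.laxT x t z * E.laxX x t z = 0 := by
  refine ⟨fun x t => tMatDeriv E.γ (specL E.q₀ z) (E.q x t) (E.dx 1 x t) (E.dx 2 x t) (E.dx 3 x t)
    (E.dx 4 x t), hE.hasDerivAt_laxT_x z, hE.continuous_laxT_deriv z, fun x t => ?_⟩
  have h := hE.equation x t
  simp only [Equation] at h
  rw [laxX_eq, laxT_eq]
  exact zero_curvature _ h

/-- A solution of the spatial equation at time `0` extends to a solution of the Lax pair. -/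
lemma exists_lax_extension (z : ℂ) {J : ℝ → Fin 2 → ℂ}
    (hJ : ∀ x, HasDerivAt J (E.laxX x 0 z *ᵥ J x) x) :
    ∃ Y : ℝ → ℝ → Fin 2 → ℂ, (∀ x, Y x 0 = J x) ∧
      (∀ x t, HasDerivAt (fun y => Y y t) (E.laxX x t z *ᵥ Y x t) x) ∧
      ∀ x t, HasDerivAt (fun r => Y x r) (E.laxT x t z *ᵥ Y x t) t := by
  choose Y hY0 hY using fun x => exists_linear_ode (hE.continuous_laxT_t z x) (J x)
  refine ⟨Y, hY0, fun x t => ?_, hY⟩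
  obtain ⟨Tx, h1, h2, h3⟩ := hE.exists_laxT_deriv z
  refine hasDerivAt_of_zero_curvature (X := fun x t => E.laxX x t z) (T := fun x t => E.laxT x t z)
    (Xt := fun x t => !![0, Complex.I * conj (E.dt x t); Complex.I * E.dt x t, 0]) (Tx := Tx)
    (hE.hasDerivAt_laxX_t z) h1
    (hE.continuous_laxT z) h2 h3 hY (fun x => ?_) x t
  simpa only [hY0] using hJ x

lemma exists_limit_laxT (s : Side) (j : Fin 2) {z : ℂ} (hz : z ≠ 0) :
    ∃ T' : ℝ → Matrix (Fin 2) (Fin 2) ℂ, Continuous T' ∧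
      (∀ t, Tendsto (fun x => E.laxT x t z) s.filter (𝓝 (T' t))) ∧
      ∀ t, HasDerivAt (fun t : ℝ => Complex.exp (colSign j * Complex.I * (E.freq z * t)) •
          (fun i => E.Ω s t z i j))
        (T' t *ᵥ (Complex.exp (colSign j * Complex.I * (E.freq z * t)) •
          (fun i => E.Ω s t z i j))) t :=
  ⟨_, continuous_iff_continuousAt.2 fun t => tendsto_tMat (hasDerivAt_qLim s t).continuousAt
    tendsto_const_nhds tendsto_const_nhds tendsto_const_nhds,
    fun t => hE.tendsto_laxT s t z, hE.hasDerivAt_background s j hz⟩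

/-- A modified column at time `0` extends to a solution of both equations of the Lax pair. -/
lemma exists_isJostColumn {s : Side} {j : Fin 2} {z : ℂ} (hz : z ≠ 0) {m : ℝ → Fin 2 → ℂ}
    (hm : E.IsModCol s j 0 z m) : ∃ Ψ, E.IsJostColumn s j z Ψ := by
  have hJx (x : ℝ) : HasDerivAt
      (fun x : ℝ => Complex.exp (colSign j * Complex.I * (E.k z * x + 0)) • m x)
      (E.laxX x 0 z *ᵥ (Complex.exp (colSign j * Complex.I * (E.k z * x + 0)) • m x)) x := by
    refine ((hasDerivAt_exp_x (colSign j * Complex.I) (E.k z) 0 x).smul (hm.ode x)).congr_deriv ?_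
    rw [Matrix.mulVec_smul, smul_sub, smul_smul, sub_add_cancel]
  obtain ⟨Y, hY0, hYx, hY⟩ := hE.exists_lax_extension z hJx
  refine ⟨Y, hYx, hY, fun t => ?_⟩
  obtain ⟨T', hT', hlim, hw⟩ := hE.exists_limit_laxT s j hz
  -- The spatial exponential does not depend on `t`, so the rescaled columns still solve the
  -- `t`-equation. They converge at time 0 and hence at all times, to the explicit background
  -- solution, whose phase in `t` is then removed.
  have hlin := tendsto_linear_ode (l := s.filter) (T := fun x t => E.laxT x t z) (T' := T')
    (v := fun x t => Complex.exp (-(colSign j * Complex.I * (E.k z * x))) • Y x t)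
    (w := fun t => Complex.exp (colSign j * Complex.I * (E.freq z * t)) • fun i => E.Ω s t z i j)
    (hE.continuous_laxT_t z) hT'
    (hE.exists_laxT_le z) hlim (fun x t => ?_) hw ?_ t
  · have h2 := hlin.const_smul (Complex.exp (-(colSign j * Complex.I * (E.freq z * t))))
    rw [smul_smul, ← Complex.exp_add, neg_add_cancel, Complex.exp_zero, one_smul] at h2
    refine h2.congr fun x => ?_
    rw [modified_eq, smul_smul, ← Complex.exp_add]
    congr 2
    ring
  · refine ((hY x t).const_smul
      (Complex.exp (-(colSign j * Complex.I * (E.k z * x))))).congr_deriv ?_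
    rw [Matrix.mulVec_smul]
  · simp only [Complex.ofReal_zero, mul_zero, Complex.exp_zero, one_smul]
    refine hm.lim.congr fun x => ?_
    rw [hY0, smul_smul, ← Complex.exp_add, add_zero, neg_add_cancel, Complex.exp_zero, one_smul]

lemma isModCol_modJost {s : Side} {j : Fin 2} {z : ℂ} (hz : z ∈ E.jostDomain s j) (t : ℝ) :
    E.IsModCol s j t z (E.modJost s j t z) := by
  have h := (hE.isPotential s t).isModified_jost (jostArg_mem_zone hz)
  fin_cases j
  · exact IsModified.isModCol h
  · exact (IsModified.isModCol h).flip_zero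

lemma eq_modJost {s : Side} {j : Fin 2} {z : ℂ} (hz : z ∈ E.jostDomain s j) {t : ℝ}
    {m : ℝ → Fin 2 → ℂ} (hm : E.IsModCol s j t z m) : m = E.modJost s j t z := by
  have hu := fun {m} => (hE.isPotential s t).jost_unique (jostArg_mem_zone hz) (m := m)
  fin_cases j
  · funext x
    have h := congrFun (hu hm.isModified) (s.sgn * x)
    rw [s.sgn_mul_sgn_mul] at h
    exact h
  · funext x
    have h := congrFun (hu hm.flip_one.isModified) (s.sgn * x)
    rw [s.sgn_mul_sgn_mul] at h
    have h' := congrArg flip h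
    rw [flip_neg, flip_flip, neg_neg] at h'
    exact h'

/-- Uniqueness needs only the `x`-equation and the limit, at each time separately. The `t`-equation
matters for existence. -/
lemma existsUnique_isJostColumn {s : Side} {j : Fin 2} {z : ℂ} (hz : z ∈ E.jostDomain s j) :
    ∃! Ψ, E.IsJostColumn s j z Ψ := by
  obtain ⟨Ψ, hΨ⟩ := hE.exists_isJostColumn (ne_zero_of_mem_jostDomain hz)
    (hE.isModCol_modJost hz 0)
  refine ⟨Ψ, hΨ, fun Φ hΦ => ?_⟩
  funext x t
  have h1 := congrFun ((hE.eq_modJost hz (hΦ.isModCol t)).trans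
    (hE.eq_modJost hz (hΨ.isModCol t)).symm) x
  simp only [modified_eq] at h1
  exact smul_right_injective _ (Complex.exp_ne_zero _) h1

lemma isJostColumn_Ψ {s : Side} {j : Fin 2} {z : ℂ} (hz : z ∈ E.jostDomain s j) :
    E.IsJostColumn s j z (E.Ψ s j z) :=
  Classical.epsilon_spec (hE.existsUnique_isJostColumn hz).exists

/-- By uniqueness the abstractly chosen column agrees at every `t` with the Volterra solution built
at that time, so regularity and asymptotics in `z` carry over. -/
lemma μ_eq {s : Side} {j : Fin 2} {z : ℂ} (hz : z ∈ E.jostDomain s j) (x t : ℝ) :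
    E.μ s j x t z = E.modJost s j t z x :=
  congrFun (hE.eq_modJost hz ((hE.isJostColumn_Ψ hz).isModCol t)) x

end IsSolution

end Data

/-! ### Functions tending to a constant at a given rate -/

section Rate

variable {l : Filter ℂ} {ε f g : ℂ → ℂ} {c d : ℂ}

lemma isBigO_mul_sub_mul (hε : Tendsto ε l (𝓝 0)) (hf : (fun z => f z - c) =O[l] ε)
    (hg : (fun z => g z - d) =O[l] ε) : (fun z => f z * g z - c * d) =O[l] ε := by
  have h1 : (fun z => (f z - c) * (g z - d)) =O[l] ε := by
    simpa using hf.mul ((hg.trans_tendsto hε).isBigO_one ℂ)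
  refine ((h1.add (hg.const_mul_left c)).add (hf.const_mul_left d)).congr_left fun z => ?_
  ring

lemma isBigO_sub_sub_sub (hf : (fun z => f z - c) =O[l] ε) (hg : (fun z => g z - d) =O[l] ε) :
    (fun z => (f z - g z) - (c - d)) =O[l] ε :=
  (hf.sub hg).congr_left fun z => by ring

lemma isBigO_inv_sub_inv (hε : Tendsto ε l (𝓝 0)) (hf : (fun z => f z - c) =O[l] ε) (hc : c ≠ 0) :
    (fun z => (f z)⁻¹ - c⁻¹) =O[l] ε := by
  have h0 : Tendsto f l (𝓝 c) := tendsto_sub_nhds_zero_iff.1 (hf.trans_tendsto hε)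
  have h1 : (fun z => (f z)⁻¹) =O[l] (1 : ℂ → ℂ) := (h0.inv₀ hc).isBigO_one ℂ
  have h2 : (fun z => -c⁻¹ * ((f z - c) * (f z)⁻¹)) =O[l] ε := by
    simpa using (hf.mul h1).const_mul_left (-c⁻¹)
  refine h2.congr' ?_ EventuallyEq.rfl
  filter_upwards [h0.eventually_ne hc] with z hz
  field_simp
  ring

end Rate

/-! ### Expansions of the first column at infinity and at the origin -/

namespace IsPotential

variable {r : ℝ} {u u' : ℝ → ℂ} {u₀ : ℂ} (hu : IsPotential r u u' u₀)
include hu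

lemma jost_isBigO_infty (x : ℝ) : (fun z => jost r u u₀ z x - ![1, 0])
    =O[Bornology.cobounded ℂ ⊓ 𝓟 (zone r)] fun z => z⁻¹ := by
  obtain ⟨K, R, -, h⟩ := hu.jost_sub_le x
  refine IsBigO.of_bound K ?_
  filter_upwards [(tendsto_norm_cobounded_atTop.eventually_ge_atTop R).filter_mono inf_le_left,
    mem_inf_of_right (mem_principal_self _)] with z h1 h2
  simpa [div_eq_mul_inv] using h z h2 h1

/-- The symmetry relates a small `z` to a point of modulus `r² / ‖z‖`, where the estimate at
infinity applies. -/
lemma jost_isBigO_zero (x : ℝ) : (fun z => z • jost r u u₀ z x - ![0, u₀])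
    =O[𝓝[zone r] 0] fun z => z := by
  obtain ⟨K, R, hR, h⟩ := hu.jost_sub_le x
  have hr := hu.pos
  refine IsBigO.of_bound (r * (K / r ^ 2)) ?_
  have hs : ∀ᶠ z : ℂ in 𝓝[zone r] 0, ‖z‖ < r ^ 2 / R := by
    refine Filter.Eventually.filter_mono nhdsWithin_le_nhds ?_
    have : Tendsto (fun z : ℂ => ‖z‖) (𝓝 0) (𝓝 0) := by simpa using (continuous_norm (E := ℂ)).tendsto 0
    exact this.eventually_lt_const (by positivity)
  filter_upwards [hs, self_mem_nhdsWithin] with z h1 h2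
  have hz : 0 < ‖z‖ := norm_pos_iff.2 h2.1
  set w : ℂ := -((r : ℂ) ^ 2 / conj z) with hw
  have hwn : ‖w‖ = r ^ 2 / ‖z‖ := by
    rw [hw, norm_neg, norm_div, norm_pow, Complex.norm_real, Complex.norm_conj, Real.norm_eq_abs,
      sq_abs]
  have hwz : w ∈ zone r := IsModified.zone_symm hr.ne' h2
  have h3 := h w hwz (by
    rw [hwn, le_div_iff₀ hz]
    rw [lt_div_iff₀ hR] at h1
    linarith)
  have e : z • jost r u u₀ z x - ![0, u₀] = u₀ • flip (jost r u u₀ w x - ![1, 0]) := by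
    rw [hu.jost_symm h2 x, smul_smul, mul_div_cancel₀ _ h2.1, flip_sub, smul_sub]
    congr 1
    ext i; fin_cases i <;> simp [flip]
  rw [e, norm_smul, hu.norm_eq]
  rw [hwn] at h3
  calc r * ‖flip (jost r u u₀ w x - ![1, 0])‖ ≤ r * (K / (r ^ 2 / ‖z‖)) := by
        gcongr
        exact (norm_flip_le _).trans h3
    _ = r * (K / r ^ 2) * ‖z‖ := by field_simp

end IsPotential

/-! ### Wronskians and analyticity of the columns -/

/-- The Wronskian of two vectors. -/
def wronskian (u v : Fin 2 → ℂ) : ℂ := u 0 * v 1 - u 1 * v 0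

lemma wronskian_flip (u v : Fin 2 → ℂ) : wronskian (flip u) (flip v) = conj (wronskian u v) := by
  simp [wronskian, flip]
  ring

lemma wronskian_smul (a b : ℂ) (u v : Fin 2 → ℂ) :
    wronskian (a • u) (b • v) = a * b * wronskian u v := by
  simp [wronskian]
  ring

lemma hasDerivAt_wronskian {u v : ℝ → Fin 2 → ℂ} {l p : ℂ} {x : ℝ}
    (hu : HasDerivAt u (xMat l p *ᵥ u x) x) (hv : HasDerivAt v (xMat l p *ᵥ v x) x) :
    HasDerivAt (fun x => wronskian (u x) (v x)) 0 x := by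
  rw [hasDerivAt_pi] at hu hv
  refine (((hu 0).mul (hv 1)).sub ((hu 1).mul (hv 0))).congr_deriv ?_
  rw [mulVec_fin_two, mulVec_fin_two]
  simp [xMat]
  ring

namespace Data

variable {E : Data}

lemma isOpen_Dp : IsOpen E.Dp := by
  have : Continuous fun z : ℂ => (‖z‖ ^ 2 - E.q₀ ^ 2) * z.im := by fun_prop
  exact isOpen_lt continuous_const this

lemma isOpen_Dm : IsOpen E.Dm := by
  have : Continuous fun z : ℂ => (‖z‖ ^ 2 - E.q₀ ^ 2) * z.im := by fun_prop
  exact isOpen_lt this continuous_const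

lemma det_ofCols (u v : Fin 2 → ℂ) : (ofCols u v).det = wronskian u v := by
  simp [ofCols, wronskian, Matrix.det_fin_two]
  ring

lemma one_add_div_ne {z : ℂ} (hz : z ∈ zone E.q₀) : 1 + (E.q₀ : ℂ) ^ 2 / z ^ 2 ≠ 0 := by
  have h0 : z ^ 2 ≠ 0 := pow_ne_zero 2 hz.1
  rw [one_add_div h0]
  exact div_ne_zero hz.2.1 h0

lemma Ψ_zero (s : Side) (j : Fin 2) (z : ℂ) : E.Ψ s j z 0 0 = E.μ s j 0 0 z := by
  rw [μ, modified_eq]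
  simp

lemma a_eq (z : ℂ) : E.a z =
    wronskian (E.μ .plus 0 0 0 z) (E.μ .minus 1 0 0 z) / (1 + (E.q₀ : ℂ) ^ 2 / z ^ 2) := by
  rw [a, det_ofCols, Ψ_zero, Ψ_zero]

lemma contour_subset_jostDomain (s : Side) (j : Fin 2) : E.contour ⊆ E.jostDomain s j := by
  fin_cases j <;> cases s <;> exact subset_union_right

lemma conj_mem_jostDomain {s : Side} {z : ℂ} (hz : z ∈ E.jostDomain s 1) :
    conj z ∈ E.jostDomain s 0 := by
  cases s
  · exact hz.imp conj_mem_Dm_iff.2 conj_mem_contour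
  · exact hz.imp conj_mem_Dp_iff.2 conj_mem_contour

namespace IsSolution

variable (hE : E.IsSolution)
include hE

lemma μ_one {s : Side} {z : ℂ} (hz : z ∈ E.jostDomain s 1) (x t : ℝ) :
    E.μ s 1 x t z = flip (E.μ s 0 x t (conj z)) := by
  rw [hE.μ_eq hz, hE.μ_eq (conj_mem_jostDomain hz)]
  rfl

lemma μ_plus_zero_eq {z : ℂ} (hz : z ∈ E.Dp ∪ E.contour) (x t : ℝ) :
    E.μ .plus 0 x t z = IsPotential.jost E.q₀ (E.pot .plus t) (E.bg .plus t) z x := by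
  rw [hE.μ_eq (s := .plus) (j := 0) hz]
  simp [modJost, Side.sgn]

lemma μ_minus_one_eq {z : ℂ} (hz : z ∈ E.Dp ∪ E.contour) (x t : ℝ) : E.μ .minus 1 x t z =
    flip (IsPotential.jost E.q₀ (E.pot .minus t) (E.bg .minus t) (-conj z) (-x)) := by
  rw [hE.μ_eq (s := .minus) (j := 1) hz]
  simp [modJost, Side.sgn]

lemma continuousOn_μ_plus (x t : ℝ) :
    ContinuousOn (fun z => E.μ .plus 0 x t z) (E.Dp ∪ E.contour) :=
  (((hE.isPotential .plus t).continuousOn_jost x).mono union_contour_subset_zone).congr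
    fun _ hz => hE.μ_plus_zero_eq hz x t

lemma continuousOn_μ_minus (x t : ℝ) :
    ContinuousOn (fun z => E.μ .minus 1 x t z) (E.Dp ∪ E.contour) := by
  refine ContinuousOn.congr ?_ fun _ hz => hE.μ_minus_one_eq hz x t
  refine continuous_flip.comp_continuousOn
    (((hE.isPotential .minus t).continuousOn_jost (-x)).comp (t := zone E.q₀)
      (f := fun z : ℂ => -conj z) Complex.continuous_conj.neg.continuousOn fun z hz => ?_)
  exact neg_conj_mem_zone_iff.2 (union_contour_subset_zone hz)

lemma differentiableOn_μ_plus (x t : ℝ) (i : Fin 2) :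
    DifferentiableOn ℂ (fun z => E.μ .plus 0 x t z i) E.Dp := by
  have h := ((hE.isPotential .plus t).differentiableOn_jost x).mono Dp_subset_zoneInt
  exact (differentiableOn_pi.1 h i).congr
    fun _ hz => congrFun (hE.μ_plus_zero_eq (Or.inl hz) x t) i

omit hE in
lemma _root_.QNLS.differentiableOn_conj_conj {f : ℂ → ℂ} {s t : Set ℂ} (ht : IsOpen t)
    (hf : DifferentiableOn ℂ f t) (hs : ∀ z ∈ s, conj z ∈ t) :
    DifferentiableOn ℂ (fun z => conj (f (conj z))) s := fun z hz =>
  (differentiableAt_conj_conj_iff.2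
    (hf.differentiableAt (ht.mem_nhds (hs z hz)))).differentiableWithinAt

/-- Conjugation occurs twice, in the argument `-conj z` and in `flip`, so the result is again
holomorphic in `z`. -/
lemma differentiableOn_μ_minus (x t : ℝ) (i : Fin 2) :
    DifferentiableOn ℂ (fun z => E.μ .minus 1 x t z i) E.Dp := by
  have h := (hE.isPotential .minus t).differentiableOn_jost (-x)
  have key : ∀ j, DifferentiableOn ℂ (fun z => conj (IsPotential.jost E.q₀ (E.pot .minus t)
      (E.bg .minus t) (-conj z) (-x) j)) E.Dp := fun j => by
    have hn : DifferentiableOn ℂ (fun w => IsPotential.jost E.q₀ (E.pot .minus t)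
        (E.bg .minus t) (-w) (-x) j) (Neg.neg ⁻¹' zoneInt E.q₀) :=
      (differentiableOn_pi.1 h j).comp differentiable_id.neg.differentiableOn fun _ h => h
    refine differentiableOn_conj_conj ((isOpen_zoneInt _).preimage continuous_neg) hn fun z hz => ?_
    obtain ⟨h0, h1⟩ := Dp_subset_zoneInt hz
    have : waveK E.q₀ (-conj z) = -conj (waveK E.q₀ z) := by
      have := waveK_sgn E.q₀ .minus (conj z)
      rw [waveK_conj] at this
      simpa [Side.sgn] using this
    refine ⟨by simpa using h0, ?_⟩
    rw [this]
    simpa using h1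
  refine DifferentiableOn.congr ?_
    fun _ hz => congrFun (hE.μ_minus_one_eq (Or.inl hz) x t) i
  fin_cases i
  · simpa [flip] using (key 1).neg
  · simpa [flip] using key 0

lemma differentiableOn_a : DifferentiableOn ℂ E.a E.Dp := by
  have hp := hE.differentiableOn_μ_plus 0 0
  have hm := hE.differentiableOn_μ_minus 0 0
  refine DifferentiableOn.congr (f := fun z => wronskian (E.μ .plus 0 0 0 z) (E.μ .minus 1 0 0 z) /
    (1 + (E.q₀ : ℂ) ^ 2 / z ^ 2)) ?_ fun z _ => a_eq z
  refine (((hp 0).mul (hm 1)).sub ((hp 1).mul (hm 0))).div ((differentiableOn_const _).add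
    ((differentiableOn_const _).div (differentiableOn_id.pow 2) fun z hz => ?_)) fun z hz => ?_
  · exact pow_ne_zero 2 (Dp_subset_zoneInt hz).1
  · exact one_add_div_ne (zoneInt_subset _ (Dp_subset_zoneInt hz))

lemma continuousOn_a : ContinuousOn E.a (E.Dp ∪ E.contour) := by
  have hp := continuousOn_pi.1 (hE.continuousOn_μ_plus 0 0)
  have hm := continuousOn_pi.1 (hE.continuousOn_μ_minus 0 0)
  refine ContinuousOn.congr (f := fun z => wronskian (E.μ .plus 0 0 0 z) (E.μ .minus 1 0 0 z) /
    (1 + (E.q₀ : ℂ) ^ 2 / z ^ 2)) ?_ fun z _ => a_eq z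
  refine (((hp 0).mul (hm 1)).sub ((hp 1).mul (hm 0))).div (continuousOn_const.add
    (continuousOn_const.div (continuousOn_id.pow 2) fun z hz => ?_)) fun z hz => ?_
  · exact pow_ne_zero 2 (union_contour_subset_zone hz).1
  · exact one_add_div_ne (union_contour_subset_zone hz)

/-! ### The scattering matrix -/

/-- The spatial matrix has trace zero, so the determinant is constant in `x`. The exponentials of
the two columns cancel, and the limit at the end `s` is the determinant of `Ω`. -/
lemma det_ΨMat {s : Side} {z : ℂ} (hz : z ∈ E.contour) (x t : ℝ) :
    (E.ΨMat s x t z).det = 1 + (E.q₀ : ℂ) ^ 2 / z ^ 2 := by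
  have h0 := hE.isJostColumn_Ψ (contour_subset_jostDomain s 0 hz)
  have h1 := hE.isJostColumn_Ψ (contour_subset_jostDomain s 1 hz)
  have hd : ∀ x, HasDerivAt (fun x => wronskian (E.Ψ s 0 z x t) (E.Ψ s 1 z x t)) 0 x := fun x => by
    have e0 := h0.eq_x x t
    have e1 := h1.eq_x x t
    rw [laxX_eq] at e0 e1
    exact hasDerivAt_wronskian e0 e1
  have hc : ∀ y, wronskian (E.Ψ s 0 z y t) (E.Ψ s 1 z y t) =
      wronskian (E.Ψ s 0 z x t) (E.Ψ s 1 z x t) := fun y =>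
    is_const_of_deriv_eq_zero (fun x => (hd x).differentiableAt) (fun x => (hd x).deriv) y x
  have hW : Continuous fun p : (Fin 2 → ℂ) × (Fin 2 → ℂ) => wronskian p.1 p.2 := by
    unfold wronskian; fun_prop
  have hlim := (hW.tendsto _).comp ((h0.tendsto t).prodMk_nhds (h1.tendsto t))
  have hconst : (fun p : (Fin 2 → ℂ) × (Fin 2 → ℂ) => wronskian p.1 p.2) ∘
      (fun y => (E.modified 0 z (E.Ψ s 0 z) y t, E.modified 1 z (E.Ψ s 1 z) y t)) =
      fun _ => wronskian (E.Ψ s 0 z x t) (E.Ψ s 1 z x t) := by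
    funext y
    simp only [Function.comp_apply, modified_eq, wronskian_smul, hc y, ← Complex.exp_add]
    simp [colSign]
  rw [hconst] at hlim
  rw [ΨMat, det_ofCols, tendsto_nhds_unique tendsto_const_nhds hlim, Ω_col_zero, Ω_col_one]
  have hq := hE.qLim_mul_conj s t
  simp only [wronskian, cons_val_zero, cons_val_one, cons_val_fin_one]
  rw [← hq]
  ring

lemma det_ΨMat_ne {s : Side} {z : ℂ} (hz : z ∈ E.contour) (x t : ℝ) : (E.ΨMat s x t z).det ≠ 0 := by
  rw [hE.det_ΨMat hz]
  exact one_add_div_ne (union_contour_subset_zone (Or.inr hz))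

/-- The definition of `S` gives the relation at the origin. Uniqueness for linear equations carries
it along the `x`-axis at `t = 0` and then in `t` for each fixed `x`. -/
lemma ΨMat_plus {z : ℂ} (hz : z ∈ E.contour) (x t : ℝ) :
    E.ΨMat .plus x t z = E.ΨMat .minus x t z * E.S z := by
  have hΨ := fun s j => hE.isJostColumn_Ψ (contour_subset_jostDomain s j hz)
  have h00 : E.ΨMat .plus 0 0 z = E.ΨMat .minus 0 0 z * E.S z := by
    rw [S, ← Matrix.mul_assoc, Matrix.mul_nonsing_inv _ (hE.det_ΨMat_ne hz 0 0).isUnit,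
      Matrix.one_mul]
  have key : ∀ j, E.Ψ .plus j z x t -
      (E.S z 0 j • E.Ψ .minus 0 z x t + E.S z 1 j • E.Ψ .minus 1 z x t) = 0 := fun j => by
    have h0 : E.Ψ .plus j z 0 0 -
        (E.S z 0 j • E.Ψ .minus 0 z 0 0 + E.S z 1 j • E.Ψ .minus 1 z 0 0) = 0 := by
      rw [sub_eq_zero]
      ext i
      have := congrFun (congrFun h00 i) j
      fin_cases i <;> fin_cases j <;>
        simpa [ΨMat, ofCols, Matrix.mul_apply, Fin.sum_univ_two, mul_comm] using this
    have hx := eq_zero_of_linear_ode (A := fun x => E.laxX x 0 z) (hE.continuous_laxX z 0)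
      (v := fun x => E.Ψ .plus j z x 0 -
        (E.S z 0 j • E.Ψ .minus 0 z x 0 + E.S z 1 j • E.Ψ .minus 1 z x 0)) (fun x => by
        refine (((hΨ .plus j).eq_x x 0).sub ((((hΨ .minus 0).eq_x x 0).const_smul (E.S z 0 j)).add
          (((hΨ .minus 1).eq_x x 0).const_smul (E.S z 1 j)))).congr_deriv ?_
        rw [Matrix.mulVec_sub, Matrix.mulVec_add, Matrix.mulVec_smul, Matrix.mulVec_smul]) h0 x
    exact eq_zero_of_linear_ode (A := fun t => E.laxT x t z) (hE.continuous_laxT_t z x)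
      (v := fun t => E.Ψ .plus j z x t -
        (E.S z 0 j • E.Ψ .minus 0 z x t + E.S z 1 j • E.Ψ .minus 1 z x t)) (fun t => by
        refine (((hΨ .plus j).eq_t x t).sub ((((hΨ .minus 0).eq_t x t).const_smul (E.S z 0 j)).add
          (((hΨ .minus 1).eq_t x t).const_smul (E.S z 1 j)))).congr_deriv ?_
        rw [Matrix.mulVec_sub, Matrix.mulVec_add, Matrix.mulVec_smul, Matrix.mulVec_smul]) hx t
  ext i j
  have := congrFun (sub_eq_zero.1 (key j)) i
  fin_cases i <;> fin_cases j <;>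
    simpa [ΨMat, ofCols, Matrix.mul_apply, Fin.sum_univ_two, mul_comm] using this

omit hE in
lemma expσ₃_mul_neg (w : ℂ) : expσ₃ (-w) * expσ₃ w = 1 := by
  ext i j
  fin_cases i <;> fin_cases j <;> simp [expσ₃, ← Complex.exp_add]

omit hE in
lemma μMat_eq (s : Side) (x t : ℝ) (z : ℂ) :
    E.μMat s x t z = E.ΨMat s x t z * expσ₃ (-(E.θ x t z)) := by
  ext i j
  fin_cases i <;> fin_cases j <;>
    simp [μMat, ΨMat, ofCols, μ, modified, expσ₃, Matrix.mul_apply, mul_comm]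

lemma μMat_plus {z : ℂ} (hz : z ∈ E.contour) (x t : ℝ) : E.μMat .plus x t z =
    E.μMat .minus x t z * expσ₃ (E.θ x t z) * E.S z * expσ₃ (-(E.θ x t z)) := by
  rw [μMat_eq, μMat_eq, Matrix.mul_assoc (E.ΨMat .minus x t z), expσ₃_mul_neg, Matrix.mul_one,
    hE.ΨMat_plus hz]

lemma S_eq {z : ℂ} (hz : z ∈ E.contour) : E.S z =
    (1 + (E.q₀ : ℂ) ^ 2 / z ^ 2)⁻¹ •
      !![wronskian (E.μ .plus 0 0 0 z) (E.μ .minus 1 0 0 z),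
          wronskian (E.μ .plus 1 0 0 z) (E.μ .minus 1 0 0 z);
        wronskian (E.μ .minus 0 0 0 z) (E.μ .plus 0 0 0 z),
          wronskian (E.μ .minus 0 0 0 z) (E.μ .plus 1 0 0 z)] := by
  rw [S, Matrix.inv_def, hE.det_ΨMat hz, Ring.inverse_eq_inv', Matrix.smul_mul]
  congr 1
  ext i j
  fin_cases i <;> fin_cases j <;>
    simp [ΨMat, ofCols, Matrix.adjugate_fin_two, Matrix.mul_apply, Fin.sum_univ_two, wronskian,
      Ψ_zero] <;> ring

/-- By Cramer's rule the entries are Wronskians. Second columns are flips of first columns at `conj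
z`, and `flip` conjugates Wronskians. -/
lemma S_symm {z : ℂ} (hz : z ∈ E.contour) :
    E.S z = !![E.a z, -conj (E.b (conj z)); E.b z, conj (E.a (conj z))] := by
  have hz' := conj_mem_contour hz
  have h1 : ∀ s, E.μ s 1 0 0 z = flip (E.μ s 0 0 0 (conj z)) := fun s =>
    hE.μ_one (contour_subset_jostDomain s 1 hz) 0 0
  have h2 : ∀ s, E.μ s 1 0 0 (conj z) = flip (E.μ s 0 0 0 z) := fun s => by
    simpa using hE.μ_one (contour_subset_jostDomain s 1 hz') 0 0
  ext i j
  fin_cases i <;> fin_cases j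
  · simp [hE.S_eq hz, a_eq, div_eq_inv_mul]
  · simp [hE.S_eq hz, hE.S_eq hz', b, h1, wronskian_flip]
    simp [wronskian]
    ring
  · simp [b]
  · simp [hE.S_eq hz, a_eq, h1, h2, div_eq_inv_mul]
    simp [wronskian, flip]
    exact Or.inl (by ring)

end IsSolution

end Data

/-! ### Reflection between `D₊` and `D₋` -/

namespace Data

/-- The antilinear involution of `2 × 2` matrices which exchanges `M⁺` and `M⁻`. -/
def reflect (N : Matrix (Fin 2) (Fin 2) ℂ) : Matrix (Fin 2) (Fin 2) ℂ :=
  !![conj (N 1 1), -conj (N 1 0); -conj (N 0 1), conj (N 0 0)]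

lemma continuous_reflect : Continuous reflect := by
  refine continuous_matrix fun i j => ?_
  fin_cases i <;> fin_cases j <;> simp only [reflect] <;>
    first
    | exact Complex.continuous_conj.comp (continuous_id.matrix_elem _ _)
    | exact (Complex.continuous_conj.comp (continuous_id.matrix_elem _ _)).neg

lemma reflect_apply (i j : Fin 2) : ∃ (c : ℂ) (i' j' : Fin 2), ∀ N, reflect N i j = c * conj (N i' j') := by
  fin_cases i <;> fin_cases j
  · exact ⟨1, 1, 1, fun N => by simp [reflect]⟩
  · exact ⟨-1, 1, 0, fun N => by simp [reflect]⟩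
  · exact ⟨-1, 0, 1, fun N => by simp [reflect]⟩
  · exact ⟨1, 0, 0, fun N => by simp [reflect]⟩

variable {E : Data}

lemma Dm_disjoint {z : ℂ} (hz : z ∈ E.Dm) : z ∉ E.Dp := fun h =>
  lt_asymm (show 0 < (‖z‖ ^ 2 - E.q₀ ^ 2) * z.im from h) hz

lemma M_of_mem_Dp {z : ℂ} (hz : z ∈ E.Dp) (x t : ℝ) : E.M x t z = E.MPlus x t z := by
  rw [M, if_pos hz]

lemma tendsto_conj_Dm (z : ℂ) : Tendsto conj (𝓝[E.Dm] z) (𝓝[E.Dp] (conj z)) :=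
  tendsto_nhdsWithin_iff.2 ⟨(Complex.continuous_conj.tendsto z).mono_left nhdsWithin_le_nhds,
    eventually_mem_nhdsWithin.mono fun _ h => conj_mem_Dp_iff.2 h⟩

lemma tendsto_conj_cobounded : Tendsto conj (Bornology.cobounded ℂ ⊓ 𝓟 E.Dm)
    (Bornology.cobounded ℂ ⊓ 𝓟 E.Dp) := by
  refine tendsto_inf.2 ⟨Tendsto.mono_left ?_ inf_le_left, tendsto_principal.2 ?_⟩
  · rw [← tendsto_norm_atTop_iff_cobounded]
    simpa using tendsto_norm_cobounded_atTop
  · exact mem_inf_of_right fun z hz => conj_mem_Dp_iff.2 hz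

/-- Entrywise bounds are inherited under reflection. -/
lemma isBigO_reflect {l l' : Filter ℂ} (hl : Tendsto conj l' l)
    {N : ℂ → Matrix (Fin 2) (Fin 2) ℂ} {g : ℂ → ℂ} (h : ∀ i j, (fun z => N z i j) =O[l] g)
    (hg : ∀ z, ‖g (conj z)‖ = ‖g z‖) (i j : Fin 2) :
    (fun z => reflect (N (conj z)) i j) =O[l'] g := by
  obtain ⟨c, i', j', hc⟩ := reflect_apply i j
  simp only [hc]
  refine IsBigO.const_mul_left ?_ c
  have h1 := (h i' j').comp_tendsto hl
  refine IsBigO.of_norm_left ?_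
  refine IsBigO.of_norm_right ?_
  simpa [Function.comp_def, hg] using h1.norm_left.norm_right

namespace IsSolution

variable (hE : E.IsSolution)
include hE

lemma μ_zero {s : Side} {z : ℂ} (hz : conj z ∈ E.jostDomain s 1) (x t : ℝ) :
    E.μ s 0 x t z = -flip (E.μ s 1 x t (conj z)) := by
  rw [hE.μ_one hz, Complex.conj_conj, flip_flip, neg_neg]

lemma MMinus_eq {z : ℂ} (hz : z ∈ E.Dm ∪ E.contour) (x t : ℝ) :
    E.MMinus x t z = reflect (E.MPlus x t (conj z)) := by
  have h1 : E.μ .plus 1 x t z = flip (E.μ .plus 0 x t (conj z)) := hE.μ_one (s := .plus) hz x t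
  have h0 : E.μ .minus 0 x t z = -flip (E.μ .minus 1 x t (conj z)) :=
    hE.μ_zero (s := .minus) (conj_mem_union_contour hz) x t
  ext i j
  fin_cases i <;> fin_cases j <;> simp [MMinus, MPlus, ofCols, reflect, h0, h1, flip]

lemma M_of_mem_Dm {z : ℂ} (hz : z ∈ E.Dm) (x t : ℝ) :
    E.M x t z = reflect (E.MPlus x t (conj z)) := by
  rw [M, if_neg (Dm_disjoint hz), hE.MMinus_eq (Or.inl hz)]

/-! ### Analyticity and boundary values -/

/-- The denominator is `a` or 1, so poles can come only from zeros of `a`. Inversion preserves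
meromorphy even for the zero function, so it need not be known here that `a` is not identically
zero. -/
lemma exists_MPlus_quotient (x t : ℝ) (i j : Fin 2) : ∃ n d : ℂ → ℂ, DifferentiableOn ℂ n E.Dp ∧
    DifferentiableOn ℂ d E.Dp ∧ ∀ z, E.MPlus x t z i j = n z * (d z)⁻¹ := by
  have hp := hE.differentiableOn_μ_plus x t
  have hm := hE.differentiableOn_μ_minus x t
  fin_cases i <;> fin_cases j
  · exact ⟨_, _, hp 0, hE.differentiableOn_a, fun z => mul_comm _ _⟩
  · exact ⟨_, 1, hm 0, differentiableOn_const _, fun z => by simp [MPlus, ofCols]⟩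
  · exact ⟨_, _, hp 1, hE.differentiableOn_a, fun z => mul_comm _ _⟩
  · exact ⟨_, 1, hm 1, differentiableOn_const _, fun z => by simp [MPlus, ofCols]⟩

omit hE in
lemma meromorphicAt_of_quotient {f n d : ℂ → ℂ} {s : Set ℂ} (hs : IsOpen s)
    (hn : DifferentiableOn ℂ n s) (hd : DifferentiableOn ℂ d s) (hf : ∀ z ∈ s, f z = n z * (d z)⁻¹)
    {z : ℂ} (hz : z ∈ s) : MeromorphicAt f z := by
  have hs' := hs.mem_nhds hz
  refine MeromorphicAt.congr ((hn.analyticAt hs').meromorphicAt.mul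
    (hd.analyticAt hs').meromorphicAt.inv) ?_
  refine Filter.EventuallyEq.filter_mono ?_ nhdsWithin_le_nhds
  filter_upwards [hs'] with w hw
  simp [hf w hw]

lemma meromorphicOn_M (x t : ℝ) (i j : Fin 2) :
    MeromorphicOn (fun z => E.M x t z i j) (E.Dp ∪ E.Dm) := by
  rintro z (hz | hz)
  · obtain ⟨n, d, hn, hd, h⟩ := hE.exists_MPlus_quotient x t i j
    exact meromorphicAt_of_quotient isOpen_Dp hn hd (fun w hw => by rw [M_of_mem_Dp hw, h]) hz
  · obtain ⟨c, i', j', hc⟩ := reflect_apply i j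
    obtain ⟨n, d, hn, hd, h⟩ := hE.exists_MPlus_quotient x t i' j'
    have hmem : ∀ z ∈ E.Dm, conj z ∈ E.Dp := fun _ => conj_mem_Dp_iff.2
    refine meromorphicAt_of_quotient isOpen_Dm
      ((differentiableOn_conj_conj isOpen_Dp hn hmem).const_mul c)
      (differentiableOn_conj_conj isOpen_Dp hd hmem) (fun w hw => ?_) hz
    rw [hE.M_of_mem_Dm hw, hc, h, map_mul, map_inv₀, mul_assoc]

lemma tendsto_MPlus {z : ℂ} (hz : z ∈ E.contour) (ha : E.a z ≠ 0) (x t : ℝ) :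
    Tendsto (E.MPlus x t) (𝓝[E.Dp] z) (𝓝 (E.MPlus x t z)) := by
  have hle : 𝓝[E.Dp] z ≤ 𝓝[E.Dp ∪ E.contour] z := nhdsWithin_mono _ subset_union_left
  have hp := tendsto_pi_nhds.1 ((hE.continuousOn_μ_plus x t z (Or.inr hz)).mono_left hle)
  have hm := tendsto_pi_nhds.1 ((hE.continuousOn_μ_minus x t z (Or.inr hz)).mono_left hle)
  have hi := (Tendsto.mono_left (hE.continuousOn_a z (Or.inr hz)) hle).inv₀ ha
  refine tendsto_pi_nhds.2 fun i => tendsto_pi_nhds.2 fun j => ?_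
  fin_cases i <;> fin_cases j
  · exact hi.mul (hp 0)
  · exact hm 0
  · exact hi.mul (hp 1)
  · exact hm 1

lemma tendsto_M_Dp {z : ℂ} (hz : z ∈ E.contour) (ha : E.a z ≠ 0) (x t : ℝ) :
    Tendsto (E.M x t) (𝓝[E.Dp] z) (𝓝 (E.MPlus x t z)) :=
  (hE.tendsto_MPlus hz ha x t).congr' (eventually_mem_nhdsWithin.mono fun _ hw =>
    (M_of_mem_Dp hw x t).symm)

lemma tendsto_M_Dm {z : ℂ} (hz : z ∈ E.contour) (ha : E.a (conj z) ≠ 0) (x t : ℝ) :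
    Tendsto (E.M x t) (𝓝[E.Dm] z) (𝓝 (E.MMinus x t z)) := by
  rw [hE.MMinus_eq (Or.inr hz)]
  have h := (hE.tendsto_MPlus (conj_mem_contour hz) ha x t).comp (tendsto_conj_Dm z)
  refine ((continuous_reflect.tendsto _).comp h).congr' ?_
  exact eventually_mem_nhdsWithin.mono fun w hw => (hE.M_of_mem_Dm hw x t).symm

lemma MPlus_eq_mul_jump {z : ℂ} (hz : z ∈ E.contour) (h0 : E.S z 0 0 ≠ 0) (h1 : E.S z 1 1 ≠ 0)
    (x t : ℝ) : E.MPlus x t z = E.MMinus x t z * E.jump x t z := by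
  have ha : E.a z = E.S z 0 0 := by rw [hE.S_symm hz]; rfl
  have ha' : conj (E.a (conj z)) = E.S z 1 1 := by rw [hE.S_symm hz]; rfl
  have hμ := hE.μMat_plus hz x t
  set e := Complex.exp (Complex.I * E.θ x t z) with he
  have e0 : e ≠ 0 := Complex.exp_ne_zero _
  have e1 : Complex.exp (-(Complex.I * E.θ x t z)) = e⁻¹ := Complex.exp_neg _
  have e2 : Complex.exp (2 * Complex.I * E.θ x t z) = e * e := by
    rw [he, ← Complex.exp_add]; ring_nf
  have e3 : Complex.exp (-(2 * Complex.I * E.θ x t z)) = e⁻¹ * e⁻¹ := by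
    rw [Complex.exp_neg, e2, mul_inv]
  -- With the columns of `μ_+` expressed by those of `μ_-`, the products `ρ ρ̃` cancel in the first
  -- column of the jump relation, so no identity for the determinant of `S` is needed.
  have c0 : ∀ i, E.μ .plus 0 x t z i =
      E.S z 0 0 * E.μ .minus 0 x t z i + e⁻¹ * e⁻¹ * E.S z 1 0 * E.μ .minus 1 x t z i := fun i => by
    have := congrFun (congrFun hμ i) 0
    fin_cases i <;> simp [μMat, ofCols, expσ₃, Matrix.mul_apply, Fin.sum_univ_two, Matrix.vecMul,
      dotProduct, e1, ← he] at this ⊢ <;> rw [this] <;> field_simp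
  have c1 : ∀ i, E.μ .plus 1 x t z i =
      e * e * E.S z 0 1 * E.μ .minus 0 x t z i + E.S z 1 1 * E.μ .minus 1 x t z i := fun i => by
    have := congrFun (congrFun hμ i) 1
    fin_cases i <;> simp [μMat, ofCols, expσ₃, Matrix.mul_apply, Fin.sum_univ_two, Matrix.vecMul,
      dotProduct, e1, ← he] at this ⊢ <;> rw [this] <;> field_simp
  ext i j
  fin_cases i <;> fin_cases j <;>
    simp [MPlus, MMinus, jump, ofCols, Matrix.mul_apply, Fin.sum_univ_two, c0, c1, ha, ha', e2, e3,
      ρ, ρTilde] <;> field_simp <;> ring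

/-! ### Behaviour at infinity -/

lemma μ_plus_isBigO_infty (x t : ℝ) (i : Fin 2) :
    (fun z => E.μ .plus 0 x t z i - ![1, 0] i) =O[Bornology.cobounded ℂ ⊓ 𝓟 E.Dp] fun z => z⁻¹ := by
  have h := (isBigO_pi.1 ((hE.isPotential .plus t).jost_isBigO_infty x) i).mono
    (inf_le_inf_left _ (principal_mono.2 (Dp_subset_zoneInt.trans (zoneInt_subset _))))
  refine h.congr' ?_ EventuallyEq.rfl
  filter_upwards [mem_inf_of_right (mem_principal_self _)] with z hz
  rw [hE.μ_plus_zero_eq (Or.inl hz)]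
  rfl

lemma μ_minus_isBigO_infty (x t : ℝ) (i : Fin 2) :
    (fun z => E.μ .minus 1 x t z i - ![0, 1] i) =O[Bornology.cobounded ℂ ⊓ 𝓟 E.Dp] fun z => z⁻¹ := by
  have hc : Tendsto (fun z : ℂ => -conj z) (Bornology.cobounded ℂ ⊓ 𝓟 E.Dp)
      (Bornology.cobounded ℂ ⊓ 𝓟 (zone E.q₀)) := by
    refine tendsto_inf.2 ⟨Tendsto.mono_left ?_ inf_le_left, tendsto_principal.2 ?_⟩
    · rw [← tendsto_norm_atTop_iff_cobounded]
      simpa using tendsto_norm_cobounded_atTop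
    · exact mem_inf_of_right fun z hz =>
        neg_conj_mem_zone_iff.2 (zoneInt_subset _ (Dp_subset_zoneInt hz))
  have h := ((hE.isPotential .minus t).jost_isBigO_infty (-x)).comp_tendsto hc
  refine IsBigO.trans (g := fun z => IsPotential.jost E.q₀ (E.pot .minus t) (E.bg .minus t)
    (-conj z) (-x) - ![1, 0]) (IsBigO.of_bound 1 ?_) (h.trans (IsBigO.of_bound 1 ?_))
  · filter_upwards [mem_inf_of_right (mem_principal_self _)] with z hz
    rw [hE.μ_minus_one_eq (Or.inl hz), one_mul]
    refine le_trans (le_of_eq ?_) ((norm_le_pi_norm _ i).trans (norm_flip_le _))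
    congr 1
    rw [flip_sub, Pi.sub_apply]
    congr 1
    fin_cases i <;> simp [flip]
  · exact Eventually.of_forall fun z => by simp

lemma a_isBigO_infty :
    (fun z => E.a z - 1) =O[Bornology.cobounded ℂ ⊓ 𝓟 E.Dp] fun z => z⁻¹ := by
  have hε : Tendsto (fun z : ℂ => z⁻¹) (Bornology.cobounded ℂ ⊓ 𝓟 E.Dp) (𝓝 0) :=
    tendsto_inv₀_cobounded.mono_left inf_le_left
  have hp := hE.μ_plus_isBigO_infty 0 0
  have hm := hE.μ_minus_isBigO_infty 0 0
  have hi : (fun z : ℂ => z⁻¹ - 0) =O[Bornology.cobounded ℂ ⊓ 𝓟 E.Dp] fun z => z⁻¹ := by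
    simpa using isBigO_refl _ _
  have hD : (fun z : ℂ => (1 + (E.q₀ : ℂ) ^ 2 / z ^ 2) - 1)
      =O[Bornology.cobounded ℂ ⊓ 𝓟 E.Dp] fun z => z⁻¹ := by
    refine ((isBigO_mul_sub_mul hε hi hi).const_mul_left ((E.q₀ : ℂ) ^ 2)).congr_left fun z => ?_
    ring
  refine (isBigO_mul_sub_mul hε (isBigO_sub_sub_sub (isBigO_mul_sub_mul hε (hp 0) (hm 1))
    (isBigO_mul_sub_mul hε (hp 1) (hm 0))) (isBigO_inv_sub_inv hε hD one_ne_zero)).congr_left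
    fun z => ?_
  rw [a_eq, wronskian]
  simp [div_eq_mul_inv]

lemma MPlus_isBigO_infty (x t : ℝ) (i j : Fin 2) : (fun z => (E.MPlus x t z - 1) i j)
    =O[Bornology.cobounded ℂ ⊓ 𝓟 E.Dp] fun z => z⁻¹ := by
  have hε : Tendsto (fun z : ℂ => z⁻¹) (Bornology.cobounded ℂ ⊓ 𝓟 E.Dp) (𝓝 0) :=
    tendsto_inv₀_cobounded.mono_left inf_le_left
  have hp := hE.μ_plus_isBigO_infty x t
  have hm := hE.μ_minus_isBigO_infty x t
  have ha := isBigO_inv_sub_inv hε hE.a_isBigO_infty one_ne_zero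
  fin_cases i <;> fin_cases j
  · exact (isBigO_mul_sub_mul hε ha (hp 0)).congr_left fun z => by simp [MPlus, ofCols]
  · exact (hm 0).congr_left fun z => by simp [MPlus, ofCols]
  · exact (isBigO_mul_sub_mul hε ha (hp 1)).congr_left fun z => by simp [MPlus, ofCols]
  · exact (hm 1).congr_left fun z => by simp [MPlus, ofCols]

omit hE in
lemma reflect_sub_one (N : Matrix (Fin 2) (Fin 2) ℂ) : reflect (N - 1) = reflect N - 1 := by
  ext i j
  fin_cases i <;> fin_cases j <;> simp [reflect]

lemma M_isBigO_infty (x t : ℝ) (i j : Fin 2) : (fun z => (E.M x t z - 1) i j)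
    =O[Bornology.cobounded ℂ ⊓ 𝓟 (E.Dp ∪ E.Dm)] fun z => z⁻¹ := by
  rw [← sup_principal, inf_sup_left]
  refine IsBigO.sup ?_ ?_
  · refine (hE.MPlus_isBigO_infty x t i j).congr' ?_ EventuallyEq.rfl
    filter_upwards [mem_inf_of_right (mem_principal_self _)] with z hz
    rw [M_of_mem_Dp hz]
  · refine (isBigO_reflect tendsto_conj_cobounded (hE.MPlus_isBigO_infty x t)
      (fun z => by simp) i j).congr' ?_ EventuallyEq.rfl
    filter_upwards [mem_inf_of_right (mem_principal_self _)] with z hz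
    rw [hE.M_of_mem_Dm hz, reflect_sub_one]

/-! ### Behaviour at the origin -/

lemma μ_plus_isBigO_zero (x t : ℝ) (i : Fin 2) :
    (fun z => z * E.μ .plus 0 x t z i - ![0, E.qLim .plus t] i) =O[𝓝[E.Dp] 0] fun z => z := by
  have h := (isBigO_pi.1 ((hE.isPotential .plus t).jost_isBigO_zero x) i).mono
    (nhdsWithin_mono _ (Dp_subset_zoneInt.trans (zoneInt_subset _)))
  refine h.congr' ?_ EventuallyEq.rfl
  filter_upwards [self_mem_nhdsWithin] with z hz
  rw [hE.μ_plus_zero_eq (Or.inl hz)]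
  simp [bg, Side.sgn]

lemma μ_minus_isBigO_zero (x t : ℝ) (i : Fin 2) :
    (fun z => z * E.μ .minus 1 x t z i - ![-conj (E.qLim .minus t), 0] i)
      =O[𝓝[E.Dp] 0] fun z => z := by
  have hc : Tendsto (fun z : ℂ => -conj z) (𝓝[E.Dp] 0) (𝓝[zone E.q₀] 0) := by
    refine tendsto_nhdsWithin_iff.2 ⟨Tendsto.mono_left ?_ nhdsWithin_le_nhds,
      eventually_mem_nhdsWithin.mono fun z hz =>
        neg_conj_mem_zone_iff.2 (zoneInt_subset _ (Dp_subset_zoneInt hz))⟩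
    have h : Tendsto (fun z : ℂ => -conj z) (𝓝 0) (𝓝 (-conj 0)) :=
      (Complex.continuous_conj.neg).tendsto 0
    simpa only [map_zero, neg_zero] using h
  have h := ((hE.isPotential .minus t).jost_isBigO_zero (-x)).comp_tendsto hc
  refine IsBigO.trans (g := fun z => -conj z • IsPotential.jost E.q₀ (E.pot .minus t)
    (E.bg .minus t) (-conj z) (-x) - ![0, E.bg .minus t]) (IsBigO.of_bound 1 ?_)
    (h.trans (IsBigO.of_bound 1 ?_))
  · filter_upwards [self_mem_nhdsWithin] with z hz
    rw [hE.μ_minus_one_eq (Or.inl hz), one_mul]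
    refine le_trans (le_of_eq ?_) ((norm_le_pi_norm _ i).trans (norm_flip_le _))
    rw [flip_sub, Pi.sub_apply, neg_smul, flip_neg, flip_smul, ← norm_neg]
    congr 1
    fin_cases i <;> simp [flip, bg, Side.sgn]
    ring
  · exact Eventually.of_forall fun z => by simp

omit hE in
-- Both ends rotate with the same phase. This reconciles `a`, which is defined from time 0, with the
-- boundary values at time `t`.
lemma qLim_ratio (t : ℝ) : E.qLim .plus t * conj (E.qLim .minus t) =
    E.qLim .plus 0 * conj (E.qLim .minus 0) := by
  have : Complex.exp (Complex.I * E.ω * t) * conj (Complex.exp (Complex.I * E.ω * t)) = 1 := by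
    rw [← Complex.exp_conj, ← Complex.exp_add]
    simp
  simp only [qLim, map_mul, Complex.ofReal_zero, mul_zero, Complex.exp_zero, mul_one]
  linear_combination (E.qPlus * conj E.qMinus) * this

/-- Each column has a simple pole at the origin. Multiplying numerator and denominator by `z²` makes
both converge, to `q_+ conj q_-` and to `q₀²`. -/
lemma a_isBigO_zero : (fun z => E.a z - E.qLim .plus 0 * conj (E.qLim .minus 0) *
    ((E.q₀ : ℂ) ^ 2)⁻¹) =O[𝓝[E.Dp] 0] fun z => z := by
  have hε : Tendsto (fun z : ℂ => z) (𝓝[E.Dp] 0) (𝓝 0) := nhdsWithin_le_nhds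
  have hp := hE.μ_plus_isBigO_zero 0 0
  have hm := hE.μ_minus_isBigO_zero 0 0
  have hi : (fun z : ℂ => z - 0) =O[𝓝[E.Dp] 0] fun z => z := by
    simpa using isBigO_refl _ _
  have hq : (E.q₀ : ℂ) ^ 2 ≠ 0 := pow_ne_zero 2 (Complex.ofReal_ne_zero.2 hE.q₀_pos.ne')
  have hD : (fun z : ℂ => (z ^ 2 + (E.q₀ : ℂ) ^ 2) - (E.q₀ : ℂ) ^ 2) =O[𝓝[E.Dp] 0] fun z => z :=
    (isBigO_mul_sub_mul hε hi hi).congr_left fun z => by ring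
  refine (isBigO_mul_sub_mul hε (isBigO_sub_sub_sub (isBigO_mul_sub_mul hε (hp 0) (hm 1))
    (isBigO_mul_sub_mul hε (hp 1) (hm 0))) (isBigO_inv_sub_inv hε hD hq)).congr' ?_
    EventuallyEq.rfl
  filter_upwards [self_mem_nhdsWithin] with z hz
  have hz' := zoneInt_subset _ (Dp_subset_zoneInt hz)
  have h0 : z ≠ 0 := hz'.1
  have h1 : z ^ 2 + (E.q₀ : ℂ) ^ 2 ≠ 0 := hz'.2.1
  have h2 : 1 + (E.q₀ : ℂ) ^ 2 / z ^ 2 = (z ^ 2 + (E.q₀ : ℂ) ^ 2) / z ^ 2 := by field_simp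
  rw [a_eq, wronskian, h2]
  simp only [cons_val_zero, cons_val_one, cons_val_fin_one]
  field_simp
  ring

lemma MPlus_isBigO_zero (x t : ℝ) (i j : Fin 2) :
    (fun z => (E.MPlus x t z + z⁻¹ • (σ₃ * E.QLim .minus t)) i j) =O[𝓝[E.Dp] 0]
      fun _ => (1 : ℂ) := by
  have hε : Tendsto (fun z : ℂ => z) (𝓝[E.Dp] 0) (𝓝 0) := nhdsWithin_le_nhds
  have hp := hE.μ_plus_isBigO_zero x t
  have hm := hE.μ_minus_isBigO_zero x t
  have hq : (E.q₀ : ℂ) ^ 2 ≠ 0 := pow_ne_zero 2 (Complex.ofReal_ne_zero.2 hE.q₀_pos.ne')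
  have hm0 := hE.qLim_mul_conj .minus t
  have hp0 := hE.qLim_mul_conj .plus t
  have hne : E.qLim .plus 0 * conj (E.qLim .minus 0) * ((E.q₀ : ℂ) ^ 2)⁻¹ ≠ 0 := by
    rw [← qLim_ratio t]
    refine mul_ne_zero (mul_ne_zero ?_ ?_) (inv_ne_zero hq)
    · exact left_ne_zero_of_mul (hp0 ▸ hq)
    · exact right_ne_zero_of_mul (hm0 ▸ hq)
  have ha := isBigO_inv_sub_inv hε hE.a_isBigO_zero hne
  have key : ∀ f : ℂ → ℂ, ∀ c, (fun z => z * f z - c) =O[𝓝[E.Dp] 0] (fun z => z) →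
      (fun z => f z - z⁻¹ * c) =O[𝓝[E.Dp] 0] fun _ => (1 : ℂ) := fun f c h => by
    refine ((isBigO_refl (fun z : ℂ => z⁻¹) _).mul h).congr' ?_ ?_ <;>
    · filter_upwards [self_mem_nhdsWithin] with z hz
      have : z ≠ 0 := (Dp_subset_zoneInt hz).1
      field_simp
  -- Division by the limit of `a` turns `q_+(t)` into `q_-(t)`; hence only `Q_-` appears in the
  -- singular part, although the first column comes from `+∞`.
  have hlim : (E.qLim .plus 0 * conj (E.qLim .minus 0) * ((E.q₀ : ℂ) ^ 2)⁻¹)⁻¹ * E.qLim .plus t =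
      E.qLim .minus t := by
    rw [inv_mul_eq_iff_eq_mul₀ hne, ← qLim_ratio t, ← hm0]
    rw [← hm0] at hq
    have := left_ne_zero_of_mul hq
    have := right_ne_zero_of_mul hq
    field_simp
  fin_cases i <;> fin_cases j
  · refine (key _ _ ((isBigO_mul_sub_mul hε ha (hp 0)).congr_left fun z => ?_)).congr_left
      (f₁ := fun z => (E.a z)⁻¹ * E.μ .plus 0 x t z 0 - z⁻¹ * 0) fun z => ?_
    · simp; ring
    · simp [MPlus, ofCols, σ₃, QLim, potential]
  · refine (key _ _ (hm 0)).congr_left fun z => ?_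
    simp [MPlus, ofCols, σ₃, QLim, potential]
  · refine (key _ _ ((isBigO_mul_sub_mul hε ha (hp 1)).congr_left fun z => ?_)).congr_left
      (f₁ := fun z => (E.a z)⁻¹ * E.μ .plus 0 x t z 1 - z⁻¹ * E.qLim .minus t) fun z => ?_
    · simp only [cons_val_one, cons_val_fin_one]; rw [hlim]; ring
    · simp [MPlus, ofCols, σ₃, QLim, potential]; ring
  · refine (key _ _ (hm 1)).congr_left fun z => ?_
    simp [MPlus, ofCols, σ₃, QLim, potential]

omit hE in
lemma reflect_add_QLim (N : Matrix (Fin 2) (Fin 2) ℂ) (s : Side) (t : ℝ) (z : ℂ) :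
    reflect (N + (conj z)⁻¹ • (σ₃ * E.QLim s t)) = reflect N + z⁻¹ • (σ₃ * E.QLim s t) := by
  ext i j
  fin_cases i <;> fin_cases j <;> simp [reflect, σ₃, QLim, potential] <;> ring

lemma M_isBigO_zero (x t : ℝ) (i j : Fin 2) :
    (fun z => (E.M x t z + z⁻¹ • (σ₃ * E.QLim .minus t)) i j) =O[𝓝[E.Dp ∪ E.Dm] 0]
      fun _ => (1 : ℂ) := by
  rw [nhdsWithin_union]
  refine IsBigO.sup ?_ ?_
  · refine (hE.MPlus_isBigO_zero x t i j).congr' ?_ EventuallyEq.rfl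
    filter_upwards [self_mem_nhdsWithin] with z hz
    rw [M_of_mem_Dp hz]
  · have hc : Tendsto conj (𝓝[E.Dm] 0) (𝓝[E.Dp] 0) := by simpa using tendsto_conj_Dm (E := E) 0
    refine (isBigO_reflect hc (hE.MPlus_isBigO_zero x t) (fun z => by simp) i j).congr' ?_
      EventuallyEq.rfl
    filter_upwards [self_mem_nhdsWithin] with z hz
    rw [hE.M_of_mem_Dm hz, reflect_add_QLim]

end IsSolution

end Data

end QNLS

end

theorem proposition3p1 (E : QNLS.Data) (hE : E.IsSolution) :
    -- the Jost columns exist and are unique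
    (∀ (s : QNLS.Side) (j : Fin 2), ∀ z ∈ E.jostDomain s j, ∃! Ψ, E.IsJostColumn s j z Ψ) ∧
    -- the scattering matrix relates them for all `x`, `t`, and `a` continues `s₁₁`
    (∀ z ∈ E.contour,
      E.S z = !![E.a z, -conj (E.b (conj z)); E.b z, conj (E.a (conj z))] ∧
      ∀ x t : ℝ, E.μMat .plus x t z =
        E.μMat .minus x t z * QNLS.Data.expσ₃ (E.θ x t z) * E.S z
          * QNLS.Data.expσ₃ (-(E.θ x t z))) ∧
    DifferentiableOn ℂ E.a E.Dp ∧ ContinuousOn E.a (E.Dp ∪ E.contour) ∧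
    ∀ x t : ℝ,
      -- analyticity
      (∀ i j, MeromorphicOn (fun z => E.M x t z i j) (E.Dp ∪ E.Dm)) ∧
      -- boundary values and jump condition
      (∀ z ∈ E.contour, E.S z 0 0 ≠ 0 → E.S z 1 1 ≠ 0 →
        Tendsto (E.M x t) (𝓝[E.Dp] z) (𝓝 (E.MPlus x t z)) ∧
        Tendsto (E.M x t) (𝓝[E.Dm] z) (𝓝 (E.MMinus x t z)) ∧
        E.MPlus x t z = E.MMinus x t z * E.jump x t z) ∧
      -- behaviour at infinity
      (∀ i j, (fun z => (E.M x t z - 1) i j)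
        =O[Bornology.cobounded ℂ ⊓ 𝓟 (E.Dp ∪ E.Dm)] fun z => z⁻¹) ∧
      -- behaviour at the origin
      (∀ i j, (fun z => (E.M x t z + z⁻¹ • (QNLS.Data.σ₃ * E.QLim .minus t)) i j)
        =O[𝓝[E.Dp ∪ E.Dm] 0] fun _ => (1 : ℂ)) := by
  refine ⟨fun s j z hz => hE.existsUnique_isJostColumn hz,
    fun z hz => ⟨hE.S_symm hz, hE.μMat_plus hz⟩, hE.differentiableOn_a, hE.continuousOn_a,
    fun x t => ⟨hE.meromorphicOn_M x t, fun z hz h0 h1 => ⟨?_, ?_, hE.MPlus_eq_mul_jump hz h0 h1 x t⟩,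
      hE.M_isBigO_infty x t, hE.M_isBigO_zero x t⟩⟩
  · rw [hE.S_symm hz] at h0
    exact hE.tendsto_M_Dp hz h0 x t
  · rw [hE.S_symm hz] at h1
    exact hE.tendsto_M_Dm hz ((map_ne_zero (starRingEnd ℂ)).1 h1) x t
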